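/- Let $\Bbbk$ be an algebraically closed field of characteristic $0$, let $G$ be a simple affine algebraic group over $\Bbbk$ (connected, non-commutative, without closed connected normal subgroups other than $1$ and $G$) with Lie algebra $\mathfrak g$, and let $H\subset G$ be a reductive algebraic subgroup with Lie algebra $\mathfrak h$. Let $\mathfrak m=\mathfrak h^{\perp}$ be the orthogonal complement of $\mathfrak h$ in $\mathfrak g$ with respect to the Killing form of $\mathfrak g$. For $x\in\mathfrak g$ let $H^x$ be the stabiliser of $x$ in $H$ under the adjoint action and $\mathfrak h^x=\mathrm{Lie}(H^x)$. Let $\mathcal O\subset\mathfrak g$ be a nilpotent $G$-orbit with Zariski closure $\overline{\mathcal O}$, and suppose that $\overline{\mathcal O}\cap\mathfrak m=\{0\}$. Then $\mathfrak g=\mathfrak h\oplus\mathfrak m$, and, if $\varphi:\mathfrak g\to\mathfrak h$ denotes the projection along $\mathfrak m$, the following hold. 1. The morphism $\varphi:\overline{\mathcal O}\to\mathfrak h$ is finite, $\overline{\varphi(\mathcal O)}=\varphi(\overline{\mathcal O})$, and $\dim\varphi(\mathcal O)=\dim\mathcal O$. 2. For every $e\in\overline{\mathcal O}$, with $e=a+b$,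 $a=\varphi(e)\in\mathfrak h$ and $b\in\mathfrak m$, one has $[a,b]=0$ and $\mathfrak h^a\subset\mathfrak h^b$. 3. If $\mathcal O\neq\{0\}$, then the centraliser of $\mathfrak h$ in $\mathfrak g$ is trivial, and $\mathfrak h$ is semisimple. -/

import Mathlib

open scoped Matrix MatrixGroups

attribute [local instance] LieRing.ofAssociativeRing

noncomputable section

namespace NilpProj

section Varieties

variable (k : Type*) [Field k] {V W : Type*}
  [AddCommGroup V] [Module k V] [AddCommGroup W] [Module k W]

/-- The algebra `k[V]` of polynomial functions on a (finite-dimensional) vector space `V`: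
the algebra of functions generated by the linear forms. -/
def polyFun (V : Type*) [AddCommGroup V] [Module k V] : Subalgebra k (V → k) :=
  Algebra.adjoin k (Set.range fun l : Module.Dual k V => (l : V → k))

/-- The Zariski topology on `V`: the principal open sets `{p ≠ 0}` form a base. -/
@[reducible] def zariski (V : Type*) [AddCommGroup V] [Module k V] : TopologicalSpace V :=
  TopologicalSpace.generateFrom {U | ∃ p ∈ polyFun k V, U = {v | p v ≠ 0}}

/-- The Zariski closure of a subset of `V`. -/
def zclosure (X : Set V) : Set V := @closure V (zariski k V) X

/-- The algebra of regular functions `k[X]` on a Zariski closed subset `X` of `V`: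
the restrictions to `X` of the polynomial functions on `V`. -/
def regFun (X : Set V) : Subalgebra k (X → k) :=
  (polyFun k V).map
    (AlgHom.pi (R := k) (A := fun _ : X => k) fun x => Pi.evalAlgHom k (fun _ : V => k) (x : V))

/-- The dimension of a (constructible) subset of `V`: the dimension of its Zariski closure `Z`,
that is, the Krull dimension of `k[Z]`. -/
def zdim (X : Set V) : WithBot ℕ∞ := ringKrullDim (regFun k (zclosure k X))

/-- Precomposition with a map `f : X → Y`. -/
def pullback {X : Set V} {Y : Set W} (f : X → Y) : (Y → k) →ₐ[k] (X → k) :=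
  AlgHom.pi (R := k) (A := fun _ : X => k) fun x => Pi.evalAlgHom k (fun _ : Y => k) (f x)

/-- `f : X → Y` is a finite morphism of affine varieties (closed subsets of vector spaces):
it pulls regular functions back to regular functions, and `k[X]` is thereby a finitely generated
`k[Y]`-module. -/
def IsFiniteMorphism {X : Set V} {Y : Set W} (f : X → Y) : Prop :=
  ∃ hf : ∀ q : regFun k Y, pullback k f q ∈ regFun k X,
    RingHom.Finite
      ((((pullback k f).comp (regFun k Y).val).codRestrict (regFun k X) hf : _ →ₐ[k] _) :
        regFun k Y →+* regFun k X)

end Varieties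

section Groups

variable {k : Type*} [Field k] {n : ℕ}

/-- The Zariski topology on `GL n k`, an open subset of the space of matrices. -/
@[reducible] def zariskiGL (k : Type*) [Field k] (n : ℕ) : TopologicalSpace (GL (Fin n) k) :=
  TopologicalSpace.induced (fun g => (g : Matrix (Fin n) (Fin n) k))
    (zariski k (Matrix (Fin n) (Fin n) k))

/-- `G` is an algebraic subgroup of `GL n k`, i.e. Zariski closed. -/
def IsAlgebraic (G : Subgroup (GL (Fin n) k)) : Prop :=
  @IsClosed _ (zariskiGL k n) (G : Set (GL (Fin n) k))

/-- `G` is connected in the Zariski topology. -/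
def IsConn (G : Subgroup (GL (Fin n) k)) : Prop :=
  @IsConnected _ (zariskiGL k n) (G : Set (GL (Fin n) k))

/-- All elements of `G` are unipotent matrices. -/
def IsUnip (G : Subgroup (GL (Fin n) k)) : Prop :=
  ∀ g ∈ G, IsNilpotent ((g : Matrix (Fin n) (Fin n) k) - 1)

/-- `G` is a simple algebraic group: a connected non-commutative algebraic group
without closed connected normal subgroups other than `1` and `G`. -/
structure IsSimpleAlgGroup (G : Subgroup (GL (Fin n) k)) : Prop where
  isAlgebraic : IsAlgebraic G
  isConn : IsConn G
  noncomm : ∃ x ∈ G, ∃ y ∈ G, x * y ≠ y * x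
  simple : ∀ N : Subgroup (GL (Fin n) k), N ≤ G → (N.subgroupOf G).Normal →
    IsAlgebraic N → IsConn N → N = ⊥ ∨ N = G

/-- `H` is a (not necessarily connected) reductive algebraic group: its unipotent radical is
trivial. -/
structure IsReductive (H : Subgroup (GL (Fin n) k)) : Prop where
  isAlgebraic : IsAlgebraic H
  unipRadical : ∀ N : Subgroup (GL (Fin n) k), N ≤ H → (N.subgroupOf H).Normal →
    IsAlgebraic N → IsConn N → IsUnip N → N = ⊥

/-- The ideal `I(G)` of the polynomials in the matrix entries that vanish on `G`. -/
def groupIdeal (G : Subgroup (GL (Fin n) k)) : Ideal (MvPolynomial (Fin n × Fin n) k) :=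
  MvPolynomial.vanishingIdeal k
    ((fun g : GL (Fin n) k => fun ij : Fin n × Fin n => g ij.1 ij.2) '' (G : Set (GL (Fin n) k)))

/-- The left invariant derivation of `k[x_ij]` attached to a matrix `A`; on the generic matrix
`x = (x_ij)` it is `x ↦ x * A`. -/
def leftDer (A : Matrix (Fin n) (Fin n) k) :
    Derivation k (MvPolynomial (Fin n × Fin n) k) (MvPolynomial (Fin n × Fin n) k) :=
  MvPolynomial.mkDerivation k fun ij =>
    ∑ l, A l ij.2 • (MvPolynomial.X (ij.1, l) : MvPolynomial (Fin n × Fin n) k)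

theorem leftDer_X (A : Matrix (Fin n) (Fin n) k) (i j : Fin n) :
    leftDer A (MvPolynomial.X (i, j)) =
      ∑ l, A l j • (MvPolynomial.X (i, l) : MvPolynomial (Fin n × Fin n) k) := by
  simp [leftDer, MvPolynomial.mkDerivation_X]

theorem leftDer_add (A B : Matrix (Fin n) (Fin n) k) :
    leftDer (A + B) = leftDer A + leftDer B := by
  apply MvPolynomial.derivation_ext
  rintro ⟨i, j⟩
  simp [leftDer_X, add_smul, Finset.sum_add_distrib]

theorem leftDer_zero : leftDer (0 : Matrix (Fin n) (Fin n) k) = 0 := by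
  apply MvPolynomial.derivation_ext
  rintro ⟨i, j⟩
  simp [leftDer_X]

theorem leftDer_smul (c : k) (A : Matrix (Fin n) (Fin n) k) :
    leftDer (c • A) = c • leftDer A := by
  apply MvPolynomial.derivation_ext
  rintro ⟨i, j⟩
  simp [leftDer_X, Finset.smul_sum, mul_smul]

theorem leftDer_lie (A B : Matrix (Fin n) (Fin n) k) :
    leftDer ⁅A, B⁆ = ⁅leftDer A, leftDer B⁆ := by
  apply MvPolynomial.derivation_ext
  rintro ⟨i, j⟩
  simp only [leftDer_X, Derivation.commutator_apply, map_sum, Derivation.map_smul,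
    Ring.lie_def, Matrix.sub_apply, Matrix.mul_apply, sub_smul, Finset.sum_sub_distrib,
    Finset.sum_smul, Finset.smul_sum, smul_smul]
  congr 1
  · rw [Finset.sum_comm]
    simp only [mul_comm]
  · rw [Finset.sum_comm]
    simp only [mul_comm]

/-- The Lie algebra of an algebraic subgroup `G` of `GL n k`: the matrices whose left invariant
derivation preserves `I(G)`, i.e. induces a left invariant derivation of `k[G]`. -/
def lieAlg (G : Subgroup (GL (Fin n) k)) : LieSubalgebra k (Matrix (Fin n) (Fin n) k) where
  carrier := {A | ∀ p ∈ groupIdeal G, leftDer A p ∈ groupIdeal G}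
  add_mem' {A B} hA hB p hp := by
    rw [leftDer_add]
    exact add_mem (hA p hp) (hB p hp)
  zero_mem' p _ := by
    rw [leftDer_zero]
    exact zero_mem _
  smul_mem' c A hA p hp := by
    rw [leftDer_smul, Derivation.smul_apply, MvPolynomial.smul_eq_C_mul]
    exact Ideal.mul_mem_left _ _ (hA p hp)
  lie_mem' {A B} hA hB p hp := by
    rw [leftDer_lie, Derivation.commutator_apply]
    exact sub_mem (hA _ (hB p hp)) (hB _ (hA p hp))

/-- The Lie algebra of a subgroup `H` of `G`, as a subalgebra of the Lie algebra of `G`. -/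
def lieSub (G H : Subgroup (GL (Fin n) k)) : LieSubalgebra k (lieAlg G) :=
  (lieAlg H).comap (lieAlg G).incl

/-- The orbit of `x` under the adjoint action of `G` on its Lie algebra. -/
def adOrbit (G : Subgroup (GL (Fin n) k)) (x : lieAlg G) : Set (lieAlg G) :=
  {y | ∃ g ∈ G, (y : Matrix (Fin n) (Fin n) k) =
    (g : Matrix (Fin n) (Fin n) k) * x * ((g⁻¹ : GL (Fin n) k) : Matrix (Fin n) (Fin n) k)}

/-- The stabiliser `H ^ x` of a matrix `x` under the adjoint action of `H`. -/
def adStab (H : Subgroup (GL (Fin n) k)) (x : Matrix (Fin n) (Fin n) k) :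
    Subgroup (GL (Fin n) k) where
  carrier := {g | g ∈ H ∧ (g : Matrix (Fin n) (Fin n) k) * x *
    ((g⁻¹ : GL (Fin n) k) : Matrix (Fin n) (Fin n) k) = x}
  one_mem' := ⟨one_mem H, by simp⟩
  mul_mem' {g h} hg hh := ⟨mul_mem hg.1 hh.1, by
    have h1 := hg.2
    conv at h1 => lhs; rw [← hh.2]
    simpa only [mul_inv_rev, Units.val_mul, mul_assoc] using h1⟩
  inv_mem' {g} hg := ⟨inv_mem hg.1, by
    have h1 := congrArg (fun y => ((g⁻¹ : GL (Fin n) k) : Matrix (Fin n) (Fin n) k) * y *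
      (g : Matrix (Fin n) (Fin n) k)) hg.2
    simpa [mul_assoc] using h1.symm⟩

/-- The orthogonal complement of `Lie H` in `Lie G` with respect to the Killing form of `Lie G`. -/
def orthCompl (G H : Subgroup (GL (Fin n) k)) : Submodule k (lieAlg G) :=
  (killingForm k (lieAlg G)).orthogonal (lieSub G H).toSubmodule

end Groups

end NilpProj

end

/-!
Write `𝔤`, `𝔥` for the Lie algebras of `G`, `H`, let `𝔪` be the orthogonal complement of `𝔥` and
`X` the closure of the orbit of `x`.

*Lie algebra and group.* In characteristic zero the Lie algebra of an algebraic group is tied to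
the group by rational curves. If `A` lies in the Lie algebra, then so do the replicas of its
semisimple part, the matrices that act on the generalised eigenspaces of `A` as `f μ` for an
additive function `f` (`scalM_mem_lieAlg`). Replicas with integral eigenvalues integrate to
one-parameter subgroups (`torus_mem`), nilpotent elements exponentiate (`evm_expM_eq_zero`), and
`A` is a combination of chords `γ t - 1` of such curves, which commute with everything that
commutes with `A` (`mem_span_curves`). A family of curves stable under conjugation generates a
closed connected normal subgroup (`exists_closed_normal_of_curves`); this is how simplicity of `G`
and reductivity of `H` are used.

*Decomposition of `𝔤`.* An element of the radical of the Killing form of `𝔤` restricted to `𝔥` is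
orthogonal to its own replicas, hence nilpotent. By Engel's theorem the radical exponentiates to a
normal unipotent subgroup of `H`, so it is zero (`killingRad_eq_bot`) and `𝔤 = 𝔥 ⊕ 𝔪`. For `H = G`
the same argument shows that the Killing form of `𝔤` is nondegenerate.

*Finiteness.* Nondegeneracy gives `h` with `[h, x] = x`, and one-parameter subgroups made from
replicas of `h` scale `x`; so `X` is a closed cone (`smul_mem_adOrbit`). A linear map whose kernel
meets a closed cone only in the origin is finite on the cone, by the Nullstellensatz and a graded
version of Nakayama's lemma (`finite_comorphism_of_cone`). Closedness of the image, equality of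
dimensions and finiteness of the fibres follow from integrality.

*Commutation and semisimplicity.* A rational curve that moves `e ∈ X` within a finite fibre of the
projection `φ` fixes `e` (`IsCurve.commute_of_finite`). Curves in `H` that commute with `a = φ e`
are of this kind, whence `[a, e] = 0`; the stabilizer of `a` in `H` also moves `e` within the
fibre, which gives the inclusion of Lie algebras (`lieAlg_le_of_finite`). Curves in `G` that
commute with `𝔥` preserve the fibres too, so the centralizer of `𝔥` commutes with the orbit, and
it is trivial because the closed subgroup of `G` generated by the curves that commute with the
orbit is normal (`centralizer_eq_zero`). Finally, for `y` in an abelian ideal of `𝔥`, `(ad y)²`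
kills `𝔥`, so the semisimple part of `y` centralizes `𝔥` and vanishes. Then `y` is ad-nilpotent,
and Engel's theorem shows that it is orthogonal to `𝔥`; so `𝔥` has no nonzero abelian ideals, and
having a nondegenerate invariant form it is semisimple (`isSemisimple_lieSub`).
-/

noncomputable section

namespace NilpProj

/-! ### Directional derivatives of polynomials and the Lie algebra of a group -/

section Points

variable {k : Type*} [Field k] {n : ℕ}

/-- Evaluation of a polynomial in the matrix entries at a matrix with entries in a `k`-algebra. -/
def evm {R : Type*} [CommRing R] [Algebra k R] (M : Matrix (Fin n) (Fin n) R) :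
    MvPolynomial (Fin n × Fin n) k →ₐ[k] R :=
  MvPolynomial.aeval fun ij => M ij.1 ij.2

@[simp] theorem evm_X {R : Type*} [CommRing R] [Algebra k R] (M : Matrix (Fin n) (Fin n) R)
    (i j : Fin n) : evm (k := k) M (MvPolynomial.X (i, j)) = M i j := by
  simp [evm]

theorem mem_groupIdeal {G : Subgroup (GL (Fin n) k)} {p : MvPolynomial (Fin n × Fin n) k} :
    p ∈ groupIdeal G ↔ ∀ g ∈ G, evm (g : Matrix (Fin n) (Fin n) k) p = 0 := by
  simp [groupIdeal, MvPolynomial.mem_vanishingIdeal_iff, evm]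

/-- The tangent vector `M + ε B` at `M`, as a matrix over the dual numbers. -/
def tangent (M B : Matrix (Fin n) (Fin n) k) : Matrix (Fin n) (Fin n) (DualNumber k) :=
  fun i j => TrivSqZeroExt.inl (M i j) + TrivSqZeroExt.inr (B i j)

/-- The derivative of the polynomial `p` at the matrix `M` in the direction `B`: the coefficient
of `ε` in `p (M + ε B)`. -/
def dir (M B : Matrix (Fin n) (Fin n) k) (p : MvPolynomial (Fin n × Fin n) k) : k :=
  (evm (tangent M B) p).snd

theorem evm_tangent_fst (M B : Matrix (Fin n) (Fin n) k) (p : MvPolynomial (Fin n × Fin n) k) :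
    (evm (tangent M B) p).fst = evm M p := by
  have : (TrivSqZeroExt.fstHom k k k).comp (evm (tangent M B)) = evm M := by
    apply MvPolynomial.algHom_ext
    rintro ⟨i, j⟩
    simp [tangent]
  exact DFunLike.congr_fun this p

@[simp] theorem dir_X (M B : Matrix (Fin n) (Fin n) k) (i j : Fin n) :
    dir M B (MvPolynomial.X (i, j)) = B i j := by
  simp [dir, tangent]

@[simp] theorem dir_C (M B : Matrix (Fin n) (Fin n) k) (c : k) :
    dir M B (MvPolynomial.C c) = 0 := by
  simp [dir, evm]
  rfl

theorem dir_add (M B : Matrix (Fin n) (Fin n) k) (p q : MvPolynomial (Fin n × Fin n) k) :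
    dir M B (p + q) = dir M B p + dir M B q := by
  simp [dir]

theorem dir_mul (M B : Matrix (Fin n) (Fin n) k) (p q : MvPolynomial (Fin n × Fin n) k) :
    dir M B (p * q) = evm M p * dir M B q + evm M q * dir M B p := by
  simp [dir, evm_tangent_fst, mul_comm]

/-- The left invariant derivation attached to `A` differentiates at `M` in the direction `M * A`. -/
theorem evm_leftDer (M A : Matrix (Fin n) (Fin n) k) (p : MvPolynomial (Fin n × Fin n) k) :
    evm M (leftDer A p) = dir M (M * A) p := by
  induction p using MvPolynomial.induction_on with
  | C a => simp [← MvPolynomial.algebraMap_eq]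
  | add p q hp hq => simp [dir_add, hp, hq]
  | mul_X p ij hp =>
    obtain ⟨i, j⟩ := ij
    rw [Derivation.leibniz, map_add, smul_eq_mul, smul_eq_mul, map_mul, map_mul, hp, dir_mul,
      leftDer_X]
    simp [Matrix.mul_apply, mul_comm]

/-- The substitution `x ↦ L x` attached to a linear endomorphism `L` of the space of matrices. -/
def subst (L : Matrix (Fin n) (Fin n) k →ₗ[k] Matrix (Fin n) (Fin n) k) :
    MvPolynomial (Fin n × Fin n) k →ₐ[k] MvPolynomial (Fin n × Fin n) k :=
  MvPolynomial.aeval fun ij => ∑ a, ∑ b, L (Matrix.single a b 1) ij.1 ij.2 •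
    (MvPolynomial.X (a, b) : MvPolynomial (Fin n × Fin n) k)

theorem linearForm_apply (l : Matrix (Fin n) (Fin n) k →ₗ[k] k)
    (M : Matrix (Fin n) (Fin n) k) : l M = ∑ a, ∑ b, l (Matrix.single a b 1) * M a b := by
  conv_lhs => rw [Matrix.matrix_eq_sum_single M]
  simp only [map_sum]
  refine Finset.sum_congr rfl fun a _ => Finset.sum_congr rfl fun b _ => ?_
  have : Matrix.single a b (M a b) = M a b • Matrix.single a b (1 : k) := by simp
  rw [this, map_smul, smul_eq_mul, mul_comm]

theorem linearMap_apply_apply (L : Matrix (Fin n) (Fin n) k →ₗ[k] Matrix (Fin n) (Fin n) k)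
    (M : Matrix (Fin n) (Fin n) k) (i j : Fin n) :
    L M i j = ∑ a, ∑ b, L (Matrix.single a b 1) i j * M a b :=
  linearForm_apply (Matrix.entryLinearMap k k i j ∘ₗ L) M

theorem evm_subst (L : Matrix (Fin n) (Fin n) k →ₗ[k] Matrix (Fin n) (Fin n) k)
    (M : Matrix (Fin n) (Fin n) k) (p : MvPolynomial (Fin n × Fin n) k) :
    evm M (subst L p) = evm (L M) p := by
  have : (evm M).comp (subst L) = evm (L M) := by
    apply MvPolynomial.algHom_ext
    rintro ⟨i, j⟩
    simp [subst, linearMap_apply_apply L M i j]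
  exact DFunLike.congr_fun this p

theorem dir_subst (L : Matrix (Fin n) (Fin n) k →ₗ[k] Matrix (Fin n) (Fin n) k)
    (M B : Matrix (Fin n) (Fin n) k) (p : MvPolynomial (Fin n × Fin n) k) :
    dir M B (subst L p) = dir (L M) (L B) p := by
  have : (evm (tangent M B)).comp (subst L) = evm (tangent (L M) (L B)) := by
    apply MvPolynomial.algHom_ext
    rintro ⟨i, j⟩
    simp only [AlgHom.comp_apply, subst, MvPolynomial.aeval_X, map_sum, map_smul, evm_X]
    ext
    · simp [tangent, linearMap_apply_apply L M i j, TrivSqZeroExt.fst_sum]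
    · simp [tangent, linearMap_apply_apply L B i j, TrivSqZeroExt.snd_sum]
  exact congrArg TrivSqZeroExt.snd (DFunLike.congr_fun this p)

theorem leftDer_subst_mulLeft (g A : Matrix (Fin n) (Fin n) k)
    (p : MvPolynomial (Fin n × Fin n) k) :
    dir 1 A (subst (LinearMap.mulLeft k g) p) = dir g (g * A) p := by
  simp [dir_subst]

/-- Tangent vectors at `1` suffice: `A` is in the Lie algebra of `G` iff all polynomials that
vanish on `G` have derivative zero at `1` in the direction `A`. -/
theorem mem_lieAlg_iff {G : Subgroup (GL (Fin n) k)} {A : Matrix (Fin n) (Fin n) k} :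
    A ∈ lieAlg G ↔ ∀ p ∈ groupIdeal G, dir 1 A p = 0 := by
  constructor
  · intro h p hp
    have := mem_groupIdeal.1 (h p hp) 1 (one_mem G)
    simpa [evm_leftDer] using this
  · intro h p hp
    refine mem_groupIdeal.2 fun g hg => ?_
    rw [evm_leftDer, ← leftDer_subst_mulLeft]
    refine h _ (mem_groupIdeal.2 fun g' hg' => ?_)
    rw [evm_subst]
    simpa using mem_groupIdeal.1 hp (g * g') (mul_mem hg hg')

theorem lieAlg_mono {H G : Subgroup (GL (Fin n) k)} (h : H ≤ G) : lieAlg H ≤ lieAlg G := by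
  intro A hA
  rw [mem_lieAlg_iff] at hA ⊢
  exact fun p hp => hA p (mem_groupIdeal.2 fun g hg => mem_groupIdeal.1 hp g (h hg))

theorem conj_mem_lieAlg {G : Subgroup (GL (Fin n) k)} {g : GL (Fin n) k} (hg : g ∈ G)
    {A : Matrix (Fin n) (Fin n) k} (hA : A ∈ lieAlg G) :
    (g : Matrix (Fin n) (Fin n) k) * A * ((g⁻¹ : GL (Fin n) k) : Matrix (Fin n) (Fin n) k)
      ∈ lieAlg G := by
  rw [mem_lieAlg_iff] at hA ⊢
  intro p hp
  let L : Matrix (Fin n) (Fin n) k →ₗ[k] Matrix (Fin n) (Fin n) k :=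
    (LinearMap.mulRight k ((g⁻¹ : GL (Fin n) k) : Matrix (Fin n) (Fin n) k)).comp
      (LinearMap.mulLeft k (g : Matrix (Fin n) (Fin n) k))
  have hL : ∀ M, L M = (g : Matrix (Fin n) (Fin n) k) * M *
    ((g⁻¹ : GL (Fin n) k) : Matrix (Fin n) (Fin n) k) := fun M => rfl
  have := hA (subst L p) (mem_groupIdeal.2 fun g' hg' => by
    rw [evm_subst, hL]
    simpa using mem_groupIdeal.1 hp (g * g' * g⁻¹) (mul_mem (mul_mem hg hg') (inv_mem hg)))
  rw [dir_subst, hL, hL] at this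
  simpa [← Units.val_mul] using this

/-- The polynomial of degree one attached to a linear form on matrices. -/
def linPoly (l : Matrix (Fin n) (Fin n) k →ₗ[k] k) : MvPolynomial (Fin n × Fin n) k :=
  ∑ a, ∑ b, MvPolynomial.C (l (Matrix.single a b 1)) * MvPolynomial.X (a, b)

@[simp] theorem evm_linPoly (l : Matrix (Fin n) (Fin n) k →ₗ[k] k)
    (M : Matrix (Fin n) (Fin n) k) : evm M (linPoly l) = l M := by
  rw [linearForm_apply l M]
  simp [linPoly, ← MvPolynomial.algebraMap_eq]

theorem dir_linPoly (l : Matrix (Fin n) (Fin n) k →ₗ[k] k)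
    (M B : Matrix (Fin n) (Fin n) k) : dir M B (linPoly l) = l B := by
  rw [linearForm_apply l B]
  have h : ∀ (s : Finset (Fin n)) (f : Fin n → MvPolynomial (Fin n × Fin n) k),
      dir M B (∑ a ∈ s, f a) = ∑ a ∈ s, dir M B (f a) := by
    intro s f
    simp [dir, TrivSqZeroExt.snd_sum]
  simp [linPoly, h, dir_mul, ← MvPolynomial.algebraMap_eq]

/-- A linear equation satisfied by the group is satisfied, without its constant term, by the Lie
algebra. -/
theorem linear_eq_zero_of_mem_lieAlg {G : Subgroup (GL (Fin n) k)}
    (l : Matrix (Fin n) (Fin n) k →ₗ[k] k) (c : k)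
    (h : ∀ g ∈ G, l (g : Matrix (Fin n) (Fin n) k) = c)
    {A : Matrix (Fin n) (Fin n) k} (hA : A ∈ lieAlg G) : l A = 0 := by
  have := mem_lieAlg_iff.1 hA (linPoly l + MvPolynomial.C (-c)) (mem_groupIdeal.2 fun g hg => by
    rw [map_add, evm_linPoly, h g hg, ← MvPolynomial.algebraMap_eq, AlgHom.commutes]
    simp)
  rwa [dir_add, dir_linPoly, dir_C, add_zero] at this

/-- `linear_eq_zero_of_mem_lieAlg` for linear maps with values in a vector space. -/
theorem linearMap_eq_zero_of_mem_lieAlg {G : Subgroup (GL (Fin n) k)} {V : Type*}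
    [AddCommGroup V] [Module k V] (l : Matrix (Fin n) (Fin n) k →ₗ[k] V) (c : V)
    (h : ∀ g ∈ G, l (g : Matrix (Fin n) (Fin n) k) = c)
    {A : Matrix (Fin n) (Fin n) k} (hA : A ∈ lieAlg G) : l A = 0 := by
  by_contra hne
  obtain ⟨f, hf⟩ := (Module.forall_dual_apply_eq_zero_iff k (l A)).not.2 hne |> not_forall.1
  exact hf (linear_eq_zero_of_mem_lieAlg (f ∘ₗ l) (f c) (fun g hg => by simp [h g hg]) hA)

end Points

/-! ### Generalised eigenspaces and replicas of an endomorphism -/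

section Replicas
open Module

variable {k : Type*} [Field k]

/-- A linear map that intertwines two endomorphisms maps generalised eigenspaces to generalised
eigenspaces. -/
theorem map_mem_maxGenEigenspace {U W : Type*} [AddCommGroup U] [Module k U] [AddCommGroup W]
    [Module k W] (j : U →ₗ[k] W) {T : End k U} {S : End k W} (h : ∀ u, j (T u) = S (j u)) {μ : k}
    {u : U} (hu : u ∈ T.maxGenEigenspace μ) : j u ∈ S.maxGenEigenspace μ := by
  rw [End.mem_maxGenEigenspace] at hu ⊢
  obtain ⟨m, hm⟩ := hu
  refine ⟨m, ?_⟩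
  have : ∀ (m : ℕ) (u : U), ((S - μ • (1 : End k W)) ^ m) (j u) =
      j (((T - μ • (1 : End k U)) ^ m) u) := by
    intro m
    induction m with
    | zero => simp
    | succ m ih =>
      intro u
      rw [pow_succ, Module.End.mul_apply, pow_succ, Module.End.mul_apply, ← ih]
      congr 1
      simp [h]
  rw [this, hm, map_zero]

/-- The Leibniz rule shifts by `μ`, `ν` and `μ + ν` without losing its form; so if `i` and `j` steps
kill `u` and `v`, then `i + j` steps kill `B u v`. -/
theorem bilin_pow_apply_eq_zero {U V W : Type*} [AddCommGroup U] [Module k U] [AddCommGroup V]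
    [Module k V] [AddCommGroup W] [Module k W] (B : U →ₗ[k] V →ₗ[k] W) (TU : End k U)
    (TV : End k V) (TW : End k W) (h : ∀ u v, TW (B u v) = B (TU u) v + B u (TV v)) (μ ν : k)
    (N i j : ℕ) (hij : i + j = N) (u : U) (v : V) (hu : ((TU - μ • (1 : End k U)) ^ i) u = 0)
    (hv : ((TV - ν • (1 : End k V)) ^ j) v = 0) :
    ((TW - (μ + ν) • (1 : End k W)) ^ N) (B u v) = 0 := by
  induction N generalizing i j u v with
  | zero =>
    obtain rfl : i = 0 := by omega
    have : u = 0 := by simpa using hu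
    simp [this]
  | succ N ih =>
    rcases Nat.eq_zero_or_pos i with rfl | hi
    · have : u = 0 := by simpa using hu
      simp [this]
    rcases Nat.eq_zero_or_pos j with rfl | hj
    · have : v = 0 := by simpa using hv
      simp [this]
    have key : (TW - (μ + ν) • (1 : End k W)) (B u v) =
        B ((TU - μ • (1 : End k U)) u) v + B u ((TV - ν • (1 : End k V)) v) := by
      simp only [LinearMap.sub_apply, LinearMap.smul_apply, Module.End.one_apply, h, map_sub,
        map_smul, add_smul, LinearMap.add_apply]
      abel
    rw [pow_succ, Module.End.mul_apply, key, map_add, ih (i - 1) j (by omega) _ _ _ hv,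
      ih i (j - 1) (by omega) _ _ hu, add_zero]
    · rwa [← Module.End.mul_apply, ← pow_succ, Nat.sub_add_cancel hj]
    · rwa [← Module.End.mul_apply, ← pow_succ, Nat.sub_add_cancel hi]

/-- Generalised eigenvalues add up under a bilinear map for which the operators satisfy the
Leibniz rule. -/
theorem bilin_mem_maxGenEigenspace {U V W : Type*} [AddCommGroup U] [Module k U] [AddCommGroup V]
    [Module k V] [AddCommGroup W] [Module k W] (B : U →ₗ[k] V →ₗ[k] W) {TU : End k U}
    {TV : End k V} {TW : End k W} (h : ∀ u v, TW (B u v) = B (TU u) v + B u (TV v)) {μ ν : k}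
    {u : U} {v : V} (hu : u ∈ TU.maxGenEigenspace μ) (hv : v ∈ TV.maxGenEigenspace ν) :
    B u v ∈ TW.maxGenEigenspace (μ + ν) := by
  rw [End.mem_maxGenEigenspace] at hu hv ⊢
  obtain ⟨i, hi⟩ := hu
  obtain ⟨j, hj⟩ := hv
  exact ⟨i + j, bilin_pow_apply_eq_zero B TU TV TW h μ ν _ i j rfl u v hi hj⟩

/-- Components of a vector of a stable subspace in the generalised eigenspaces lie in the
subspace; the ambient space may have infinite dimension. -/
theorem mem_of_sum_mem_of_maxGenEigenspace {V : Type*} [AddCommGroup V] [Module k V]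
    (T : End k V) (p : Submodule k V) (hp : ∀ x ∈ p, T x ∈ p) (s : Finset k) (x : k → V)
    (hx : ∀ μ ∈ s, x μ ∈ T.maxGenEigenspace μ) (hsum : ∑ μ ∈ s, x μ ∈ p) :
    ∀ μ ∈ s, x μ ∈ p := by
  classical
  have hpoly : ∀ (q : Polynomial k), ∀ y ∈ p, Polynomial.aeval T q y ∈ p := by
    intro q y hy
    induction q using Polynomial.induction_on generalizing y with
    | C a => simpa using p.smul_mem a hy
    | add q r hq hr => simpa using p.add_mem (hq y hy) (hr y hy)
    | monomial m a ih =>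
      rw [pow_succ, ← mul_assoc, map_mul, Module.End.mul_apply, Polynomial.aeval_X]
      exact ih _ (hp y hy)
  induction s using Finset.induction_on generalizing x with
  | empty => simp
  | insert μ₀ s hμ₀ ih =>
    obtain ⟨N, hN⟩ := End.mem_maxGenEigenspace _ _ _ |>.1 (hx μ₀ (Finset.mem_insert_self _ _))
    have haev : ∀ (μ : k) (m : ℕ), Polynomial.aeval T ((Polynomial.X - Polynomial.C μ) ^ m) =
        (T - μ • (1 : End k V)) ^ m := by
      intro μ m
      simp [Algebra.algebraMap_eq_smul_one]
    have hs : ∀ μ ∈ s, x μ ∈ p := by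
      have h1 := ih (fun μ => Polynomial.aeval T ((Polynomial.X - Polynomial.C μ₀) ^ N) (x μ))
        (fun μ hμ => End.mapsTo_maxGenEigenspace_of_comm (by
          have := Commute.map (Commute.all Polynomial.X
            ((Polynomial.X - Polynomial.C μ₀) ^ N)) (Polynomial.aeval (R := k) T)
          rwa [Polynomial.aeval_X] at this) μ
          (hx μ (Finset.mem_insert_of_mem hμ))) (by
        rw [← map_sum]
        have h2 := hpoly ((Polynomial.X - Polynomial.C μ₀) ^ N) _ hsum
        rw [Finset.sum_insert hμ₀, map_add, haev, hN, zero_add] at h2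
        rwa [haev])
      intro μ hμ
      obtain ⟨M, hM⟩ := End.mem_maxGenEigenspace _ _ _ |>.1 (hx μ (Finset.mem_insert_of_mem hμ))
      have hne : μ₀ - μ ≠ 0 := sub_ne_zero.2 (by rintro rfl; exact hμ₀ hμ)
      have hcop : IsCoprime ((Polynomial.X - Polynomial.C μ₀) ^ N)
          ((Polynomial.X - Polynomial.C μ) ^ M) :=
        (Polynomial.isCoprime_X_sub_C_of_isUnit_sub hne.isUnit).pow
      obtain ⟨a, b, hab⟩ := hcop
      have h3 : x μ = Polynomial.aeval T a
          (Polynomial.aeval T ((Polynomial.X - Polynomial.C μ₀) ^ N) (x μ)) := by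
        have := congrArg (fun q => Polynomial.aeval T q (x μ)) hab
        simp only [map_add, map_mul, LinearMap.add_apply, Module.End.mul_apply, map_one,
          Module.End.one_apply] at this
        rw [haev μ M, hM, map_zero, add_zero] at this
        exact this.symm
      rw [h3]
      exact hpoly _ _ (h1 μ hμ)
    intro μ hμ
    rcases Finset.mem_insert.1 hμ with rfl | hμ
    · rw [Finset.sum_insert hμ₀] at hsum
      exact (Submodule.add_mem_iff_left _ (p.sum_mem hs)).1 hsum
    · exact hs μ hμ

/-- An endomorphism of a finite-dimensional space has finitely many eigenvalues. -/
theorem finite_spec {V : Type*} [AddCommGroup V] [Module k V] [FiniteDimensional k V]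
    (T : End k V) : {μ | T.maxGenEigenspace μ ≠ ⊥}.Finite :=
  WellFoundedGT.finite_ne_bot_of_iSupIndep T.independent_maxGenEigenspace

/-- An eigenvector `y` for bracketing with `T` shifts the generalised eigenspaces of `T`. -/
theorem apply_mem_of_mem_ad {V : Type*} [AddCommGroup V] [Module k V] {T y : End k V} {μ : k}
    (hy : y ∈ End.maxGenEigenspace (LinearMap.mulLeft k T - LinearMap.mulRight k T) μ)
    {ν : k} {v : V} (hv : v ∈ T.maxGenEigenspace ν) :
    y v ∈ T.maxGenEigenspace (μ + ν) := by
  refine bilin_mem_maxGenEigenspace (LinearMap.id : End k V →ₗ[k] V →ₗ[k] V) (fun u v => ?_) hy hv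
  simp

variable [IsAlgClosed k] {V : Type*} [AddCommGroup V] [Module k V] [FiniteDimensional k V]

theorem isInternal_maxGenEigenspace (T : End k V) [DecidableEq k] :
    DirectSum.IsInternal T.maxGenEigenspace :=
  DirectSum.isInternal_submodule_of_iSupIndep_of_iSup_eq_top T.independent_maxGenEigenspace
    (End.iSup_maxGenEigenspace_eq_top T)

theorem exists_scal (T : End k V) (f : k → k) :
    ∃ S : End k V, ∀ μ, ∀ v ∈ T.maxGenEigenspace μ, S v = f μ • v := by
  classical
  let e := LinearEquiv.ofBijective (DirectSum.coeLinearMap T.maxGenEigenspace)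
    (isInternal_maxGenEigenspace T)
  refine ⟨(DirectSum.toModule k k V fun μ => f μ • (T.maxGenEigenspace μ).subtype) ∘ₗ e.symm,
    fun μ v hv => ?_⟩
  have : e.symm v = DirectSum.lof k k (fun μ => T.maxGenEigenspace μ) μ ⟨v, hv⟩ := by
    rw [LinearEquiv.symm_apply_eq]
    exact (DirectSum.coeLinearMap_lof T.maxGenEigenspace μ ⟨v, hv⟩).symm
  simp [this]

/-- The endomorphism that acts as the scalar `f μ` on the generalised eigenspace of `T` with
eigenvalue `μ`. For `f = id` it is the semisimple part of `T`; for additive `f` these are the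
replicas of the semisimple part. -/
def scal (T : End k V) (f : k → k) : End k V := (exists_scal T f).choose

theorem scal_apply (T : End k V) (f : k → k) {μ : k} {v : V} (hv : v ∈ T.maxGenEigenspace μ) :
    scal T f v = f μ • v := (exists_scal T f).choose_spec μ v hv

theorem end_ext_maxGenEigenspace (T : End k V) {W : Type*} [AddCommGroup W] [Module k W]
    {S S' : V →ₗ[k] W} (h : ∀ μ, ∀ v ∈ T.maxGenEigenspace μ, S v = S' v) : S = S' := by
  ext v
  have hv : v ∈ ⨆ μ, T.maxGenEigenspace μ := by
    rw [End.iSup_maxGenEigenspace_eq_top]; trivial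
  induction hv using Submodule.iSup_induction' with
  | mem μ v hv => exact h μ v hv
  | zero => simp
  | add v w _ _ hv hw => simp [hv, hw]

/-- Only the values of `f` at the eigenvalues of `T` matter for `scal T f`. -/
theorem scal_congr (T : End k V) {f g : k → k}
    (h : ∀ μ, T.maxGenEigenspace μ ≠ ⊥ → f μ = g μ) : scal T f = scal T g := by
  refine end_ext_maxGenEigenspace T fun μ v hv => ?_
  rw [scal_apply T f hv, scal_apply T g hv]
  by_cases hb : T.maxGenEigenspace μ = ⊥
  · rw [hb, Submodule.mem_bot] at hv
    simp [hv]
  · rw [h μ hb]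

theorem commute_scal {T B : End k V} (h : Commute T B) (f : k → k) : Commute (scal T f) B := by
  refine end_ext_maxGenEigenspace T fun μ v hv => ?_
  rw [Module.End.mul_apply, Module.End.mul_apply, scal_apply T f hv, map_smul,
    scal_apply T f (End.mapsTo_maxGenEigenspace_of_comm h μ hv)]

theorem scal_add (T : End k V) (f g : k → k) : scal T (f + g) = scal T f + scal T g := by
  refine end_ext_maxGenEigenspace T fun μ v hv => ?_
  simp [scal_apply T _ hv, add_smul]

theorem scal_smul (T : End k V) (c : k) (f : k → k) : scal T (c • f) = c • scal T f := by
  refine end_ext_maxGenEigenspace T fun μ v hv => ?_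
  simp [scal_apply T _ hv, mul_smul]

theorem scal_mul (T : End k V) (f g : k → k) : scal T (f * g) = scal T f * scal T g := by
  refine end_ext_maxGenEigenspace T fun μ v hv => ?_
  simp [scal_apply T _ hv, mul_smul, smul_comm (f μ)]

theorem scal_one (T : End k V) : scal T 1 = 1 := by
  refine end_ext_maxGenEigenspace T fun μ v hv => ?_
  simp [scal_apply T _ hv]

theorem scal_zero (T : End k V) : scal T 0 = 0 := by
  refine end_ext_maxGenEigenspace T fun μ v hv => ?_
  simp [scal_apply T _ hv]

theorem scal_sum (T : End k V) {ι : Type*} (s : Finset ι) (f : ι → k → k) :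
    scal T (∑ i ∈ s, f i) = ∑ i ∈ s, scal T (f i) := by
  classical
  induction s using Finset.induction_on with
  | empty => simp [scal_zero]
  | insert i s hi ih => rw [Finset.sum_insert hi, Finset.sum_insert hi, scal_add, ih]

/-- The nilpotent part of an endomorphism is nilpotent. -/
theorem isNilpotent_sub_scal (T : End k V) : IsNilpotent (T - scal T id) := by
  refine ⟨finrank k V, end_ext_maxGenEigenspace T fun μ v hv => ?_⟩
  have h : ∀ m : ℕ, ((T - scal T id) ^ m) v = ((T - μ • (1 : End k V)) ^ m) v ∧
      ((T - μ • (1 : End k V)) ^ m) v ∈ T.maxGenEigenspace μ := by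
    intro m
    induction m with
    | zero => simpa using hv
    | succ m ih =>
      rw [pow_succ', pow_succ', Module.End.mul_apply, Module.End.mul_apply, ih.1]
      refine ⟨?_, ?_⟩
      · simp [scal_apply T id ih.2]
      · exact End.mapsTo_maxGenEigenspace_of_comm
          ((Commute.refl T).sub_right ((Commute.one_right T).smul_right μ)) μ ih.2
  rw [(h _).1, LinearMap.zero_apply]
  rw [End.maxGenEigenspace_eq_genEigenspace_finrank, End.mem_genEigenspace_nat,
    LinearMap.mem_ker] at hv
  exact hv

/-- If `y` is a generalised eigenvector for bracketing with `T`, then it is an eigenvector for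
bracketing with every replica `scal T f`. -/
theorem scal_mul_sub_mul_scal {T y : End k V} {μ : k}
    (hy : y ∈ End.maxGenEigenspace (LinearMap.mulLeft k T - LinearMap.mulRight k T) μ)
    (f : k →+ k) : scal T f * y - y * scal T f = f μ • y := by
  refine end_ext_maxGenEigenspace T fun ν v hv => ?_
  simp [scal_apply T _ hv, scal_apply T _ (apply_mem_of_mem_ad hy hv), add_smul]

/-- The multiplicative analogue of `scal_mul_sub_mul_scal`: for multiplicative `f`, conjugation by
`scal T f` scales generalised eigenvectors `y` for bracketing with `T`. -/
theorem scal_mul_eq {T y : End k V} {μ : k}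
    (hy : y ∈ End.maxGenEigenspace (LinearMap.mulLeft k T - LinearMap.mulRight k T) μ)
    (f : k → k) (c : k) (hf : ∀ ν, T.maxGenEigenspace ν ≠ ⊥ → f (μ + ν) = c * f ν) :
    scal T f * y = c • (y * scal T f) := by
  refine end_ext_maxGenEigenspace T fun ν v hv => ?_
  by_cases hb : T.maxGenEigenspace ν = ⊥
  · rw [hb, Submodule.mem_bot] at hv
    simp [hv]
  · simp [scal_apply T _ hv, scal_apply T _ (apply_mem_of_mem_ad hy hv), hf ν hb, mul_smul]

theorem aeval_scal (T : End k V) (f : k → k) (Q : Polynomial k) :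
    Polynomial.aeval (scal T f) Q = scal T fun μ => Q.eval (f μ) := by
  refine end_ext_maxGenEigenspace T fun μ v hv => ?_
  rw [scal_apply T _ hv]
  induction Q using Polynomial.induction_on' with
  | add p q hp hq => simp [hp, hq, add_smul]
  | monomial m a =>
    have : ∀ m : ℕ, (scal T f ^ m) v = f μ ^ m • v := by
      intro m
      induction m with
      | zero => simp
      | succ m ih =>
        rw [pow_succ', Module.End.mul_apply, ih, map_smul, scal_apply T f hv, smul_smul, pow_succ]
    simp [Polynomial.aeval_monomial, this, mul_smul, smul_comm a]

theorem trace_mul_scal (T : End k V) (f : k → k) :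
    LinearMap.trace k V (T * scal T f) =
      ∑ μ ∈ (finite_spec T).toFinset, f μ * μ * (finrank k (T.maxGenEigenspace μ) : k) := by
  classical
  have hT : ∀ μ, Set.MapsTo T (T.maxGenEigenspace μ) (T.maxGenEigenspace μ) := fun μ =>
    End.mapsTo_maxGenEigenspace_of_comm (Commute.refl T) μ
  have hm : ∀ μ, Set.MapsTo (T * scal T f) (T.maxGenEigenspace μ) (T.maxGenEigenspace μ) :=
    fun μ => End.mapsTo_maxGenEigenspace_of_comm
      ((Commute.refl T).mul_right (commute_scal (Commute.refl T) f).symm) μ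
  rw [LinearMap.trace_eq_sum_trace_restrict' (isInternal_maxGenEigenspace T) (finite_spec T) hm]
  refine Finset.sum_congr rfl fun μ _ => ?_
  have hT' : Set.MapsTo (T - algebraMap k (End k V) μ) (T.maxGenEigenspace μ)
      (T.maxGenEigenspace μ) := fun v hv => Submodule.sub_mem _ (hT μ hv)
        (Submodule.smul_mem _ μ hv)
  have hnil : IsNilpotent ((T - algebraMap k (End k V) μ).restrict hT') :=
    End.isNilpotent_restrict_maxGenEigenspace_sub_algebraMap T μ hT'
  have heq : (T * scal T f).restrict (hm μ) =
      f μ • (T - algebraMap k (End k V) μ).restrict hT' +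
        (f μ * μ) • (LinearMap.id : End k (T.maxGenEigenspace μ)) := by
    ext v
    have h1 : scal T f v = f μ • (v : V) := scal_apply T f v.2
    change T (scal T f v) = f μ • (T v - μ • (v : V)) + (f μ * μ) • (v : V)
    rw [h1, map_smul, smul_sub, mul_smul, sub_add_cancel]
  rw [heq, map_add, map_smul, map_smul, LinearMap.trace_id,
    (LinearMap.isNilpotent_trace_of_isNilpotent hnil).eq_zero]
  simp

/-- The trace criterion of nilpotency: it is enough to test an endomorphism against its replicas
for the `ℚ`-linear functions `k → ℚ`. -/
theorem isNilpotent_of_trace_mul_scal_eq_zero [CharZero k] (T : End k V)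
    (h : ∀ f : k →ₗ[ℚ] ℚ, LinearMap.trace k V (T * scal T fun μ => (f μ : k)) = 0) :
    IsNilpotent T := by
  have key : ∀ μ, T.maxGenEigenspace μ ≠ ⊥ → μ = 0 := by
    intro μ hμ
    refine (Module.forall_dual_apply_eq_zero_iff ℚ μ).1 fun f => ?_
    have h1 := h f
    rw [trace_mul_scal] at h1
    -- Applying `f` once more turns the trace into a sum of squares.
    have h2 := congrArg f h1
    rw [map_sum, map_zero] at h2
    have h3 : ∀ ν ∈ (finite_spec T).toFinset,
        f ((f ν : k) * ν * (finrank k (T.maxGenEigenspace ν) : k)) =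
          f ν ^ 2 * (finrank k (T.maxGenEigenspace ν) : ℚ) := by
      intro ν _
      have : (f ν : k) * ν * (finrank k (T.maxGenEigenspace ν) : k) =
          (f ν * (finrank k (T.maxGenEigenspace ν) : ℚ)) • ν := by
        rw [Rat.smul_def]
        push_cast
        ring
      rw [this, map_smul, smul_eq_mul]
      ring
    rw [Finset.sum_congr rfl h3, Finset.sum_eq_zero_iff_of_nonneg fun ν _ => by positivity] at h2
    have h4 := h2 μ (by simpa using hμ)
    have h5 : finrank k (T.maxGenEigenspace μ) ≠ 0 := by
      rwa [Ne, Submodule.finrank_eq_zero]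
    simpa [h5] using h4
  have hz : scal T id = 0 := by
    rw [← scal_zero T]
    exact scal_congr T fun μ hμ => by simpa using key μ hμ
  simpa [hz] using isNilpotent_sub_scal T

end Replicas

/-! ### Replicas in the Lie algebra and one-parameter subgroups in the group -/

section MatrixReplicas
open Module

variable {k : Type*} [Field k] {n : ℕ}

/-- The linear form `∑ j, v j * x_ij` on matrices. -/
def rowForm (i : Fin n) : (Fin n → k) →ₗ[k] MvPolynomial (Fin n × Fin n) k :=
  Fintype.linearCombination k fun j => MvPolynomial.X (i, j)

theorem rowForm_apply (i : Fin n) (v : Fin n → k) :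
    rowForm i v = ∑ j, v j • (MvPolynomial.X (i, j) : MvPolynomial (Fin n × Fin n) k) :=
  Fintype.linearCombination_apply _ _ _

theorem rowForm_single (i j : Fin n) :
    rowForm i (Pi.single j (1 : k)) = MvPolynomial.X (i, j) := by
  simp [rowForm_apply, Pi.single_apply, ite_smul]

theorem leftDer_rowForm (A : Matrix (Fin n) (Fin n) k) (i : Fin n) (v : Fin n → k) :
    leftDer A (rowForm i v) = rowForm i (Matrix.toLinAlgEquiv' A v) := by
  simp only [rowForm_apply, map_sum, Derivation.map_smul, leftDer_X, Finset.smul_sum, smul_smul,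
    Matrix.toLinAlgEquiv'_apply, Matrix.mulVec, dotProduct, Finset.sum_smul]
  rw [Finset.sum_comm]
  simp only [mul_comm]

theorem subst_mulRight_X (g : Matrix (Fin n) (Fin n) k) (i j : Fin n) :
    subst (LinearMap.mulRight k g) (MvPolynomial.X (i, j)) =
      ∑ l, g l j • (MvPolynomial.X (i, l) : MvPolynomial (Fin n × Fin n) k) := by
  simp only [subst, MvPolynomial.aeval_X, LinearMap.mulRight_apply]
  rw [Finset.sum_eq_single i]
  · simp
  · intro a _ ha
    refine Finset.sum_eq_zero fun b _ => ?_
    rw [Matrix.single_mul_apply_of_ne _ _ _ _ _ ha.symm, zero_smul]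
  · simp

theorem subst_mulRight_rowForm (g : Matrix (Fin n) (Fin n) k) (i : Fin n) (v : Fin n → k) :
    subst (LinearMap.mulRight k g) (rowForm i v) = rowForm i (Matrix.toLinAlgEquiv' g v) := by
  simp only [rowForm_apply, map_sum, map_smul, subst_mulRight_X, Finset.smul_sum, smul_smul,
    Matrix.toLinAlgEquiv'_apply, Matrix.mulVec, dotProduct, Finset.sum_smul]
  rw [Finset.sum_comm]
  simp only [mul_comm]

/-- The spaces of an algebra grading exhaust the polynomial ring as soon as they contain the
variables. -/
theorem mem_iSup_of_grading (C : k → Submodule k (MvPolynomial (Fin n × Fin n) k))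
    (h1 : (1 : MvPolynomial (Fin n × Fin n) k) ∈ C 0)
    (hmul : ∀ μ ν, ∀ p ∈ C μ, ∀ q ∈ C ν, p * q ∈ C (μ + ν))
    (hX : ∀ i j, MvPolynomial.X (i, j) ∈ ⨆ μ, C μ) (p : MvPolynomial (Fin n × Fin n) k) :
    p ∈ ⨆ μ, C μ := by
  have hm : ∀ p ∈ ⨆ μ, C μ, ∀ q ∈ ⨆ μ, C μ, p * q ∈ ⨆ μ, C μ := by
    intro p hp q hq
    induction hp using Submodule.iSup_induction' with
    | mem μ p hp =>
      induction hq using Submodule.iSup_induction' with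
      | mem ν q hq => exact Submodule.mem_iSup_of_mem (μ + ν) (hmul μ ν p hp q hq)
      | zero => simp
      | add q r _ _ hq hr => rw [mul_add]; exact add_mem hq hr
    | zero => simp
    | add q r _ _ hq hr => rw [add_mul]; exact add_mem hq hr
  induction p using MvPolynomial.induction_on with
  | C a =>
    rw [MvPolynomial.C_eq_smul_one]
    exact Submodule.smul_mem _ _ (Submodule.mem_iSup_of_mem 0 h1)
  | add p q hp hq => exact add_mem hp hq
  | mul_X p ij hp => exact hm _ hp _ (hX ij.1 ij.2)

theorem leftDer_mul_mem_maxGenEigenspace {A : Matrix (Fin n) (Fin n) k} {μ ν : k}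
    {p q : MvPolynomial (Fin n × Fin n) k}
    (hp : p ∈ End.maxGenEigenspace (leftDer A).toLinearMap μ)
    (hq : q ∈ End.maxGenEigenspace (leftDer A).toLinearMap ν) :
    p * q ∈ End.maxGenEigenspace (leftDer A).toLinearMap (μ + ν) := by
  refine bilin_mem_maxGenEigenspace (LinearMap.mul k (MvPolynomial (Fin n × Fin n) k))
    (fun u v => ?_) hp hq
  simp [mul_comm, add_comm]

theorem one_mem_maxGenEigenspace_leftDer (A : Matrix (Fin n) (Fin n) k) :
    (1 : MvPolynomial (Fin n × Fin n) k) ∈ End.maxGenEigenspace (leftDer A).toLinearMap 0 := by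
  rw [End.mem_maxGenEigenspace]
  exact ⟨1, by simp⟩

theorem rowForm_mem_maxGenEigenspace {A : Matrix (Fin n) (Fin n) k} {μ : k} {v : Fin n → k}
    (hv : v ∈ End.maxGenEigenspace (Matrix.toLinAlgEquiv' A) μ) (i : Fin n) :
    rowForm i v ∈ End.maxGenEigenspace (leftDer A).toLinearMap μ :=
  map_mem_maxGenEigenspace (rowForm i) (fun u => (leftDer_rowForm A i u).symm) hv

variable [IsAlgClosed k]

/-- Let `C` be a multiplicative family of spaces of generalised eigenvectors of `leftDer A` that
contains the linear forms made from generalised eigenvectors of `A`. Then a subspace `I` stable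
under `leftDer A` is spanned by its intersections with the spaces `C μ`. Applied to the ideal of a group,
this shows that the ideal is stable under any operator that acts as a scalar on each `C μ`. -/
theorem exists_decomposition (A : Matrix (Fin n) (Fin n) k)
    (C : k → Submodule k (MvPolynomial (Fin n × Fin n) k))
    (hC : ∀ μ, C μ ≤ End.maxGenEigenspace (leftDer A).toLinearMap μ)
    (h1 : (1 : MvPolynomial (Fin n × Fin n) k) ∈ C 0)
    (hmul : ∀ μ ν, ∀ p ∈ C μ, ∀ q ∈ C ν, p * q ∈ C (μ + ν))
    (hX : ∀ i μ, ∀ v ∈ End.maxGenEigenspace (Matrix.toLinAlgEquiv' A) μ, rowForm i v ∈ C μ)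
    (I : Submodule k (MvPolynomial (Fin n × Fin n) k)) (hI : ∀ p ∈ I, leftDer A p ∈ I)
    (p : MvPolynomial (Fin n × Fin n) k) (hp : p ∈ I) :
    ∃ (s : Finset k) (x : k → MvPolynomial (Fin n × Fin n) k), p = ∑ μ ∈ s, x μ ∧
      ∀ μ ∈ s, x μ ∈ C μ ∧ x μ ∈ I := by
  have hX' : ∀ i j, MvPolynomial.X (i, j) ∈ ⨆ μ, C μ := by
    intro i j
    have hv : ∀ v ∈ ⨆ μ, End.maxGenEigenspace (Matrix.toLinAlgEquiv' A) μ,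
        rowForm i v ∈ ⨆ μ, C μ := by
      intro v hv
      induction hv using Submodule.iSup_induction' with
      | mem μ v hv => exact Submodule.mem_iSup_of_mem μ (hX i μ v hv)
      | zero => simp
      | add v w _ _ hv hw => rw [map_add]; exact add_mem hv hw
    rw [← rowForm_single]
    refine hv _ ?_
    rw [End.iSup_maxGenEigenspace_eq_top]
    trivial
  obtain ⟨x, hx, rfl⟩ := (Submodule.mem_iSup_iff_exists_finsupp _ _).1
    (mem_iSup_of_grading C h1 hmul hX' p)
  exact ⟨x.support, x, rfl, fun μ hμ => ⟨hx μ, mem_of_sum_mem_of_maxGenEigenspace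
    (leftDer A).toLinearMap I hI x.support x (fun μ _ => hC μ (hx μ)) hp μ hμ⟩⟩

/-- The matrix that acts as `f μ` on the generalised eigenspace of `A` with eigenvalue `μ`. -/
def scalM (A : Matrix (Fin n) (Fin n) k) (f : k → k) : Matrix (Fin n) (Fin n) k :=
  LinearMap.toMatrixAlgEquiv' (scal (Matrix.toLinAlgEquiv' A) f)

@[simp] theorem toLin_scalM (A : Matrix (Fin n) (Fin n) k) (f : k → k) :
    Matrix.toLinAlgEquiv' (scalM A f) = scal (Matrix.toLinAlgEquiv' A) f := by
  simp [scalM]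

/-- The eigenvalues of a matrix. -/
def spec (A : Matrix (Fin n) (Fin n) k) : Set k :=
  {μ | End.maxGenEigenspace (Matrix.toLinAlgEquiv' A) μ ≠ ⊥}

/-- The Lie algebra of an algebraic group contains the replicas of its elements. -/
theorem scalM_mem_lieAlg {K : Subgroup (GL (Fin n) k)} {A : Matrix (Fin n) (Fin n) k}
    (hA : A ∈ lieAlg K) (f : k →+ k) : scalM A f ∈ lieAlg K := by
  intro p hp
  obtain ⟨s, x, rfl, hx⟩ := exists_decomposition A
    (fun μ => End.maxGenEigenspace (leftDer A).toLinearMap μ ⊓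
      LinearMap.ker ((leftDer (scalM A f)).toLinearMap - f μ • LinearMap.id))
    (fun μ => inf_le_left)
    ⟨one_mem_maxGenEigenspace_leftDer A, by simp⟩
    (fun μ ν p hp q hq => ⟨leftDer_mul_mem_maxGenEigenspace hp.1 hq.1, by
      have h1 := hp.2
      have h2 := hq.2
      simp only [LinearMap.mem_ker, LinearMap.sub_apply, LinearMap.smul_apply,
        LinearMap.id_apply, sub_eq_zero, Derivation.coeFn_coe,
        SetLike.mem_coe] at h1 h2 ⊢
      simp only [Derivation.leibniz, h1, h2, map_add, add_smul, smul_eq_mul, mul_smul_comm]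
      rw [mul_comm q p, add_comm]⟩)
    (fun i μ v hv => ⟨rowForm_mem_maxGenEigenspace hv i, by
      simp only [LinearMap.mem_ker, LinearMap.sub_apply, LinearMap.smul_apply,
        LinearMap.id_apply, sub_eq_zero, Derivation.coeFn_coe,
        SetLike.mem_coe]
      rw [leftDer_rowForm, toLin_scalM, scal_apply _ _ hv, map_smul]⟩)
    ((groupIdeal K).restrictScalars k) hA p hp
  rw [map_sum]
  refine sum_mem fun μ hμ => ?_
  have h := (hx μ hμ).1.2
  simp only [LinearMap.mem_ker, LinearMap.sub_apply, LinearMap.smul_apply,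
        LinearMap.id_apply, sub_eq_zero, Derivation.coeFn_coe,
        SetLike.mem_coe] at h
  rw [h, MvPolynomial.smul_eq_C_mul]
  exact Ideal.mul_mem_left _ _ (hx μ hμ).2

variable [CharZero k]

/-- The function `μ ↦ t ^ f μ`, for a `ℚ`-linear function `f`; it is used only where `f μ` is an
integer, and there the rounding does nothing. -/
def chi (f : k →ₗ[ℚ] ℚ) (t : kˣ) : k → k := fun μ => ((t ^ ⌊f μ⌋ : kˣ) : k)

/-- The point `t ^ s` of the one-parameter subgroup attached to a replica `s` of `A` with integral
eigenvalues. -/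
def torus (A : Matrix (Fin n) (Fin n) k) (f : k →ₗ[ℚ] ℚ) (t : kˣ) : GL (Fin n) k where
  val := scalM A (chi f t)
  inv := scalM A (chi f t⁻¹)
  val_inv := by
    rw [scalM, scalM, ← map_mul, ← scal_mul]
    have : chi f t * chi f t⁻¹ = 1 := by
      ext μ
      simp only [chi, Pi.mul_apply, ← Units.val_mul, ← mul_zpow]
      simp
    rw [this, scal_one, map_one]
  inv_val := by
    rw [scalM, scalM, ← map_mul, ← scal_mul]
    have : chi f t⁻¹ * chi f t = 1 := by
      ext μ
      simp only [chi, Pi.mul_apply, ← Units.val_mul, ← mul_zpow]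
      simp
    rw [this, scal_one, map_one]

theorem coe_torus (A : Matrix (Fin n) (Fin n) k) (f : k →ₗ[ℚ] ℚ) (t : kˣ) :
    (torus A f t : Matrix (Fin n) (Fin n) k) = scalM A (chi f t) := rfl

/-- An algebraic group contains the one-parameter subgroups attached to the integral replicas of the
elements of its Lie algebra: right translation by a point of the subgroup acts on suitable
generalised eigenvectors of `leftDer A` as a scalar, hence preserves the ideal of the group. -/
theorem torus_mem {K : Subgroup (GL (Fin n) k)} (hK : ∀ g : GL (Fin n) k,
      (∀ p ∈ groupIdeal K, evm (g : Matrix (Fin n) (Fin n) k) p = 0) → g ∈ K)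
    {A : Matrix (Fin n) (Fin n) k} (hA : A ∈ lieAlg K) (f : k →ₗ[ℚ] ℚ)
    (hf : ∀ μ ∈ spec A, ((⌊f μ⌋ : ℤ) : ℚ) = f μ) (t : kˣ) : torus A f t ∈ K := by
  classical
  refine hK _ fun p hp => ?_
  -- Only integral weights `f μ` occur; this is recorded in the spaces of the grading, because the
  -- rounding in `chi` is multiplicative on integral weights only.
  have hmem : ∀ (μ : k) (q : MvPolynomial (Fin n × Fin n) k),
      q ∈ (if ((⌊f μ⌋ : ℤ) : ℚ) = f μ then ⊤ else ⊥ :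
        Submodule k (MvPolynomial (Fin n × Fin n) k)) ↔ (q ≠ 0 → ((⌊f μ⌋ : ℤ) : ℚ) = f μ) := by
    intro μ q
    split_ifs with h
    · simp [h]
    · simp [h]
  obtain ⟨s, x, rfl, hx⟩ := exists_decomposition A
    (fun μ => End.maxGenEigenspace (leftDer A).toLinearMap μ ⊓
      (LinearMap.ker ((subst (LinearMap.mulRight k (scalM A (chi f t)))).toLinearMap -
        chi f t μ • LinearMap.id) ⊓ if ((⌊f μ⌋ : ℤ) : ℚ) = f μ then ⊤ else ⊥))
    (fun μ => inf_le_left)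
    ⟨one_mem_maxGenEigenspace_leftDer A, by simp [chi], (hmem _ _).2 (by simp)⟩
    (fun μ ν p hp q hq => by
      refine ⟨leftDer_mul_mem_maxGenEigenspace hp.1 hq.1, ?_, ?_⟩
      · by_cases h0 : p = 0
        · simp [h0]
        by_cases h0' : q = 0
        · simp [h0']
        have hμ := (hmem _ _).1 hp.2.2 h0
        have hν := (hmem _ _).1 hq.2.2 h0'
        have h1 := hp.2.1
        have h2 := hq.2.1
        have h3 : chi f t (μ + ν) = chi f t μ * chi f t ν := by
          have : ⌊f (μ + ν)⌋ = ⌊f μ⌋ + ⌊f ν⌋ := by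
            rw [map_add, ← hμ, ← hν]
            simp
          rw [chi, this, zpow_add, Units.val_mul, chi, chi]
        simp only [LinearMap.mem_ker, LinearMap.sub_apply, LinearMap.smul_apply,
          LinearMap.id_apply, sub_eq_zero, AlgHom.toLinearMap_apply, SetLike.mem_coe] at h1 h2 ⊢
        rw [map_mul, h1, h2, h3, smul_mul_smul_comm]
      · refine (hmem _ _).2 fun h0 => ?_
        have hμ := (hmem _ _).1 hp.2.2 (left_ne_zero_of_mul h0)
        have hν := (hmem _ _).1 hq.2.2 (right_ne_zero_of_mul h0)
        rw [map_add, ← hμ, ← hν]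
        simp)
    (fun i μ v hv => by
      refine ⟨rowForm_mem_maxGenEigenspace hv i, ?_, ?_⟩
      · simp only [LinearMap.mem_ker, LinearMap.sub_apply, LinearMap.smul_apply,
          LinearMap.id_apply, sub_eq_zero, AlgHom.toLinearMap_apply, SetLike.mem_coe]
        rw [subst_mulRight_rowForm, toLin_scalM, scal_apply _ _ hv, map_smul]
      · refine (hmem _ _).2 fun h0 => hf μ fun hb => h0 ?_
        rw [hb, Submodule.mem_bot] at hv
        rw [hv, map_zero])
    ((groupIdeal K).restrictScalars k) hA p hp
  rw [coe_torus, map_sum]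
  refine Finset.sum_eq_zero fun μ hμ => ?_
  have h := (hx μ hμ).1.2.1
  simp only [LinearMap.mem_ker, LinearMap.sub_apply, LinearMap.smul_apply,
          LinearMap.id_apply, sub_eq_zero, AlgHom.toLinearMap_apply, SetLike.mem_coe] at h
  have h1 := evm_subst (LinearMap.mulRight k (scalM A (chi f t))) 1 (x μ)
  rw [h, map_smul, LinearMap.mulRight_apply, one_mul] at h1
  rw [← h1]
  have h2 := mem_groupIdeal.1 (hx μ hμ).2 1 (one_mem K)
  simp only [Units.val_one] at h2
  rw [h2, smul_zero]

end MatrixReplicas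

/-! ### Exponentials of nilpotent elements of the Lie algebra -/

section Exponentials

variable {k : Type*} [Field k] {n : ℕ}

/-- The exponential `exp (t A)` of a nilpotent matrix, with entries polynomial in `t`. -/
def expPoly (A : Matrix (Fin n) (Fin n) k) : Matrix (Fin n) (Fin n) (Polynomial k) :=
  fun i j => ∑ m ∈ Finset.range (nilpotencyClass A),
    Polynomial.monomial m ((m.factorial : k)⁻¹ * (A ^ m) i j)

/-- The exponential `exp (t A)` of a nilpotent matrix. -/
def expM (A : Matrix (Fin n) (Fin n) k) (t : k) : Matrix (Fin n) (Fin n) k :=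
  ∑ m ∈ Finset.range (nilpotencyClass A), (t ^ m * (m.factorial : k)⁻¹) • A ^ m

theorem eval_expPoly (A : Matrix (Fin n) (Fin n) k) (t : k) (i j : Fin n) :
    (expPoly A i j).eval t = expM A t i j := by
  simp [expPoly, expM, Polynomial.eval_finsetSum, Matrix.sum_apply]
  exact Finset.sum_congr rfl fun m _ => by ring

theorem expM_zero {A : Matrix (Fin n) (Fin n) k} (hA : IsNilpotent A) : expM A 0 = 1 := by
  rcases Nat.eq_zero_or_pos (nilpotencyClass A) with h | h
  · have := pow_nilpotencyClass hA
    rw [h, pow_zero] at this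
    rw [expM, h]
    simp [this]
  · rw [expM, Finset.sum_eq_single_of_mem 0 (by simpa using h)]
    · simp
    · intro m _ hm
      simp [hm]

theorem derivative_expPoly [CharZero k] {A : Matrix (Fin n) (Fin n) k} (hA : IsNilpotent A)
    (i j : Fin n) :
    Polynomial.derivative (expPoly A i j) = ∑ l, A l j • expPoly A i l := by
  have hN := pow_nilpotencyClass hA
  set N := nilpotencyClass A with hNdef
  have h1 : ∀ m : ℕ, ∑ l, A l j * (A ^ m) i l = (A ^ (m + 1)) i j := by
    intro m
    rw [pow_succ, Matrix.mul_apply]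
    simp only [mul_comm]
  have h2 : ∑ l, A l j • expPoly A i l = ∑ m ∈ Finset.range N,
      Polynomial.monomial m ((m.factorial : k)⁻¹ * (A ^ (m + 1)) i j) := by
    simp only [expPoly, Finset.smul_sum, ← hNdef]
    rw [Finset.sum_comm]
    refine Finset.sum_congr rfl fun m _ => ?_
    rw [← h1, Finset.mul_sum, map_sum]
    refine Finset.sum_congr rfl fun l _ => ?_
    rw [Polynomial.smul_monomial]
    congr 1
    simp only [smul_eq_mul]
    ring
  rw [h2, expPoly, ← hNdef]
  rcases N with _ | N
  · simp
  rw [Finset.sum_range_succ', Finset.sum_range_succ, hN]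
  simp only [map_add, map_sum, Polynomial.derivative_monomial, Nat.cast_zero, mul_zero,
    Matrix.zero_apply, map_zero, add_zero]
  refine Finset.sum_congr rfl fun m _ => ?_
  simp only [Nat.add_sub_cancel]
  congr 1
  have : ((m + 1 : ℕ) : k) ≠ 0 := by exact_mod_cast Nat.succ_ne_zero m
  have h4 : (m.factorial : k) ≠ 0 := by exact_mod_cast Nat.factorial_ne_zero m
  rw [Nat.factorial_succ]
  push_cast at this ⊢
  field_simp

theorem derivative_evm_expPoly [CharZero k] {A : Matrix (Fin n) (Fin n) k} (hA : IsNilpotent A)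
    (p : MvPolynomial (Fin n × Fin n) k) :
    Polynomial.derivative (evm (expPoly A) p) = evm (expPoly A) (leftDer A p) := by
  induction p using MvPolynomial.induction_on with
  | C a => simp [← MvPolynomial.algebraMap_eq]
  | add p q hp hq => simp [hp, hq]
  | mul_X p ij hp =>
    obtain ⟨i, j⟩ := ij
    rw [Derivation.leibniz, map_add, smul_eq_mul, smul_eq_mul, map_mul (evm _), map_mul (evm _),
      map_mul (evm _), Polynomial.derivative_mul, hp, leftDer_X, evm_X, derivative_expPoly hA]
    simp only [map_sum, map_smul, evm_X]
    ring

theorem eval_evm (M : Matrix (Fin n) (Fin n) (Polynomial k)) (t : k)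
    (p : MvPolynomial (Fin n × Fin n) k) :
    (evm M p).eval t = evm (M.map (Polynomial.eval t)) p := by
  have : (Polynomial.aeval t).comp (evm M) = evm (k := k) (M.map (Polynomial.eval t)) := by
    apply MvPolynomial.algHom_ext
    rintro ⟨i, j⟩
    simp [Polynomial.coe_aeval_eq_eval]
  simpa [Polynomial.coe_aeval_eq_eval] using DFunLike.congr_fun this p

theorem exists_expM_eq {A : Matrix (Fin n) (Fin n) k} (hA : IsNilpotent A) (t : k) :
    ∃ Q : Polynomial k, expM A t = 1 + A * Polynomial.aeval A Q := by
  rcases Nat.eq_zero_or_pos (nilpotencyClass A) with h | h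
  · have h1 := pow_nilpotencyClass hA
    rw [h, pow_zero] at h1
    have := subsingleton_of_zero_eq_one h1.symm
    exact ⟨0, Subsingleton.elim _ _⟩
  · obtain ⟨N, hN⟩ := Nat.exists_eq_succ_of_ne_zero h.ne'
    refine ⟨∑ m ∈ Finset.range N,
      Polynomial.monomial m (t ^ (m + 1) * (((m + 1).factorial : ℕ) : k)⁻¹), ?_⟩
    rw [expM, hN, Finset.sum_range_succ', add_comm]
    simp only [pow_zero, Nat.factorial_zero, Nat.cast_one, inv_one, mul_one, one_smul, map_sum,
      Polynomial.aeval_monomial, Finset.mul_sum]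
    congr 1
    refine Finset.sum_congr rfl fun m _ => ?_
    rw [← Algebra.smul_def, mul_smul_comm, pow_succ' A]

theorem isUnit_expM {A : Matrix (Fin n) (Fin n) k} (hA : IsNilpotent A) (t : k) :
    IsUnit (expM A t) := by
  obtain ⟨Q, hQ⟩ := exists_expM_eq hA t
  have hc : Commute A (Polynomial.aeval A Q) := by
    have := Commute.map (Commute.all Polynomial.X Q) (Polynomial.aeval (R := k) A)
    rwa [Polynomial.aeval_X] at this
  rw [hQ]
  exact IsNilpotent.isUnit_one_add (hc.isNilpotent_mul_right hA)

/-- The exponential of a nilpotent element of the Lie algebra satisfies the equations of the group: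
all derivatives of `t ↦ p (exp (t A))` vanish at `t = 0`. -/
theorem evm_expM_eq_zero [CharZero k] {K : Subgroup (GL (Fin n) k)} {A : Matrix (Fin n) (Fin n) k}
    (hA : A ∈ lieAlg K) (hn : IsNilpotent A) (t : k) (p : MvPolynomial (Fin n × Fin n) k)
    (hp : p ∈ groupIdeal K) : evm (expM A t) p = 0 := by
  have h0 : ∀ m : ℕ, (Polynomial.derivative^[m] (evm (expPoly A) p)) =
      evm (expPoly A) ((leftDer A)^[m] p) ∧ (leftDer A)^[m] p ∈ groupIdeal K := by
    intro m
    induction m with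
    | zero => exact ⟨rfl, hp⟩
    | succ m ih =>
      rw [Function.iterate_succ_apply', Function.iterate_succ_apply', ih.1,
        derivative_evm_expPoly hn]
      exact ⟨rfl, hA _ ih.2⟩
  have hz : evm (expPoly A) p = 0 := by
    ext m
    have h1 := congrArg (Polynomial.coeff · 0) (h0 m).1
    beta_reduce at h1
    rw [Polynomial.coeff_iterate_derivative, Polynomial.coeff_zero_eq_eval_zero, eval_evm,
      zero_add, Nat.descFactorial_self] at h1
    have h2 : (expPoly A).map (Polynomial.eval 0) = (1 : Matrix (Fin n) (Fin n) k) := by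
      rw [← expM_zero hn]
      ext i j
      exact eval_expPoly A 0 i j
    rw [h2] at h1
    have h3 := mem_groupIdeal.1 (h0 m).2 1 (one_mem K)
    rw [Units.val_one] at h3
    rw [h3, nsmul_eq_mul] at h1
    rcases mul_eq_zero.1 h1 with h | h
    · exact absurd h (by exact_mod_cast Nat.factorial_ne_zero m)
    · simpa using h
  have h4 := eval_evm (expPoly A) t p
  rw [hz, Polynomial.eval_zero] at h4
  have h5 : expM A t = (expPoly A).map (Polynomial.eval t) := by
    ext i j
    exact (eval_expPoly A t i j).symm
  rw [h5, ← h4]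

end Exponentials

/-! ### The Zariski topology -/

section ZariskiTopology
open Module

variable {k : Type*} [Field k] {n : ℕ}

theorem isTopologicalBasis_zariski (V : Type*) [AddCommGroup V] [Module k V] :
    @TopologicalSpace.IsTopologicalBasis V (zariski k V)
      {U | ∃ p ∈ polyFun k V, U = {v | p v ≠ 0}} := by
  let _ := zariski k V
  refine ⟨?_, ?_, rfl⟩
  · rintro _ ⟨p, hp, rfl⟩ _ ⟨q, hq, rfl⟩ v hv
    refine ⟨{v | (p * q) v ≠ 0}, ⟨p * q, mul_mem hp hq, rfl⟩, ?_, ?_⟩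
    · exact mul_ne_zero hv.1 hv.2
    · intro w hw
      exact ⟨left_ne_zero_of_mul hw, right_ne_zero_of_mul hw⟩
  · refine Set.eq_univ_of_forall fun v => ?_
    exact ⟨_, ⟨1, one_mem _, rfl⟩, by simp⟩

/-- The Zariski closure of `X` is the set of common zeros of the polynomials that vanish on `X`. -/
theorem mem_zclosure {V : Type*} [AddCommGroup V] [Module k V] {X : Set V} {v : V} :
    v ∈ zclosure k X ↔ ∀ p ∈ polyFun k V, (∀ x ∈ X, p x = 0) → p v = 0 := by
  let _ := zariski k V
  rw [zclosure, (isTopologicalBasis_zariski V).mem_closure_iff]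
  constructor
  · intro h p hp hX
    by_contra hv
    obtain ⟨x, hx, hxX⟩ := h _ ⟨p, hp, rfl⟩ hv
    exact hx (hX x hxX)
  · rintro h _ ⟨p, hp, rfl⟩ hv
    by_contra hne
    refine hv (h p hp fun x hx => ?_)
    by_contra hpx
    exact hne ⟨x, hpx, hx⟩

theorem subset_zclosure {V : Type*} [AddCommGroup V] [Module k V] (X : Set V) :
    X ⊆ zclosure k X := fun _ hv => mem_zclosure.2 fun _ _ h => h _ hv

/-- The polynomial functions on a space embedded into matrices are the restrictions of the
polynomials in the matrix entries. -/
theorem mem_polyFun_iff {V : Type*} [AddCommGroup V] [Module k V]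
    {ι : V →ₗ[k] Matrix (Fin n) (Fin n) k} (hι : Function.Injective ι) {q : V → k} :
    q ∈ polyFun k V ↔ ∃ p : MvPolynomial (Fin n × Fin n) k, q = fun v => evm (ι v) p := by
  constructor
  · intro hq
    obtain ⟨r, hr⟩ := LinearMap.exists_leftInverse_of_injective ι (LinearMap.ker_eq_bot.2 hι)
    induction hq using Algebra.adjoin_induction with
    | mem q hq =>
      obtain ⟨l, rfl⟩ := hq
      refine ⟨linPoly (l ∘ₗ r), ?_⟩
      ext v
      have := DFunLike.congr_fun hr v
      simp only [LinearMap.comp_apply, LinearMap.id_apply] at this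
      simp [this]
    | algebraMap c => exact ⟨MvPolynomial.C c, by ext v; simp [← MvPolynomial.algebraMap_eq]⟩
    | add p q _ _ hp hq =>
      obtain ⟨p, rfl⟩ := hp
      obtain ⟨q, rfl⟩ := hq
      exact ⟨p + q, by ext v; simp⟩
    | mul p q _ _ hp hq =>
      obtain ⟨p, rfl⟩ := hp
      obtain ⟨q, rfl⟩ := hq
      exact ⟨p * q, by ext v; simp⟩
  · rintro ⟨p, rfl⟩
    induction p using MvPolynomial.induction_on with
    | C a =>
      have : (fun v => evm (ι v) (MvPolynomial.C a)) = algebraMap k (V → k) a := by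
        ext v; simp [← MvPolynomial.algebraMap_eq]
      rw [this]
      exact Subalgebra.algebraMap_mem _ _
    | add p q hp hq =>
      have : (fun v => evm (ι v) (p + q)) = (fun v => evm (ι v) p) + fun v => evm (ι v) q := by
        ext v; simp
      rw [this]
      exact add_mem hp hq
    | mul_X p ij hp =>
      have : (fun v => evm (ι v) (p * MvPolynomial.X ij)) =
          (fun v => evm (ι v) p) * fun v => ι v ij.1 ij.2 := by
        ext v
        obtain ⟨i, j⟩ := ij
        simp
      rw [this]
      refine mul_mem hp (Algebra.subset_adjoin ⟨Matrix.entryLinearMap k k ij.1 ij.2 ∘ₗ ι, ?_⟩)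
      ext v
      rfl

theorem mem_polyFun_matrix {q : Matrix (Fin n) (Fin n) k → k} :
    q ∈ polyFun k (Matrix (Fin n) (Fin n) k) ↔
      ∃ p : MvPolynomial (Fin n × Fin n) k, q = fun M => evm M p :=
  mem_polyFun_iff (V := Matrix (Fin n) (Fin n) k)
    (ι := (LinearMap.id : Matrix (Fin n) (Fin n) k →ₗ[k] Matrix (Fin n) (Fin n) k))
    (fun _ _ h => h)

/-- A subgroup of `GL n k` is algebraic iff it is the zero set of its ideal in `GL n k`. -/
theorem isAlgebraic_iff {K : Subgroup (GL (Fin n) k)} :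
    IsAlgebraic K ↔ ∀ g : GL (Fin n) k,
      (∀ p ∈ groupIdeal K, evm (g : Matrix (Fin n) (Fin n) k) p = 0) → g ∈ K := by
  have hcl : ∀ (g : GL (Fin n) k),
      (g : Matrix (Fin n) (Fin n) k) ∈ zclosure k
        ((fun g : GL (Fin n) k => (g : Matrix (Fin n) (Fin n) k)) '' K) ↔
      ∀ p ∈ groupIdeal K, evm (g : Matrix (Fin n) (Fin n) k) p = 0 := by
    intro g
    rw [mem_zclosure]
    constructor
    · intro h p hp
      refine h _ (mem_polyFun_matrix.2 ⟨p, rfl⟩) ?_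
      rintro _ ⟨g', hg', rfl⟩
      exact mem_groupIdeal.1 hp g' hg'
    · intro h q hq hK
      obtain ⟨p, rfl⟩ := mem_polyFun_matrix.1 hq
      exact h p (mem_groupIdeal.2 fun g' hg' => hK _ ⟨g', hg', rfl⟩)
  let _ := zariski k (Matrix (Fin n) (Fin n) k)
  rw [IsAlgebraic, isClosed_induced_iff]
  constructor
  · rintro ⟨t, ht, hK⟩ g hg
    have h1 := (hcl g).2 hg
    have h2 : zclosure k ((fun g : GL (Fin n) k => (g : Matrix (Fin n) (Fin n) k)) '' K) ⊆ t :=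
      closure_minimal (by rintro _ ⟨g', hg', rfl⟩; rw [← hK] at hg'; exact hg') ht
    have h3 : g ∈ (K : Set (GL (Fin n) k)) := by rw [← hK]; exact h2 h1
    exact h3
  · intro h
    refine ⟨_, isClosed_closure (s := ((fun g : GL (Fin n) k =>
      (g : Matrix (Fin n) (Fin n) k)) '' (K : Set (GL (Fin n) k)))), ?_⟩
    ext g
    exact ⟨fun hg => h g ((hcl g).1 hg), fun hg => subset_closure ⟨g, hg, rfl⟩⟩

theorem isOpen_zariskiGL_iff {U : Set (GL (Fin n) k)} :
    @IsOpen _ (zariskiGL k n) U ↔ ∀ g ∈ U, ∃ p : MvPolynomial (Fin n × Fin n) k,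
      evm (g : Matrix (Fin n) (Fin n) k) p ≠ 0 ∧
      ∀ h : GL (Fin n) k, evm (h : Matrix (Fin n) (Fin n) k) p ≠ 0 → h ∈ U := by
  let _ := zariski k (Matrix (Fin n) (Fin n) k)
  have hb := (isTopologicalBasis_zariski (k := k) (Matrix (Fin n) (Fin n) k)).induced
    (fun g : GL (Fin n) k => (g : Matrix (Fin n) (Fin n) k))
  rw [@TopologicalSpace.IsTopologicalBasis.isOpen_iff _ (zariskiGL k n) _ _ hb]
  refine forall₂_congr fun g _ => ⟨?_, ?_⟩
  · rintro ⟨_, ⟨_, ⟨q, hq, rfl⟩, rfl⟩, hg, hU⟩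
    obtain ⟨p, rfl⟩ := mem_polyFun_matrix.1 hq
    exact ⟨p, hg, fun h hh => hU hh⟩
  · rintro ⟨p, hg, hU⟩
    exact ⟨_, ⟨_, ⟨_, mem_polyFun_matrix.2 ⟨p, rfl⟩,
      rfl⟩, rfl⟩, hg, fun h hh => hU h hh⟩

theorem continuous_mul_left_zariskiGL (g : GL (Fin n) k) :
    @Continuous _ _ (zariskiGL k n) (zariskiGL k n) fun h => g * h := by
  let _ := zariskiGL k n
  refine continuous_def.2 fun U hU => isOpen_zariskiGL_iff.2 fun h hh => ?_
  obtain ⟨p, hp, hpU⟩ := isOpen_zariskiGL_iff.1 hU _ hh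
  refine ⟨subst (LinearMap.mulLeft k (g : Matrix (Fin n) (Fin n) k)) p, ?_, fun h' hh' => ?_⟩
  · rw [evm_subst]
    simpa using hp
  · rw [evm_subst] at hh'
    exact hpU _ (by simpa using hh')

end ZariskiTopology

/-! ### The Zariski closure of a group of matrices -/

section Closure

variable {k : Type*} [Field k] {n : ℕ}

/-- A polynomial in the entries of `g⁻¹` becomes a polynomial in the entries of `g` after
multiplication by a power of the determinant. -/
theorem exists_evm_inv (p : MvPolynomial (Fin n × Fin n) k) :
    ∃ (q : MvPolynomial (Fin n × Fin n) k) (N : ℕ), ∀ g : GL (Fin n) k,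
      evm ((g⁻¹ : GL (Fin n) k) : Matrix (Fin n) (Fin n) k) p *
        (g : Matrix (Fin n) (Fin n) k).det ^ N = evm (g : Matrix (Fin n) (Fin n) k) q := by
  have hmap : ∀ M : Matrix (Fin n) (Fin n) k,
      (Matrix.mvPolynomialX (Fin n) (Fin n) k).map (evm M) = M := by
    intro M
    ext i j
    simp [Matrix.mvPolynomialX]
  have hdet : ∀ M : Matrix (Fin n) (Fin n) k,
      evm M (Matrix.mvPolynomialX (Fin n) (Fin n) k).det = M.det := by
    intro M
    rw [AlgHom.map_det, AlgHom.mapMatrix_apply, hmap]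
  have hadj : ∀ (M : Matrix (Fin n) (Fin n) k) (i j : Fin n),
      evm M ((Matrix.mvPolynomialX (Fin n) (Fin n) k).adjugate i j) = M.adjugate i j := by
    intro M i j
    have := AlgHom.map_adjugate (evm M) (Matrix.mvPolynomialX (Fin n) (Fin n) k)
    rw [AlgHom.mapMatrix_apply, AlgHom.mapMatrix_apply, hmap] at this
    rw [← this]
    rfl
  induction p using MvPolynomial.induction_on with
  | C a => exact ⟨MvPolynomial.C a, 0, fun g => by simp [← MvPolynomial.algebraMap_eq]⟩
  | add p q hp hq =>
    obtain ⟨p', N, hp⟩ := hp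
    obtain ⟨q', M, hq⟩ := hq
    refine ⟨p' * (Matrix.mvPolynomialX (Fin n) (Fin n) k).det ^ M +
      q' * (Matrix.mvPolynomialX (Fin n) (Fin n) k).det ^ N, N + M, fun g => ?_⟩
    simp only [map_add, map_mul, map_pow, hdet, ← hp, ← hq]
    ring
  | mul_X p ij hp =>
    obtain ⟨i, j⟩ := ij
    obtain ⟨p', N, hp⟩ := hp
    refine ⟨p' * (Matrix.mvPolynomialX (Fin n) (Fin n) k).adjugate i j, N + 1, fun g => ?_⟩
    have h1 : ((g⁻¹ : GL (Fin n) k) : Matrix (Fin n) (Fin n) k) i j *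
        (g : Matrix (Fin n) (Fin n) k).det = (g : Matrix (Fin n) (Fin n) k).adjugate i j := by
      have hu : IsUnit (g : Matrix (Fin n) (Fin n) k).det :=
        (Matrix.isUnit_iff_isUnit_det _).1 g.isUnit
      rw [Matrix.coe_units_inv, Matrix.inv_def, Matrix.smul_apply, smul_eq_mul,
        Ring.inverse_eq_inv', mul_right_comm, inv_mul_cancel₀ hu.ne_zero, one_mul]
    rw [map_mul, evm_X, map_mul, hadj, ← hp, ← h1]
    ring

/-- The Zariski closure of a subgroup of `GL n k`. -/
def closureGroup (Γ : Subgroup (GL (Fin n) k)) : Subgroup (GL (Fin n) k) where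
  carrier := {g | ∀ p ∈ groupIdeal Γ, evm (g : Matrix (Fin n) (Fin n) k) p = 0}
  one_mem' p hp := mem_groupIdeal.1 hp 1 (one_mem Γ)
  mul_mem' {g h} hg hh p hp := by
    have h1 : subst (LinearMap.mulRight k (h : Matrix (Fin n) (Fin n) k)) p ∈ groupIdeal Γ := by
      refine mem_groupIdeal.2 fun g' hg' => ?_
      have h2 : subst (LinearMap.mulLeft k (g' : Matrix (Fin n) (Fin n) k)) p ∈ groupIdeal Γ := by
        refine mem_groupIdeal.2 fun h' hh' => ?_
        rw [evm_subst]
        simpa using mem_groupIdeal.1 hp (g' * h') (mul_mem hg' hh')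
      have h3 := hh _ h2
      rw [evm_subst] at h3 ⊢
      simpa using h3
    have h4 := hg _ h1
    rw [evm_subst] at h4
    simpa using h4
  inv_mem' {g} hg p hp := by
    obtain ⟨q, N, hq⟩ := exists_evm_inv p
    have h1 : q ∈ groupIdeal Γ := mem_groupIdeal.2 fun g' hg' => by
      rw [← hq, mem_groupIdeal.1 hp _ (inv_mem hg'), zero_mul]
    have h2 := hg q h1
    rw [← hq] at h2
    have hu : IsUnit (g : Matrix (Fin n) (Fin n) k).det :=
      (Matrix.isUnit_iff_isUnit_det _).1 g.isUnit
    exact (mul_eq_zero.1 h2).resolve_right (pow_ne_zero _ hu.ne_zero)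

theorem le_closureGroup (Γ : Subgroup (GL (Fin n) k)) : Γ ≤ closureGroup Γ :=
  fun g hg _ hp => mem_groupIdeal.1 hp g hg

theorem isAlgebraic_closureGroup (Γ : Subgroup (GL (Fin n) k)) : IsAlgebraic (closureGroup Γ) :=
  isAlgebraic_iff.2 fun _ hg p hp => hg p (mem_groupIdeal.2 fun _ hh => hh p hp)

theorem closureGroup_le {Γ L : Subgroup (GL (Fin n) k)} (hL : IsAlgebraic L) (h : Γ ≤ L) :
    closureGroup Γ ≤ L := fun g hg => isAlgebraic_iff.1 hL g fun p hp =>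
  hg p (mem_groupIdeal.2 fun g' hg' => mem_groupIdeal.1 hp g' (h hg'))

theorem closureGroup_subset_closure (Γ : Subgroup (GL (Fin n) k)) :
    (closureGroup Γ : Set (GL (Fin n) k)) ⊆ @closure _ (zariskiGL k n) (Γ : Set _) := by
  let _ := zariskiGL k n
  intro g hg
  rw [mem_closure_iff]
  intro U hU hgU
  obtain ⟨p, hp, hpU⟩ := isOpen_zariskiGL_iff.1 hU g hgU
  by_contra hne
  refine hp (hg p (mem_groupIdeal.2 fun h hh => ?_))
  by_contra hph
  exact hne ⟨h, hpU h hph, hh⟩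

end Closure

/-! ### Rational curves and the closed connected groups they generate -/

section Curves

variable {k : Type*} [Field k] {n : ℕ}

/-- Laurent polynomial functions on the multiplicative group of the field. -/
def IsLaurent (F : kˣ → k) : Prop :=
  ∃ (N : ℕ) (Q : Polynomial k), ∀ t : kˣ, (t : k) ^ N * F t = Q.eval (t : k)

theorem isLaurent_eval (Q : Polynomial k) : IsLaurent fun t : kˣ => Q.eval (t : k) :=
  ⟨0, Q, fun t => by simp⟩

theorem isLaurent_const (c : k) : IsLaurent fun _ : kˣ => c :=
  ⟨0, Polynomial.C c, fun t => by simp⟩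

theorem isLaurent_zpow (m : ℤ) : IsLaurent fun t : kˣ => ((t ^ m : kˣ) : k) := by
  obtain ⟨a, rfl | rfl⟩ := m.eq_nat_or_neg
  · exact ⟨0, Polynomial.X ^ a, fun t => by simp⟩
  · refine ⟨a, 1, fun t => ?_⟩
    beta_reduce
    rw [zpow_neg, zpow_natCast, ← Units.val_pow_eq_pow_val, ← Units.val_mul]
    simp

theorem IsLaurent.add {F G : kˣ → k} (hF : IsLaurent F) (hG : IsLaurent G) :
    IsLaurent fun t => F t + G t := by
  obtain ⟨N, P, hP⟩ := hF
  obtain ⟨M, Q, hQ⟩ := hG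
  refine ⟨N + M, Polynomial.X ^ M * P + Polynomial.X ^ N * Q, fun t => ?_⟩
  simp only [Polynomial.eval_add, Polynomial.eval_mul, Polynomial.eval_pow, Polynomial.eval_X,
    ← hP, ← hQ]
  ring

theorem IsLaurent.mul {F G : kˣ → k} (hF : IsLaurent F) (hG : IsLaurent G) :
    IsLaurent fun t => F t * G t := by
  obtain ⟨N, P, hP⟩ := hF
  obtain ⟨M, Q, hQ⟩ := hG
  refine ⟨N + M, P * Q, fun t => ?_⟩
  simp only [Polynomial.eval_mul, ← hP, ← hQ]
  ring

theorem IsLaurent.sum {ι : Type*} (s : Finset ι) {F : ι → kˣ → k}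
    (hF : ∀ i ∈ s, IsLaurent (F i)) : IsLaurent fun t => ∑ i ∈ s, F i t := by
  classical
  induction s using Finset.induction_on with
  | empty => simpa using isLaurent_const 0
  | insert i s hi ih =>
    simp only [Finset.sum_insert hi]
    exact (hF i (Finset.mem_insert_self _ _)).add
      (ih fun j hj => hF j (Finset.mem_insert_of_mem hj))

/-- The product of two nonzero Laurent polynomials is nonzero. -/
theorem IsLaurent.exists_ne_zero [Infinite k] {F G : kˣ → k} (hF : IsLaurent F)
    (hG : IsLaurent G) (hF0 : ∃ t, F t ≠ 0) (hG0 : ∃ t, G t ≠ 0) :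
    ∃ t, F t ≠ 0 ∧ G t ≠ 0 := by
  obtain ⟨N, P, hP⟩ := hF
  obtain ⟨M, Q, hQ⟩ := hG
  obtain ⟨t₁, ht₁⟩ := hF0
  obtain ⟨t₂, ht₂⟩ := hG0
  have hP0 : P ≠ 0 := by
    rintro rfl
    have := hP t₁
    simp [ht₁] at this
  have hQ0 : Q ≠ 0 := by
    rintro rfl
    have := hQ t₂
    simp [ht₂] at this
  have h0 : Polynomial.X * P * Q ≠ 0 := mul_ne_zero (mul_ne_zero Polynomial.X_ne_zero hP0) hQ0
  obtain ⟨t, ht⟩ : ∃ t : k, (Polynomial.X * P * Q).eval t ≠ 0 := by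
    by_contra! h
    exact h0 (Polynomial.funext fun t => by simpa using h t)
  simp only [Polynomial.eval_mul, Polynomial.eval_X] at ht
  have ht0 : t ≠ 0 := left_ne_zero_of_mul (left_ne_zero_of_mul ht)
  refine ⟨Units.mk0 t ht0, fun h => ?_, fun h => ?_⟩
  · have := hP (Units.mk0 t ht0)
    rw [h, mul_zero] at this
    exact right_ne_zero_of_mul (left_ne_zero_of_mul ht) this.symm
  · have := hQ (Units.mk0 t ht0)
    rw [h, mul_zero] at this
    exact right_ne_zero_of_mul ht this.symm

theorem IsLaurent.exists_forall_ne_zero [Infinite k] {ι : Type*} (s : Finset ι) (F : ι → kˣ → k)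
    (hF : ∀ i ∈ s, IsLaurent (F i)) (h0 : ∀ i ∈ s, ∃ t, F i t ≠ 0) :
    ∃ t, ∀ i ∈ s, F i t ≠ 0 := by
  classical
  suffices h : IsLaurent (fun t => ∏ i ∈ s, F i t) ∧ ∃ t, ∏ i ∈ s, F i t ≠ 0 by
    obtain ⟨t, ht⟩ := h.2
    exact ⟨t, fun i hi => Finset.prod_ne_zero_iff.1 ht i hi⟩
  induction s using Finset.induction_on with
  | empty => exact ⟨by simpa using isLaurent_const 1, 1, by simp⟩
  | insert i s hi ih =>
    obtain ⟨h1, h2⟩ := ih (fun j hj => hF j (Finset.mem_insert_of_mem hj))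
      (fun j hj => h0 j (Finset.mem_insert_of_mem hj))
    simp only [Finset.prod_insert hi]
    refine ⟨(hF i (Finset.mem_insert_self _ _)).mul h1, ?_⟩
    obtain ⟨t, ht, ht'⟩ := (hF i (Finset.mem_insert_self _ _)).exists_ne_zero h1
      (h0 i (Finset.mem_insert_self _ _)) h2
    exact ⟨t, mul_ne_zero ht ht'⟩

/-- Rational curves `kˣ → GL n k` whose matrix entries are Laurent polynomials, starting at `1`
for `t = 1`. -/
structure IsCurve (γ : kˣ → GL (Fin n) k) : Prop where
  laurent : ∀ i j, IsLaurent fun t => (γ t : Matrix (Fin n) (Fin n) k) i j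
  one : γ 1 = 1

theorem isLaurent_evm {M : kˣ → Matrix (Fin n) (Fin n) k}
    (hM : ∀ i j, IsLaurent fun t => M t i j) (p : MvPolynomial (Fin n × Fin n) k) :
    IsLaurent fun t => evm (M t) p := by
  induction p using MvPolynomial.induction_on with
  | C a => simpa [← MvPolynomial.algebraMap_eq] using isLaurent_const a
  | add p q hp hq => simpa using hp.add hq
  | mul_X p ij hp =>
    obtain ⟨i, j⟩ := ij
    simpa using hp.mul (hM i j)

/-- The image of a rational curve is irreducible, hence connected. -/
theorem IsCurve.isPreconnected [Infinite k] {γ : kˣ → GL (Fin n) k} (hγ : IsCurve γ) :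
    @IsPreconnected _ (zariskiGL k n) (Set.range γ) := by
  let _ := zariskiGL k n
  refine IsPreirreducible.isPreconnected ?_
  rintro U V hU hV ⟨_, ⟨t₁, rfl⟩, ht₁⟩ ⟨_, ⟨t₂, rfl⟩, ht₂⟩
  obtain ⟨p, hp, hpU⟩ := isOpen_zariskiGL_iff.1 hU _ ht₁
  obtain ⟨q, hq, hqV⟩ := isOpen_zariskiGL_iff.1 hV _ ht₂
  obtain ⟨t, h1, h2⟩ := (isLaurent_evm hγ.laurent p).exists_ne_zero (isLaurent_evm hγ.laurent q)
    ⟨t₁, hp⟩ ⟨t₂, hq⟩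
  exact ⟨γ t, ⟨t, rfl⟩, hpU _ h1, hqV _ h2⟩

theorem IsCurve.conj {γ : kˣ → GL (Fin n) k} (hγ : IsCurve γ) (g : GL (Fin n) k) :
    IsCurve fun t => g * γ t * g⁻¹ := by
  refine ⟨fun i j => ?_, by simp [hγ.one]⟩
  simp only [Units.val_mul, Matrix.mul_apply]
  exact IsLaurent.sum _ fun a _ => (IsLaurent.sum _ fun b _ =>
    (isLaurent_const _).mul (hγ.laurent b a)).mul (isLaurent_const _)

/-- A subgroup generated by connected sets that contain `1` is connected. -/
theorem isConn_closureGroup [Infinite k] {C : Set (kˣ → GL (Fin n) k)}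
    (hC : ∀ γ ∈ C, IsCurve γ) :
    IsConn (closureGroup (Subgroup.closure {g | ∃ γ ∈ C, ∃ t, g = γ t})) := by
  let _ := zariskiGL k n
  set Γ := Subgroup.closure {g | ∃ γ ∈ C, ∃ t, g = γ t}
  have key : ∀ g ∈ Γ, ∃ T : Set (GL (Fin n) k), T ⊆ Γ ∧ IsPreconnected T ∧ 1 ∈ T ∧ g ∈ T := by
    intro g hg
    induction hg using Subgroup.closure_induction with
    | mem g hg =>
      obtain ⟨γ, hγ, t, rfl⟩ := hg
      refine ⟨Set.range γ, ?_, (hC γ hγ).isPreconnected, ⟨1, (hC γ hγ).one⟩, ⟨t, rfl⟩⟩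
      rintro _ ⟨s, rfl⟩
      exact Subgroup.subset_closure ⟨γ, hγ, s, rfl⟩
    | one => exact ⟨{1}, by simp [one_mem], isPreconnected_singleton, rfl, rfl⟩
    | mul g h hg hh ihg ihh =>
      obtain ⟨T, hT, hTc, hT1, hTg⟩ := ihg
      obtain ⟨T', hT', hTc', hT1', hTh⟩ := ihh
      refine ⟨T ∪ (fun x => g * x) '' T', ?_, ?_, Or.inl hT1, Or.inr ⟨h, hTh, rfl⟩⟩
      · rintro _ (hx | ⟨x, hx, rfl⟩)
        · exact hT hx
        · exact mul_mem hg (hT' hx)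
      · exact hTc.union g hTg ⟨1, hT1', mul_one g⟩
          (hTc'.image _ (continuous_mul_left_zariskiGL g).continuousOn)
    | inv g hg ih =>
      obtain ⟨T, hT, hTc, hT1, hTg⟩ := ih
      refine ⟨(fun x => g⁻¹ * x) '' T, ?_, ?_, ⟨g, hTg, inv_mul_cancel g⟩, ⟨1, hT1, mul_one _⟩⟩
      · rintro _ ⟨x, hx, rfl⟩
        exact mul_mem (inv_mem hg) (hT hx)
      · exact hTc.image _ (continuous_mul_left_zariskiGL g⁻¹).continuousOn
  have hΓ : IsPreconnected (Γ : Set (GL (Fin n) k)) :=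
    isPreconnected_of_forall 1 fun g hg => by
      obtain ⟨T, hT, hTc, hT1, hTg⟩ := key g hg
      exact ⟨T, hT, hT1, hTg, hTc⟩
  exact ⟨⟨1, one_mem _⟩, hΓ.subset_closure (le_closureGroup Γ) (closureGroup_subset_closure Γ)⟩

/-- The closed subgroup generated by a family of curves that is stable under conjugation. -/
theorem exists_closed_normal_of_curves [Infinite k] {K : Subgroup (GL (Fin n) k)}
    (hK : IsAlgebraic K) {C : Set (kˣ → GL (Fin n) k)} (hC : ∀ γ ∈ C, IsCurve γ)
    (hCK : ∀ γ ∈ C, ∀ t, γ t ∈ K) (hconj : ∀ g ∈ K, ∀ γ ∈ C, (fun t => g * γ t * g⁻¹) ∈ C) :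
    ∃ N : Subgroup (GL (Fin n) k), N ≤ K ∧ (N.subgroupOf K).Normal ∧ IsAlgebraic N ∧ IsConn N ∧
      (∀ γ ∈ C, ∀ t, γ t ∈ N) ∧
      ∀ L : Subgroup (GL (Fin n) k), IsAlgebraic L → (∀ γ ∈ C, ∀ t, γ t ∈ L) → N ≤ L := by
  set Γ := Subgroup.closure {g | ∃ γ ∈ C, ∃ t, g = γ t}
  have hle : ∀ L : Subgroup (GL (Fin n) k), (∀ γ ∈ C, ∀ t, γ t ∈ L) → Γ ≤ L := by
    intro L hL
    rw [Subgroup.closure_le]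
    rintro _ ⟨γ, hγ, t, rfl⟩
    exact hL γ hγ t
  have hmin : ∀ L : Subgroup (GL (Fin n) k), IsAlgebraic L → (∀ γ ∈ C, ∀ t, γ t ∈ L) →
      closureGroup Γ ≤ L := fun L hLa hL => closureGroup_le hLa (hle L hL)
  have hΓc : ∀ g ∈ K, ∀ x ∈ Γ, g * x * g⁻¹ ∈ Γ := by
    intro g hg
    have := hle (Γ.comap (MulAut.conj g).toMonoidHom) fun γ hγ t =>
      Subgroup.subset_closure ⟨_, hconj g hg γ hγ, t, rfl⟩
    exact fun x hx => this hx
  refine ⟨closureGroup Γ, hmin K hK hCK, ⟨?_⟩, isAlgebraic_closureGroup Γ,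
    isConn_closureGroup hC, fun γ hγ t => le_closureGroup Γ
      (Subgroup.subset_closure ⟨γ, hγ, t, rfl⟩), hmin⟩
  rintro ⟨x, hxK⟩ hx ⟨g, hg⟩
  rw [Subgroup.mem_subgroupOf] at hx ⊢
  intro p hp
  let L : Matrix (Fin n) (Fin n) k →ₗ[k] Matrix (Fin n) (Fin n) k :=
    (LinearMap.mulRight k ((g⁻¹ : GL (Fin n) k) : Matrix (Fin n) (Fin n) k)).comp
      (LinearMap.mulLeft k (g : Matrix (Fin n) (Fin n) k))
  have h1 : subst L p ∈ groupIdeal Γ := mem_groupIdeal.2 fun y hy => by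
    rw [evm_subst]
    exact mem_groupIdeal.1 hp (g * y * g⁻¹) (hΓc g hg y hy)
  have h2 := hx _ h1
  rw [evm_subst] at h2
  exact h2

end Curves

/-! ### Elements of the Lie algebra as combinations of chords of curves -/

section SpanningCurves
open Module

variable {k : Type*} [Field k] {n : ℕ}

/-- The curve `t ↦ exp ((t - 1) A)` attached to a nilpotent matrix `A`; the shift moves the
identity to `t = 1`. -/
def expCurve (A : Matrix (Fin n) (Fin n) k) (hA : IsNilpotent A) (t : kˣ) : GL (Fin n) k :=
  (isUnit_expM hA ((t : k) - 1)).unit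

theorem coe_expCurve (A : Matrix (Fin n) (Fin n) k) (hA : IsNilpotent A) (t : kˣ) :
    (expCurve A hA t : Matrix (Fin n) (Fin n) k) = expM A ((t : k) - 1) := rfl

theorem isCurve_expCurve (A : Matrix (Fin n) (Fin n) k) (hA : IsNilpotent A) :
    IsCurve (expCurve A hA) := by
  refine ⟨fun i j => ?_, ?_⟩
  · have h : ∀ t : kˣ, (expCurve A hA t : Matrix (Fin n) (Fin n) k) i j =
        ((expPoly A i j).comp (Polynomial.X - Polynomial.C 1)).eval (t : k) := by
      intro t
      rw [coe_expCurve, Polynomial.eval_comp, ← eval_expPoly]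
      simp
    simp only [h]
    exact isLaurent_eval _
  · ext i j
    rw [coe_expCurve, Units.val_one, sub_self, expM_zero hA, Units.val_one]

theorem commute_expCurve {A B : Matrix (Fin n) (Fin n) k} (hA : IsNilpotent A) (h : Commute A B)
    (t : kˣ) : Commute (expCurve A hA t : Matrix (Fin n) (Fin n) k) B := by
  rw [coe_expCurve]
  exact Commute.sum_left _ _ _ fun m _ => (h.pow_left m).smul_left _

theorem expCurve_mem [CharZero k] {K : Subgroup (GL (Fin n) k)} (hK : IsAlgebraic K)
    {A : Matrix (Fin n) (Fin n) k} (hA : A ∈ lieAlg K) (hn : IsNilpotent A) (t : kˣ) :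
    expCurve A hn t ∈ K :=
  isAlgebraic_iff.1 hK _ fun p hp => evm_expM_eq_zero hA hn _ p hp

/-- The velocity of an exponential curve lies in the span of its chords. -/
theorem mem_span_expCurve [Infinite k] {A : Matrix (Fin n) (Fin n) k} (hA : IsNilpotent A) :
    A ∈ Submodule.span k
      (Set.range fun t => (expCurve A hA t : Matrix (Fin n) (Fin n) k) - 1) := by
  by_contra hne
  obtain ⟨l, hl, hle⟩ := Submodule.exists_le_ker_of_notMem hne
  have h1 : ∀ t : kˣ, l (expM A ((t : k) - 1)) = l 1 := by
    intro t
    have : expM A ((t : k) - 1) - 1 ∈ LinearMap.ker l :=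
      hle (Submodule.subset_span ⟨t, rfl⟩)
    rwa [LinearMap.mem_ker, map_sub, sub_eq_zero] at this
  let Q : Polynomial k := ∑ m ∈ Finset.range (nilpotencyClass A),
    Polynomial.monomial m ((m.factorial : k)⁻¹ * l (A ^ m))
  have hQ : ∀ t : k, Q.eval t = l (expM A t) := by
    intro t
    simp only [Q, Polynomial.eval_finsetSum, Polynomial.eval_monomial, expM, map_sum, map_smul,
      smul_eq_mul]
    exact Finset.sum_congr rfl fun m _ => by ring
  have hQC : Q = Polynomial.C (l 1) := by
    refine Polynomial.eq_of_infinite_eval_eq _ _ ?_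
    have hinf : ({-1}ᶜ : Set k).Infinite := (Set.finite_singleton _).infinite_compl
    refine hinf.mono fun t ht => ?_
    have ht0 : t + 1 ≠ 0 := fun h => ht (eq_neg_of_add_eq_zero_left h)
    have := h1 (Units.mk0 (t + 1) ht0)
    simp only [Units.val_mk0, add_sub_cancel_right] at this
    simp [hQ, this]
  have h2 := congrArg (Polynomial.coeff · 1) hQC
  simp only [Q, Polynomial.finsetSum_coeff, Polynomial.coeff_monomial, Polynomial.coeff_C] at h2
  by_cases hN : 1 < nilpotencyClass A
  · rw [Finset.sum_eq_single_of_mem 1 (by simpa using hN)] at h2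
    · simp at h2
      exact hl h2
    · intro m _ hm
      simp [hm]
  · have h3 : A ^ 1 = 0 := pow_eq_zero_of_le (by omega) (pow_nilpotencyClass hA)
    rw [pow_one] at h3
    exact hl (by rw [h3, map_zero])

theorem aeval_sub_eval_one_mem_span {R : Type*} [Ring R] [Algebra k R] (τ : R)
    (Q : Polynomial k) : Polynomial.aeval τ Q - algebraMap k R (Q.eval 1) ∈
      Submodule.span k (Set.range fun m : ℕ => τ ^ m - 1) := by
  induction Q using Polynomial.induction_on' with
  | add p q hp hq =>
    have := add_mem hp hq
    rw [map_add, Polynomial.eval_add, map_add]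
    convert this using 1
    abel
  | monomial m a =>
    rw [Polynomial.aeval_monomial, Polynomial.eval_monomial, one_pow, mul_one,
      ← Algebra.smul_def, Algebra.algebraMap_eq_smul_one, ← smul_sub]
    exact Submodule.smul_mem _ _ (Submodule.subset_span ⟨m, rfl⟩)

theorem two_zpow_injective [CharZero k] : Function.Injective fun m : ℤ => (2 : k) ^ m := by
  intro a b h
  have h1 : ((2 : ℚ) ^ a : ℚ) = (2 : ℚ) ^ b := by
    have : (((2 : ℚ) ^ a : ℚ) : k) = (((2 : ℚ) ^ b : ℚ) : k) := by
      push_cast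
      exact h
    exact_mod_cast this
  exact zpow_right_injective₀ (by norm_num) (by norm_num) h1

theorem commute_scalM [IsAlgClosed k] {A B : Matrix (Fin n) (Fin n) k} (h : Commute A B)
    (f : k → k) : Commute (scalM A f) B := by
  have h1 := commute_scal (h.map (Matrix.toLinAlgEquiv' : Matrix (Fin n) (Fin n) k ≃ₐ[k] _)) f
  have h2 := h1.map (LinearMap.toMatrixAlgEquiv' : _ ≃ₐ[k] Matrix (Fin n) (Fin n) k)
  simpa [scalM] using h2

theorem isNilpotent_sub_scalM [IsAlgClosed k]
    (A : Matrix (Fin n) (Fin n) k) : IsNilpotent (A - scalM A id) := by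
  have h := (isNilpotent_sub_scal (Matrix.toLinAlgEquiv' A)).map
    (LinearMap.toMatrixAlgEquiv' : _ ≃ₐ[k] Matrix (Fin n) (Fin n) k)
  simpa [scalM] using h

variable [IsAlgClosed k] [CharZero k]

theorem isCurve_torus (A : Matrix (Fin n) (Fin n) k) (f : k →ₗ[ℚ] ℚ) : IsCurve (torus A f) := by
  classical
  constructor
  · intro i j
    let S := (finite_spec (Matrix.toLinAlgEquiv' A)).toFinset
    have hS : ∀ t, scalM A (chi f t) =
        ∑ μ ∈ S, (((t ^ ⌊f μ⌋ : kˣ) : k)) • scalM A (Pi.single μ 1) := by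
      intro t
      have h1 : scal (Matrix.toLinAlgEquiv' A) (chi f t) = scal (Matrix.toLinAlgEquiv' A)
          (∑ μ ∈ S, (((t ^ ⌊f μ⌋ : kˣ) : k)) • Pi.single μ 1) := by
        refine scal_congr _ fun μ hμ => ?_
        rw [Finset.sum_apply, Finset.sum_eq_single_of_mem μ (by simpa [S] using hμ)]
        · simp [chi]
        · intro ν _ hν
          simp [hν.symm]
      simp only [scalM, h1, scal_sum, scal_smul, map_sum, map_smul]
    have : ∀ t, (torus A f t : Matrix (Fin n) (Fin n) k) i j =
        ∑ μ ∈ S, (((t ^ ⌊f μ⌋ : kˣ) : k)) * scalM A (Pi.single μ 1) i j := by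
      intro t
      rw [coe_torus, hS, Matrix.sum_apply]
      rfl
    simp only [this]
    exact IsLaurent.sum _ fun μ _ => (isLaurent_zpow _).mul (isLaurent_const _)
  · ext i j
    have : chi f 1 = 1 := by ext μ; simp [chi]
    rw [coe_torus, this, scalM, scal_one, map_one, Units.val_one]

/-- The velocity of a one-parameter subgroup lies in the span of its chords. -/
theorem scalM_mem_span_torus (A : Matrix (Fin n) (Fin n) k) (f : k →ₗ[ℚ] ℚ)
    (hf : ∀ μ ∈ spec A, ((⌊f μ⌋ : ℤ) : ℚ) = f μ) :
    scalM A (fun μ => (f μ : k)) ∈ Submodule.span k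
      (Set.range fun t => (torus A f t : Matrix (Fin n) (Fin n) k) - 1) := by
  classical
  set T := Matrix.toLinAlgEquiv' A
  let s : Finset ℤ := insert 0 ((finite_spec T).toFinset.image fun μ => ⌊f μ⌋)
  -- On the finitely many integers `m` that occur, `m` is a polynomial in `2 ^ m`; hence the
  -- replica is a polynomial in the point of the one-parameter subgroup at `t = 2`.
  let Q : Polynomial k := Lagrange.interpolate s (fun m : ℤ => (2 : k) ^ m) fun m => (m : k)
  have hQ : ∀ m ∈ s, Q.eval ((2 : k) ^ m) = m := fun m hm =>
    Lagrange.eval_interpolate_at_node _ two_zpow_injective.injOn hm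
  let u : kˣ := Units.mk0 2 two_ne_zero
  have h1 : scal T (fun μ => (f μ : k)) = Polynomial.aeval (scal T (chi f u)) Q := by
    rw [aeval_scal]
    refine scal_congr T fun μ hμ => ?_
    have h2 := hQ ⌊f μ⌋ (Finset.mem_insert_of_mem (Finset.mem_image_of_mem _ (by simpa using hμ)))
    have h3 : chi f u μ = (2 : k) ^ ⌊f μ⌋ := by simp [chi, u]
    rw [h3, h2, ← hf μ hμ]
    simp
  have h4 : Q.eval 1 = 0 := by simpa using hQ 0 (Finset.mem_insert_self _ _)
  have h5 := aeval_sub_eval_one_mem_span (scalM A (chi f u)) Q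
  rw [h4, map_zero, sub_zero] at h5
  have h6 : scalM A (fun μ => (f μ : k)) = Polynomial.aeval (scalM A (chi f u)) Q := by
    have h7 := Polynomial.aeval_algHom_apply
      (LinearMap.toMatrixAlgEquiv' : _ ≃ₐ[k] Matrix (Fin n) (Fin n) k).toAlgHom
      (scal T (chi f u)) Q
    rw [scalM, h1]
    exact h7.symm
  rw [h6]
  refine Submodule.span_mono ?_ h5
  rintro _ ⟨m, rfl⟩
  refine ⟨u ^ m, ?_⟩
  beta_reduce
  rw [coe_torus, scalM, scalM, ← map_pow]
  congr 2
  have h8 : ∀ m : ℕ, scal T (chi f u) ^ m = scal T (chi f (u ^ m)) := by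
    intro m
    induction m with
    | zero =>
      have : chi f (u ^ 0) = 1 := by ext μ; simp [chi]
      rw [this, scal_one, pow_zero]
    | succ m ih =>
      rw [pow_succ, ih, ← scal_mul]
      congr 1
      ext μ
      simp only [chi, Pi.mul_apply, ← Units.val_mul, ← mul_zpow, pow_succ]
  rw [h8]

/-- A `ℚ`-linear form becomes integral on a finite set after multiplication by a common
denominator. -/
theorem exists_mul_eq_intCast {F : Type*} [Field F] [CharZero F] (g : F →ₗ[ℚ] ℚ) (S : Finset F) :
    ∃ D : ℕ, D ≠ 0 ∧ ∀ μ ∈ S, ((⌊((D : ℚ) • g) μ⌋ : ℤ) : ℚ) = ((D : ℚ) • g) μ := by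
  classical
  refine ⟨∏ μ ∈ S, (g μ).den, by simp [Finset.prod_eq_zero_iff], fun μ hμ => ?_⟩
  obtain ⟨c, hc⟩ := Finset.dvd_prod_of_mem (fun μ => (g μ).den) hμ
  have : ((∏ μ ∈ S, (g μ).den : ℕ) : ℚ) • g μ = ((c * (g μ).num : ℤ) : ℚ) := by
    have h5 : ((∏ μ ∈ S, (g μ).den : ℕ) : ℚ) = ((g μ).den : ℚ) * c := by exact_mod_cast hc
    rw [h5, smul_eq_mul]
    conv_lhs => rw [← Rat.num_div_den (g μ)]
    have : ((g μ).den : ℚ) ≠ 0 := by simp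
    push_cast
    field_simp
    simp [Rat.num_div_den]
  rw [LinearMap.smul_apply, this, Int.floor_intCast]

/-- The semisimple part of a matrix is a linear combination of its replicas with integral
eigenvalues. -/
theorem scalM_id_mem_span (A : Matrix (Fin n) (Fin n) k) :
    scalM A id ∈ Submodule.span k {M | ∃ f : k →ₗ[ℚ] ℚ,
      (∀ μ ∈ spec A, ((⌊f μ⌋ : ℤ) : ℚ) = f μ) ∧ M = scalM A fun μ => (f μ : k)} := by
  classical
  set T := Matrix.toLinAlgEquiv' A with hT
  let S := (finite_spec T).toFinset
  let b := Basis.ofVectorSpace ℚ k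
  let I := S.biUnion fun μ => (b.repr μ).support
  have h1 : scal T id = scal T (∑ i ∈ I, b i • fun μ => ((b.coord i μ : ℚ) : k)) := by
    refine scal_congr T fun μ hμ => ?_
    have h2 : (b.repr μ).support ⊆ I :=
      Finset.subset_biUnion_of_mem (fun μ => (b.repr μ).support) (by simpa [S] using hμ)
    have h3 := b.linearCombination_repr μ
    rw [Finsupp.linearCombination_apply, Finsupp.sum_of_support_subset _ h2 _ (by simp)] at h3
    rw [id, Finset.sum_apply]
    conv_lhs => rw [← h3]
    refine Finset.sum_congr rfl fun i _ => ?_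
    simp [Rat.smul_def, mul_comm]
  have h4 : scalM A id = ∑ i ∈ I, b i • scalM A fun μ => ((b.coord i μ : ℚ) : k) := by
    rw [scalM, ← hT, h1]
    simp only [scal_sum, scal_smul, map_sum, map_smul, scalM, hT]
  rw [h4]
  refine Submodule.sum_mem _ fun i _ => Submodule.smul_mem _ _ ?_
  obtain ⟨D, hD, hDS⟩ := exists_mul_eq_intCast (b.coord i) S
  let f : k →ₗ[ℚ] ℚ := (D : ℚ) • b.coord i
  have hf : ∀ μ ∈ spec A, ((⌊f μ⌋ : ℤ) : ℚ) = f μ := fun μ hμ =>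
    hDS μ (by simpa [S, spec] using hμ)
  have h6 : scalM A (fun μ => ((b.coord i μ : ℚ) : k)) =
      ((D : k)⁻¹) • scalM A fun μ => (f μ : k) := by
    have h7 : (D : k) ≠ 0 := by exact_mod_cast hD
    rw [scalM, scalM, ← map_smul, ← scal_smul]
    congr 2
    ext μ
    simp [f, h7]
  rw [h6]
  exact Submodule.smul_mem _ _ (Submodule.subset_span ⟨f, hf, rfl⟩)

/-- An element of the Lie algebra of an algebraic group is a linear combination of chords of
rational curves in the group that commute with everything that commutes with the element. -/
theorem mem_span_curves {K : Subgroup (GL (Fin n) k)} (hK : IsAlgebraic K)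
    {A : Matrix (Fin n) (Fin n) k} (hA : A ∈ lieAlg K) :
    A ∈ Submodule.span k {M | ∃ γ : kˣ → GL (Fin n) k, IsCurve γ ∧ (∀ t, γ t ∈ K) ∧
      (∀ t B, Commute A B → Commute (γ t : Matrix (Fin n) (Fin n) k) B) ∧
      ∃ t, M = (γ t : Matrix (Fin n) (Fin n) k) - 1} := by
  set W := Submodule.span k {M | ∃ γ : kˣ → GL (Fin n) k, IsCurve γ ∧ (∀ t, γ t ∈ K) ∧
      (∀ t B, Commute A B → Commute (γ t : Matrix (Fin n) (Fin n) k) B) ∧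
      ∃ t, M = (γ t : Matrix (Fin n) (Fin n) k) - 1}
  have hs : scalM A id ∈ W := by
    refine Submodule.span_le.2 ?_ (scalM_id_mem_span A)
    rintro _ ⟨f, hf, rfl⟩
    refine Submodule.span_mono ?_ (scalM_mem_span_torus A f hf)
    rintro _ ⟨t, rfl⟩
    exact ⟨torus A f, isCurve_torus A f, torus_mem (isAlgebraic_iff.1 hK) hA f hf,
      fun t B h => commute_scalM h _, t, rfl⟩
  have hn : A - scalM A id ∈ W := by
    have hnil := isNilpotent_sub_scalM A
    have hmem : A - scalM A id ∈ lieAlg K := sub_mem hA (scalM_mem_lieAlg hA (AddMonoidHom.id k))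
    refine Submodule.span_mono ?_ (mem_span_expCurve hnil)
    rintro _ ⟨t, rfl⟩
    exact ⟨expCurve _ hnil, isCurve_expCurve _ hnil, expCurve_mem hK hmem hnil,
      fun t B h => commute_expCurve hnil (h.sub_left (commute_scalM h _)) t, t, rfl⟩
  have := add_mem hn hs
  rwa [sub_add_cancel] at this

end SpanningCurves

/-! ### Linear conditions and commutants -/

section LinearConditions
open Module

variable {k : Type*} [Field k] {n : ℕ}

/-- A subgroup cut out by a linear condition on `g - 1` is algebraic. -/
theorem isAlgebraic_of_sub_one_mem (L : Subgroup (GL (Fin n) k))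
    (U : Submodule k (Matrix (Fin n) (Fin n) k))
    (h : ∀ g : GL (Fin n) k, g ∈ L ↔ (g : Matrix (Fin n) (Fin n) k) - 1 ∈ U) :
    IsAlgebraic L := by
  refine isAlgebraic_iff.2 fun g hg => (h g).2 ?_
  by_contra hne
  obtain ⟨l, hl, hle⟩ := Submodule.exists_le_ker_of_notMem hne
  refine hl ?_
  have hC : ∀ (M : Matrix (Fin n) (Fin n) k), evm M (linPoly l - MvPolynomial.C (l 1)) =
      l (M - 1) := by
    intro M
    rw [map_sub, evm_linPoly, ← MvPolynomial.algebraMap_eq, AlgHom.commutes, map_sub]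
    rfl
  rw [← hC]
  refine hg _ (mem_groupIdeal.2 fun g' hg' => ?_)
  rw [hC]
  exact hle ((h g').1 hg')

/-- A linear condition on `g - 1` that holds for the elements of a group holds for its Lie
algebra. -/
theorem mem_of_mem_lieAlg_of_sub_one_mem {G : Subgroup (GL (Fin n) k)}
    (U : Submodule k (Matrix (Fin n) (Fin n) k))
    (h : ∀ g ∈ G, (g : Matrix (Fin n) (Fin n) k) - 1 ∈ U)
    {A : Matrix (Fin n) (Fin n) k} (hA : A ∈ lieAlg G) : A ∈ U := by
  rw [← Submodule.Quotient.mk_eq_zero, ← Submodule.mkQ_apply]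
  refine linearMap_eq_zero_of_mem_lieAlg U.mkQ (U.mkQ 1) (fun g hg => ?_) hA
  rw [← sub_eq_zero, ← map_sub, Submodule.mkQ_apply, Submodule.Quotient.mk_eq_zero]
  exact h g hg

/-- The matrices that commute with all elements of `S`. -/
def commutant (S : Set (Matrix (Fin n) (Fin n) k)) : Submodule k (Matrix (Fin n) (Fin n) k) :=
  (Subalgebra.centralizer k S).toSubmodule

theorem mem_commutant {S : Set (Matrix (Fin n) (Fin n) k)} {M : Matrix (Fin n) (Fin n) k} :
    M ∈ commutant S ↔ ∀ B ∈ S, Commute M B := by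
  rw [commutant, Subalgebra.mem_toSubmodule, Subalgebra.mem_centralizer_iff]
  exact forall₂_congr fun B _ => ⟨fun h => h.symm, fun h => h.symm⟩

theorem one_mem_commutant (S : Set (Matrix (Fin n) (Fin n) k)) :
    (1 : Matrix (Fin n) (Fin n) k) ∈ commutant S := mem_commutant.2 fun B _ => Commute.one_left B

/-- The subgroup of the elements of `GL n k` that commute with all elements of `S`. -/
def commutantGroup (S : Set (Matrix (Fin n) (Fin n) k)) : Subgroup (GL (Fin n) k) where
  carrier := {g | ∀ B ∈ S, Commute (g : Matrix (Fin n) (Fin n) k) B}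
  one_mem' B _ := Commute.one_left B
  mul_mem' hg hh B hB := (hg B hB).mul_left (hh B hB)
  inv_mem' hg B hB := (hg B hB).units_inv_left

theorem mem_commutantGroup {S : Set (Matrix (Fin n) (Fin n) k)} {g : GL (Fin n) k} :
    g ∈ commutantGroup S ↔ ∀ B ∈ S, Commute (g : Matrix (Fin n) (Fin n) k) B := Iff.rfl

theorem isAlgebraic_commutantGroup (S : Set (Matrix (Fin n) (Fin n) k)) :
    IsAlgebraic (commutantGroup S) :=
  isAlgebraic_of_sub_one_mem _ (commutant S) fun g => by
    rw [Submodule.sub_mem_iff_left _ (one_mem_commutant S), mem_commutant, mem_commutantGroup]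

theorem commute_of_mem_lieAlg {G : Subgroup (GL (Fin n) k)} {B : Matrix (Fin n) (Fin n) k}
    (h : ∀ g ∈ G, Commute (g : Matrix (Fin n) (Fin n) k) B)
    {A : Matrix (Fin n) (Fin n) k} (hA : A ∈ lieAlg G) : Commute A B :=
  mem_commutant.1 (mem_of_mem_lieAlg_of_sub_one_mem (commutant {B}) (fun g hg =>
    (Submodule.sub_mem_iff_left _ (one_mem_commutant _)).2
      (mem_commutant.2 fun B' hB' => by
        rw [Set.mem_singleton_iff.1 hB']; exact h g hg)) hA) B rfl

end LinearConditions

/-! ### Centralizers in the Lie algebra of a simple group -/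

section Centralizers

variable {k : Type*} [Field k] [IsAlgClosed k] [CharZero k] {n : ℕ}

/-- For a simple group `G` and a `G`-stable set `S` of matrices, the centralizer of `S` in the Lie
algebra is trivial, unless `G` centralizes `S`. -/
theorem commutant_trivial_or {G : Subgroup (GL (Fin n) k)} (hG : IsSimpleAlgGroup G)
    (S : Set (Matrix (Fin n) (Fin n) k))
    (hS : ∀ g ∈ G, ∀ B ∈ S, (g : Matrix (Fin n) (Fin n) k) * B *
      ((g⁻¹ : GL (Fin n) k) : Matrix (Fin n) (Fin n) k) ∈ S) :
    (∀ A ∈ lieAlg G, (∀ B ∈ S, Commute A B) → A = 0) ∨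
      ∀ g ∈ G, ∀ B ∈ S, Commute (g : Matrix (Fin n) (Fin n) k) B := by
  -- The curves in `G` that commute with `S` generate a closed connected normal subgroup.
  obtain ⟨N, hNG, hNn, hNa, hNc, hCN, hmin⟩ := exists_closed_normal_of_curves hG.isAlgebraic
    (C := {γ | IsCurve γ ∧ (∀ t, γ t ∈ G) ∧
      ∀ t, ∀ B ∈ S, Commute (γ t : Matrix (Fin n) (Fin n) k) B})
    (fun γ hγ => hγ.1) (fun γ hγ => hγ.2.1) (fun g hg γ hγ => by
      refine ⟨hγ.1.conj g, fun t => mul_mem (mul_mem hg (hγ.2.1 t)) (inv_mem hg),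
        fun t B hB => ?_⟩
      have h1 := hγ.2.2 t _ (hS g⁻¹ (inv_mem hg) B hB)
      have h2 := congrArg (fun M => (g : Matrix (Fin n) (Fin n) k) * M *
        ((g⁻¹ : GL (Fin n) k) : Matrix (Fin n) (Fin n) k)) h1.eq
      rw [Commute, SemiconjBy]
      simpa [mul_assoc] using h2)
  rcases hG.simple N hNG hNn hNa hNc with rfl | rfl
  · left
    intro A hA hAS
    have hspan := mem_span_curves hG.isAlgebraic hA
    have hbot : Submodule.span k {M | ∃ γ : kˣ → GL (Fin n) k, IsCurve γ ∧ (∀ t, γ t ∈ G) ∧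
        (∀ t B, Commute A B → Commute (γ t : Matrix (Fin n) (Fin n) k) B) ∧
        ∃ t, M = (γ t : Matrix (Fin n) (Fin n) k) - 1} = ⊥ := by
      rw [Submodule.span_eq_bot]
      rintro _ ⟨γ, hγ, hγG, hγA, t, rfl⟩
      have := hCN γ ⟨hγ, hγG, fun t B hB => hγA t B (hAS B hB)⟩ t
      rw [Subgroup.mem_bot] at this
      rw [this, Units.val_one, sub_self]
    rw [hbot, Submodule.mem_bot] at hspan
    exact hspan
  · right
    exact hmin (commutantGroup S) (isAlgebraic_commutantGroup S) fun γ hγ t => hγ.2.2 t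

/-- The Lie algebra of a simple algebraic group has trivial centre. -/
theorem center_lieAlg_trivial {G : Subgroup (GL (Fin n) k)} (hG : IsSimpleAlgGroup G)
    {A : Matrix (Fin n) (Fin n) k} (hA : A ∈ lieAlg G) (h : ∀ B ∈ lieAlg G, Commute A B) :
    A = 0 := by
  rcases commutant_trivial_or hG (lieAlg G : Set (Matrix (Fin n) (Fin n) k))
    (fun g hg B hB => conj_mem_lieAlg hg hB) with h1 | h1
  · exact h1 A hA h
  · rcases commutant_trivial_or hG ((fun g : GL (Fin n) k => (g : Matrix (Fin n) (Fin n) k)) '' G)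
      (by
        rintro g hg _ ⟨g', hg', rfl⟩
        exact ⟨g * g' * g⁻¹, mul_mem (mul_mem hg hg') (inv_mem hg), rfl⟩) with h2 | h2
    · refine h2 A hA ?_
      rintro _ ⟨g, hg, rfl⟩
      exact (h1 g hg A hA).symm
    · obtain ⟨x, hx, y, hy, hxy⟩ := hG.noncomm
      exact absurd (Units.ext (h2 x hx _ ⟨y, hy, rfl⟩).eq) hxy

end Centralizers

/-! ### Nondegeneracy of the Killing form on reductive subgroups -/

section Killing
open Module

variable {k : Type*} [Field k] {n : ℕ}

/-- The adjoint action of an element of `G`, as an automorphism of the Lie algebra of `G`. -/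
def adEquiv {G : Subgroup (GL (Fin n) k)} (g : GL (Fin n) k) (hg : g ∈ G) :
    lieAlg G ≃ₗ⁅k⁆ lieAlg G where
  toFun y := ⟨(g : Matrix (Fin n) (Fin n) k) * y *
    ((g⁻¹ : GL (Fin n) k) : Matrix (Fin n) (Fin n) k), conj_mem_lieAlg hg y.2⟩
  invFun y := ⟨((g⁻¹ : GL (Fin n) k) : Matrix (Fin n) (Fin n) k) * y *
    (g : Matrix (Fin n) (Fin n) k), by
      have := conj_mem_lieAlg (inv_mem hg) y.2
      rwa [inv_inv] at this⟩
  map_add' x y := by ext1; simp [mul_add, add_mul]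
  map_smul' c x := by ext1; simp
  map_lie' {x y} := by
    ext1
    simp [Ring.lie_def, mul_sub, sub_mul, mul_assoc]
  left_inv y := by ext1; simp [mul_assoc]
  right_inv y := by ext1; simp [mul_assoc]

theorem coe_adEquiv {G : Subgroup (GL (Fin n) k)} (g : GL (Fin n) k) (hg : g ∈ G) (y : lieAlg G) :
    (adEquiv g hg y : Matrix (Fin n) (Fin n) k) = (g : Matrix (Fin n) (Fin n) k) * y *
      ((g⁻¹ : GL (Fin n) k) : Matrix (Fin n) (Fin n) k) := rfl

theorem mem_lieSub {G H : Subgroup (GL (Fin n) k)} {y : lieAlg G} :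
    y ∈ lieSub G H ↔ (y : Matrix (Fin n) (Fin n) k) ∈ lieAlg H := Iff.rfl

theorem mem_orthCompl {G H : Subgroup (GL (Fin n) k)} {y : lieAlg G} :
    y ∈ orthCompl G H ↔ ∀ z ∈ lieSub G H, killingForm k (lieAlg G) z y = 0 := by
  rw [orthCompl, LinearMap.BilinForm.mem_orthogonal_iff]
  rfl

theorem killingForm_comm' {L : Type*} [LieRing L] [LieAlgebra k L] (x y : L) :
    killingForm k L x y = killingForm k L y x := LieModule.traceForm_comm k L L x y

theorem killingForm_lie {L : Type*} [LieRing L] [LieAlgebra k L] (x y z : L) :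
    killingForm k L ⁅x, y⁆ z = killingForm k L x ⁅y, z⁆ :=
  LieModule.traceForm_apply_lie_apply k L L x y z

theorem adEquiv_mem_orthCompl {G H : Subgroup (GL (Fin n) k)} (hHG : H ≤ G) {g : GL (Fin n) k}
    (hg : g ∈ H) {y : lieAlg G} (hy : y ∈ orthCompl G H) :
    adEquiv g (hHG hg) y ∈ orthCompl G H := by
  rw [mem_orthCompl] at hy ⊢
  intro z hz
  have h1 := LieAlgebra.killingForm_of_equiv_apply (adEquiv g (hHG hg))
    ((adEquiv g (hHG hg)).symm z) y
  rw [LieEquiv.apply_symm_apply] at h1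
  rw [h1]
  refine hy _ ?_
  have := conj_mem_lieAlg (inv_mem hg) (mem_lieSub.1 hz)
  rwa [inv_inv] at this

/-- The radical of the restriction of the Killing form of `Lie G` to `Lie H`, as a Lie algebra of
matrices. -/
def killingRad (G H : Subgroup (GL (Fin n) k)) : LieSubalgebra k (Matrix (Fin n) (Fin n) k) where
  carrier := {A | ∃ y : lieAlg G, y ∈ lieSub G H ∧ y ∈ orthCompl G H ∧ A = y}
  add_mem' := by
    rintro _ _ ⟨x, hx, hx', rfl⟩ ⟨y, hy, hy', rfl⟩
    exact ⟨x + y, add_mem hx hy, add_mem hx' hy', rfl⟩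
  zero_mem' := ⟨0, zero_mem _, zero_mem _, rfl⟩
  smul_mem' := by
    rintro c _ ⟨x, hx, hx', rfl⟩
    exact ⟨c • x, SMulMemClass.smul_mem c hx, Submodule.smul_mem _ c hx', rfl⟩
  lie_mem' := by
    rintro _ _ ⟨x, hx, hx', rfl⟩ ⟨y, hy, hy', rfl⟩
    refine ⟨⁅x, y⁆, LieSubalgebra.lie_mem _ hx hy, ?_, rfl⟩
    rw [mem_orthCompl] at hy' ⊢
    intro z hz
    rw [← killingForm_lie]
    exact hy' _ (LieSubalgebra.lie_mem _ hz hx)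

theorem conj_mem_killingRad {G H : Subgroup (GL (Fin n) k)} (hHG : H ≤ G) {g : GL (Fin n) k}
    (hg : g ∈ H) {A : Matrix (Fin n) (Fin n) k} (hA : A ∈ killingRad G H) :
    (g : Matrix (Fin n) (Fin n) k) * A * ((g⁻¹ : GL (Fin n) k) : Matrix (Fin n) (Fin n) k)
      ∈ killingRad G H := by
  obtain ⟨y, hy, hy', rfl⟩ := hA
  exact ⟨adEquiv g (hHG hg) y, conj_mem_lieAlg hg hy, adEquiv_mem_orthCompl hHG hg hy', rfl⟩

/-- A Lie algebra of nilpotent matrices strictly preserves a flag (Engel). -/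
theorem exists_flag (R : LieSubalgebra k (Matrix (Fin n) (Fin n) k))
    (hR : ∀ A ∈ R, IsNilpotent A) :
    ∃ F : ℕ → Submodule k (Fin n → k), F 0 = ⊤ ∧ (∃ N, F N = ⊥) ∧ Antitone F ∧
      ∀ A ∈ R, ∀ i, ∀ v ∈ F i, A *ᵥ v ∈ F (i + 1) := by
  let e : Matrix (Fin n) (Fin n) k →ₗ⁅k⁆ End k (Fin n → k) :=
    (lieEquivMatrix' (R := k) (n := Fin n)).symm.toLieHom
  let R' := R.map e
  have hnil : LieModule.IsNilpotent R' (Fin n → k) := by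
    rw [LieModule.isNilpotent_iff_forall (R := k)]
    rintro ⟨_, A, hA, rfl⟩
    have h1 := (hR A hA).map (Matrix.toLinAlgEquiv' : Matrix (Fin n) (Fin n) k ≃ₐ[k] _)
    exact h1
  obtain ⟨N, hN⟩ := (LieModule.isNilpotent_iff k R' (Fin n → k)).1 hnil
  refine ⟨fun i => (LieModule.lowerCentralSeries k R' (Fin n → k) i).toSubmodule, by simp,
    ⟨N, by simp [hN]⟩, fun i j h => LieModule.antitone_lowerCentralSeries k R' (Fin n → k) h,
    fun A hA i v hv => ?_⟩
  have h2 : ⁅(⟨e A, A, hA, rfl⟩ : R'), v⁆ ∈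
      LieModule.lowerCentralSeries k R' (Fin n → k) (i + 1) := by
    rw [LieModule.lowerCentralSeries_succ]
    exact LieSubmodule.lie_mem_lie (LieSubmodule.mem_top _) hv
  exact h2

/-- The matrices that lower a filtration by one step. -/
def lowering (F : ℕ → Submodule k (Fin n → k)) : Submodule k (Matrix (Fin n) (Fin n) k) where
  carrier := {M | ∀ i, ∀ v ∈ F i, M *ᵥ v ∈ F (i + 1)}
  add_mem' h h' i v hv := by rw [Matrix.add_mulVec]; exact add_mem (h i v hv) (h' i v hv)
  zero_mem' i v hv := by rw [Matrix.zero_mulVec]; exact zero_mem _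
  smul_mem' c M h i v hv := by rw [Matrix.smul_mulVec]; exact Submodule.smul_mem _ c (h i v hv)

theorem mul_mem_lowering {F : ℕ → Submodule k (Fin n → k)} (hF : Antitone F)
    {M M' : Matrix (Fin n) (Fin n) k} (h : M ∈ lowering F) (h' : M' ∈ lowering F) :
    M * M' ∈ lowering F := by
  intro i v hv
  rw [← Matrix.mulVec_mulVec]
  exact hF (Nat.le_succ _) (h _ _ (h' i v hv))

theorem pow_mulVec_mem {F : ℕ → Submodule k (Fin n → k)} (h0 : F 0 = ⊤)
    {M : Matrix (Fin n) (Fin n) k} (h : M ∈ lowering F) (m : ℕ) (v : Fin n → k) :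
    (M ^ m) *ᵥ v ∈ F m := by
  induction m with
  | zero => simp [h0]
  | succ m ih =>
    rw [pow_succ', ← Matrix.mulVec_mulVec]
    exact h m _ ih

theorem isNilpotent_of_mem_lowering {F : ℕ → Submodule k (Fin n → k)} (h0 : F 0 = ⊤)
    (hN : ∃ N, F N = ⊥) {M : Matrix (Fin n) (Fin n) k} (h : M ∈ lowering F) : IsNilpotent M := by
  obtain ⟨N, hN⟩ := hN
  refine ⟨N, ?_⟩
  refine Matrix.ext_of_mulVec_single fun i => ?_
  have := pow_mulVec_mem h0 h N (Pi.single i 1)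
  rw [hN, Submodule.mem_bot] at this
  rw [this, Matrix.zero_mulVec]

/-- The unipotent group of the elements that act trivially on the graded pieces of a finite
filtration. -/
def flagGroup (F : ℕ → Submodule k (Fin n → k)) (hF : Antitone F) (hN : ∃ N, F N = ⊥) :
    Subgroup (GL (Fin n) k) where
  carrier := {g | (g : Matrix (Fin n) (Fin n) k) - 1 ∈ lowering F}
  one_mem' := by simp [zero_mem]
  mul_mem' {g h} hg hh := by
    have : ((g * h : GL (Fin n) k) : Matrix (Fin n) (Fin n) k) - 1 =
        ((g : Matrix (Fin n) (Fin n) k) - 1) * ((h : Matrix (Fin n) (Fin n) k) - 1) +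
          ((g : Matrix (Fin n) (Fin n) k) - 1) + ((h : Matrix (Fin n) (Fin n) k) - 1) := by
      rw [Units.val_mul]
      noncomm_ring
    rw [Set.mem_ofPred_eq, this]
    exact add_mem (add_mem (mul_mem_lowering hF hg hh) hg) hh
  inv_mem' {g} hg := by
    obtain ⟨N, hN⟩ := hN
    have h1 : ((g⁻¹ : GL (Fin n) k) : Matrix (Fin n) (Fin n) k) - 1 =
        -(((g⁻¹ : GL (Fin n) k) : Matrix (Fin n) (Fin n) k) *
          ((g : Matrix (Fin n) (Fin n) k) - 1)) := by
      rw [mul_sub, ← Units.val_mul]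
      simp
    have h2 : ∀ m i, N ≤ i + m → ∀ v ∈ F i,
        ((g⁻¹ : GL (Fin n) k) : Matrix (Fin n) (Fin n) k) *ᵥ v ∈ F i := by
      intro m
      induction m with
      | zero =>
        intro i hi v hv
        have : F i = ⊥ := eq_bot_iff.2 (hN ▸ hF hi)
        rw [this, Submodule.mem_bot] at hv
        rw [hv, Matrix.mulVec_zero]
        exact zero_mem _
      | succ m ih =>
        intro i hi v hv
        have h3 : ((g⁻¹ : GL (Fin n) k) : Matrix (Fin n) (Fin n) k) *ᵥ v = v -
            ((g⁻¹ : GL (Fin n) k) : Matrix (Fin n) (Fin n) k) *ᵥ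
              (((g : Matrix (Fin n) (Fin n) k) - 1) *ᵥ v) := by
          have h4 := congrArg (· *ᵥ v) h1
          simp only [Matrix.sub_mulVec, Matrix.neg_mulVec, Matrix.one_mulVec,
            ← Matrix.mulVec_mulVec] at h4 ⊢
          rw [sub_eq_iff_eq_add] at h4
          rw [h4]
          abel
        rw [h3]
        exact sub_mem hv (hF (Nat.le_succ i) (ih (i + 1) (by omega) _ (hg i v hv)))
    rw [Set.mem_ofPred_eq, h1]
    refine neg_mem fun i v hv => ?_
    rw [← Matrix.mulVec_mulVec]
    exact h2 N (i + 1) (by omega) _ (hg i v hv)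

theorem mem_flagGroup {F : ℕ → Submodule k (Fin n → k)} {hF : Antitone F} {hN : ∃ N, F N = ⊥}
    {g : GL (Fin n) k} :
    g ∈ flagGroup F hF hN ↔ (g : Matrix (Fin n) (Fin n) k) - 1 ∈ lowering F := Iff.rfl

variable [IsAlgClosed k]

/-- Generalised eigenvectors of `ad x` in the Lie algebra are eigenvectors for bracketing with the
replicas of the matrix `x`. -/
theorem scalM_mul_sub_mul_scalM {G : Subgroup (GL (Fin n) k)} {x y : lieAlg G} {μ : k}
    (hy : y ∈ End.maxGenEigenspace (LieAlgebra.ad k (lieAlg G) x) μ) (f : k →+ k) :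
    scalM (x : Matrix (Fin n) (Fin n) k) f * y - y * scalM (x : Matrix (Fin n) (Fin n) k) f =
      f μ • (y : Matrix (Fin n) (Fin n) k) := by
  let e := (Matrix.toLinAlgEquiv' : Matrix (Fin n) (Fin n) k ≃ₐ[k] ((Fin n → k) →ₗ[k] Fin n → k))
  have h1 := map_mem_maxGenEigenspace (e.toLinearMap ∘ₗ (lieAlg G).toSubmodule.subtype)
    (S := LinearMap.mulLeft k (e x) - LinearMap.mulRight k (e x)) (fun u => by
      change e ((x : Matrix (Fin n) (Fin n) k) * u - u * x) = e x * e u - e u * e x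
      rw [map_sub, map_mul, map_mul]) hy
  have h2 := scal_mul_sub_mul_scal h1 f
  apply e.injective
  simp only [map_sub, map_mul, map_smul]
  have h3 : e (scalM (x : Matrix (Fin n) (Fin n) k) f) = scal (e x) f := toLin_scalM _ _
  rw [h3]
  exact h2

/-- Elements of the Lie algebra of a simple group that are nilpotent in the adjoint representation
are nilpotent matrices. -/
theorem isNilpotent_of_isNilpotent_ad [CharZero k] {G : Subgroup (GL (Fin n) k)}
    (hG : IsSimpleAlgGroup G) {x : lieAlg G} (hx : IsNilpotent (LieAlgebra.ad k (lieAlg G) x)) :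
    IsNilpotent (x : Matrix (Fin n) (Fin n) k) := by
  have h0 : scalM (x : Matrix (Fin n) (Fin n) k) id = 0 := by
    refine center_lieAlg_trivial hG (scalM_mem_lieAlg x.2 (AddMonoidHom.id k)) fun B hB => ?_
    have h1 : (⟨B, hB⟩ : lieAlg G) ∈
        End.maxGenEigenspace (LieAlgebra.ad k (lieAlg G) x) 0 := by
      rw [End.mem_maxGenEigenspace]
      obtain ⟨m, hm⟩ := hx
      exact ⟨m, by simp [hm]⟩
    have h2 := scalM_mul_sub_mul_scalM h1 (AddMonoidHom.id k)
    simp only [map_zero, zero_smul, sub_eq_zero] at h2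
    exact h2
  have h3 := isNilpotent_sub_scalM (x : Matrix (Fin n) (Fin n) k)
  rwa [h0, sub_zero] at h3

variable [CharZero k]

/-- The elements of the radical of the Killing form restricted to `Lie H` are nilpotent matrices,
since they are orthogonal to their replicas, which lie in `Lie H`. -/
theorem isNilpotent_of_mem_killingRad {G H : Subgroup (GL (Fin n) k)} (hG : IsSimpleAlgGroup G)
    (hHG : H ≤ G) {A : Matrix (Fin n) (Fin n) k} (hA : A ∈ killingRad G H) : IsNilpotent A := by
  obtain ⟨x, hx, hx', rfl⟩ := hA
  refine isNilpotent_of_isNilpotent_ad hG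
    (isNilpotent_of_trace_mul_scal_eq_zero _ fun f => ?_)
  let f' : k →+ k := (algebraMap ℚ k).toAddMonoidHom.comp f.toAddMonoidHom
  have hs : scalM (x : Matrix (Fin n) (Fin n) k) f' ∈ lieAlg H := scalM_mem_lieAlg hx f'
  let s : lieAlg G := ⟨_, lieAlg_mono hHG hs⟩
  have h1 : scal (LieAlgebra.ad k (lieAlg G) x) (fun μ => (f μ : k)) =
      LieAlgebra.ad k (lieAlg G) s := by
    refine end_ext_maxGenEigenspace (LieAlgebra.ad k (lieAlg G) x) fun μ y hy => ?_
    rw [scal_apply _ _ hy]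
    ext1
    exact (scalM_mul_sub_mul_scalM hy f').symm
  rw [h1]
  have h2 := mem_orthCompl.1 hx' s hs
  rw [killingForm_comm', killingForm_apply_apply] at h2
  exact h2

/-- The Killing form of the Lie algebra of a simple group is nondegenerate on the Lie algebra of
any reductive subgroup: otherwise the radical of the restricted form would exponentiate to a
normal unipotent subgroup. -/
theorem killingRad_eq_bot {G H : Subgroup (GL (Fin n) k)} (hG : IsSimpleAlgGroup G)
    (hHG : H ≤ G) (hH : IsReductive H ∨ H = G) : killingRad G H = ⊥ := by
  have hnil : ∀ A ∈ killingRad G H, IsNilpotent A := fun A hA =>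
    isNilpotent_of_mem_killingRad hG hHG hA
  have hHa : IsAlgebraic H := by
    rcases hH with h | rfl
    exacts [h.isAlgebraic, hG.isAlgebraic]
  obtain ⟨F, h0, hN, hF, hRF⟩ := exists_flag _ hnil
  obtain ⟨N, hNH, hNn, hNa, hNc, hCN, hmin⟩ := exists_closed_normal_of_curves hHa
    (C := {γ | IsCurve γ ∧ (∀ t, γ t ∈ H) ∧ ∃ A ∈ killingRad G H, ∀ t, ∃ Q : Polynomial k,
      (γ t : Matrix (Fin n) (Fin n) k) = 1 + A * Polynomial.aeval A Q})
    (fun γ hγ => hγ.1) (fun γ hγ => hγ.2.1) (fun g hg γ hγ => by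
      obtain ⟨hγ, hγH, A, hA, hγA⟩ := hγ
      refine ⟨hγ.conj g, fun t => mul_mem (mul_mem hg (hγH t)) (inv_mem hg), _,
        conj_mem_killingRad hHG hg hA, fun t => ?_⟩
      obtain ⟨Q, hQ⟩ := hγA t
      refine ⟨Q, ?_⟩
      let c : Matrix (Fin n) (Fin n) k ≃ₐ[k] Matrix (Fin n) (Fin n) k :=
        MulSemiringAction.toAlgEquiv k _ (ConjAct.toConjAct g)
      have hc : ∀ M, c M = (g : Matrix (Fin n) (Fin n) k) * M *
          ((g⁻¹ : GL (Fin n) k) : Matrix (Fin n) (Fin n) k) := fun M => rfl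
      have h1 := congrArg c hQ
      rw [map_add, map_one, map_mul, ← AlgEquiv.coe_toAlgHom, ← Polynomial.aeval_algHom_apply] at h1
      exact h1)
  have hbot : N = ⊥ → killingRad G H = ⊥ := by
    rintro rfl
    rw [eq_bot_iff]
    intro A hA
    have hAn := hnil A hA
    have hAH : A ∈ lieAlg H := by
      obtain ⟨y, hy, -, rfl⟩ := hA
      exact hy
    have hspan := mem_span_expCurve hAn
    have : Submodule.span k
        (Set.range fun t => (expCurve A hAn t : Matrix (Fin n) (Fin n) k) - 1) = ⊥ := by
      rw [Submodule.span_eq_bot]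
      rintro _ ⟨t, rfl⟩
      have := hCN (expCurve A hAn) ⟨isCurve_expCurve A hAn, expCurve_mem hHa hAH hAn, A, hA,
        fun t => exists_expM_eq hAn _⟩ t
      rw [Subgroup.mem_bot] at this
      simp [this]
    rw [this, Submodule.mem_bot] at hspan
    simp [hspan]
  have hNF : N ≤ flagGroup F hF hN := by
    refine hmin _ (isAlgebraic_of_sub_one_mem _ (lowering F) fun g => Iff.rfl) fun γ hγ t => ?_
    obtain ⟨-, -, A, hA, hγA⟩ := hγ
    obtain ⟨Q, hQ⟩ := hγA t
    rw [mem_flagGroup, hQ, add_sub_cancel_left]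
    have hc : Commute A (Polynomial.aeval A Q) := by
      have := Commute.map (Commute.all Polynomial.X Q) (Polynomial.aeval (R := k) A)
      rwa [Polynomial.aeval_X] at this
    have hst : ∀ (Q : Polynomial k) (i : ℕ), ∀ v ∈ F i, (Polynomial.aeval A Q) *ᵥ v ∈ F i := by
      intro Q i v hv
      induction Q using Polynomial.induction_on generalizing v with
      | C a =>
        rw [Polynomial.aeval_C, Algebra.algebraMap_eq_smul_one, Matrix.smul_mulVec,
          Matrix.one_mulVec]
        exact Submodule.smul_mem _ a hv
      | add p q hp hq =>
        rw [map_add, Matrix.add_mulVec]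
        exact add_mem (hp v hv) (hq v hv)
      | monomial m a ih =>
        rw [pow_succ, ← mul_assoc, map_mul, Polynomial.aeval_X, ← Matrix.mulVec_mulVec]
        exact ih _ (hF (Nat.le_succ i) (hRF A hA i v hv))
    intro i v hv
    rw [← Matrix.mulVec_mulVec]
    exact hRF A hA i _ (hst Q i v hv)
  rcases hH with hH | rfl
  · exact hbot (hH.unipRadical N hNH hNn hNa hNc fun g hg =>
      isNilpotent_of_mem_lowering h0 hN (hNF hg))
  · rcases hG.simple N hNH hNn hNa hNc with h | rfl
    · exact hbot h
    · -- Here the whole group is unipotent, so its Lie algebra is nilpotent with trivial centre.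
      have h1 : ∀ A ∈ lieAlg N, IsNilpotent A := fun A hA =>
        isNilpotent_of_mem_lowering h0 hN
          (mem_of_mem_lieAlg_of_sub_one_mem (lowering F) (fun g hg => hNF hg) hA)
      have h2 : LieModule.IsNilpotent (lieAlg N) (lieAlg N) := by
        rw [LieModule.isNilpotent_iff_forall (R := k)]
        intro x
        exact LieSubalgebra.isNilpotent_ad_of_isNilpotent_ad _
          (LieAlgebra.ad_nilpotent_of_nilpotent (h1 x x.2))
      have h3 : Subsingleton (lieAlg N) := by
        by_contra hns
        rw [not_subsingleton_iff_nontrivial] at hns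
        obtain ⟨z, hz⟩ := (nontrivial_iff_exists_ne 0).1
          (LieModule.nontrivial_max_triv_of_isNilpotent k (lieAlg N) (lieAlg N))
        refine hz (Subtype.ext (Subtype.ext (center_lieAlg_trivial hG z.1.2 fun B hB => ?_)))
        have h4 := congrArg Subtype.val (z.2 ⟨B, hB⟩)
        exact (sub_eq_zero.1 h4).symm
      rw [eq_bot_iff]
      rintro _ ⟨y, -, -, rfl⟩
      simp [Subsingleton.elim y 0]

/-- `Lie G` is the direct sum of `Lie H` and its orthogonal complement, for reductive `H`. -/
theorem isCompl_lieSub_orthCompl {G H : Subgroup (GL (Fin n) k)} (hG : IsSimpleAlgGroup G)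
    (hHG : H ≤ G) (hH : IsReductive H) :
    IsCompl (lieSub G H).toSubmodule (orthCompl G H) := by
  rw [orthCompl, LinearMap.BilinForm.isCompl_orthogonal_iff_disjoint
    (LieModule.traceForm_isSymm k (lieAlg G) (lieAlg G)).isRefl, disjoint_iff, eq_bot_iff]
  rintro y ⟨hy, hy'⟩
  have h1 : (y : Matrix (Fin n) (Fin n) k) ∈ killingRad G H := ⟨y, hy, hy', rfl⟩
  rw [killingRad_eq_bot hG hHG (Or.inl hH)] at h1
  simpa using h1

theorem isKilling_lieAlg {G : Subgroup (GL (Fin n) k)} (hG : IsSimpleAlgGroup G) :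
    LieAlgebra.IsKilling k (lieAlg G) := by
  refine ⟨?_⟩
  rw [eq_bot_iff]
  intro y hy
  have h1 : (y : Matrix (Fin n) (Fin n) k) ∈ killingRad G G := by
    refine ⟨y, y.2, mem_orthCompl.2 fun z _ => ?_, rfl⟩
    exact (LieIdeal.mem_killingCompl k (lieAlg G) ⊤).1 hy z (LieSubmodule.mem_top z)
  rw [killingRad_eq_bot hG le_rfl (Or.inr rfl)] at h1
  simpa using h1

end Killing

/-! ### Orbits of ad-nilpotent elements are cones -/

section Cone
open Module

/-- In a Lie algebra with nondegenerate Killing form, an ad-nilpotent element `x` lies in the image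
of `ad x`: that image is the orthogonal of the centralizer of `x`, and `x` is orthogonal to its
centralizer because the product of commuting endomorphisms is nilpotent if one of them is. -/
theorem exists_lie_eq_self {k L : Type*} [Field k] [LieRing L] [LieAlgebra k L]
    [FiniteDimensional k L] [LieAlgebra.IsKilling k L] {x : L}
    (hx : IsNilpotent (LieAlgebra.ad k L x)) : ∃ h : L, ⁅h, x⁆ = x := by
  have hrefl : (killingForm k L).IsRefl := (LieModule.traceForm_isSymm k L L).isRefl
  set R := LinearMap.range (LieAlgebra.ad k L x)
  have h1 : x ∈ (killingForm k L).orthogonal ((killingForm k L).orthogonal R) := by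
    rw [LinearMap.BilinForm.mem_orthogonal_iff]
    intro y hy
    rw [LinearMap.BilinForm.mem_orthogonal_iff] at hy
    have hxy : ⁅x, y⁆ = 0 := by
      refine (LieAlgebra.IsKilling.killingForm_nondegenerate k L).1 _ fun z => ?_
      have h2 : killingForm k L ⁅x, z⁆ y = 0 := hy _ ⟨z, rfl⟩
      rw [← lie_skew, map_neg, LinearMap.neg_apply, killingForm_lie, neg_eq_zero] at h2
      rw [killingForm_comm', h2]
    have hc : Commute (LieAlgebra.ad k L y) (LieAlgebra.ad k L x) := by
      rw [commute_iff_lie_eq, ← LieHom.map_lie, ← lie_skew, hxy, neg_zero, map_zero]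
    change killingForm k L y x = 0
    rw [killingForm_apply_apply]
    exact (LinearMap.isNilpotent_trace_of_isNilpotent (hc.isNilpotent_mul_left hx)).eq_zero
  rw [LinearMap.BilinForm.orthogonal_orthogonal
    (LieAlgebra.IsKilling.killingForm_nondegenerate k L) hrefl] at h1
  obtain ⟨h, hh⟩ := h1
  refine ⟨-h, ?_⟩
  rw [LieAlgebra.ad_apply] at hh
  rw [neg_lie, lie_skew, hh]

variable {k : Type*} [Field k] [IsAlgClosed k] [CharZero k] {n : ℕ}

/-- If `[h, x] = x`, then the one-parameter subgroups attached to the replicas of `h` scale `x`. -/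
theorem torus_conj {h x : Matrix (Fin n) (Fin n) k} (hx : h * x - x * h = x) (f : k →ₗ[ℚ] ℚ)
    {m : ℤ} (hm : f 1 = m) (t : kˣ) :
    (torus h f t : Matrix (Fin n) (Fin n) k) * x *
      (((torus h f t)⁻¹ : GL (Fin n) k) : Matrix (Fin n) (Fin n) k) = ((t ^ m : kˣ) : k) • x := by
  let e := (Matrix.toLinAlgEquiv' : Matrix (Fin n) (Fin n) k ≃ₐ[k] ((Fin n → k) →ₗ[k] Fin n → k))
  have h1 : e x ∈ End.maxGenEigenspace
      (LinearMap.mulLeft k (e h) - LinearMap.mulRight k (e h)) (1 : k) := by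
    rw [End.mem_maxGenEigenspace]
    refine ⟨1, ?_⟩
    simp only [pow_one, LinearMap.sub_apply, LinearMap.mulLeft_apply, LinearMap.mulRight_apply,
      Module.End.one_apply, one_smul]
    rw [← map_mul, ← map_mul, ← map_sub, hx, sub_self]
  have h2 := scal_mul_eq h1 (chi f t) ((t ^ m : kˣ) : k) fun ν _ => by
    simp only [chi, map_add, hm, Int.floor_intCast_add, zpow_add, Units.val_mul]
  have h3 : (torus h f t : Matrix (Fin n) (Fin n) k) * x =
      ((t ^ m : kˣ) : k) • (x * (torus h f t : Matrix (Fin n) (Fin n) k)) := by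
    apply e.injective
    rw [map_mul, map_smul, map_mul]
    have h4 : e (torus h f t : Matrix (Fin n) (Fin n) k) = scal (e h) (chi f t) := by
      rw [coe_torus]; exact toLin_scalM _ _
    rw [h4]
    exact h2
  rw [h3, smul_mul_assoc, mul_assoc, ← Units.val_mul, mul_inv_cancel, Units.val_one, mul_one]

/-- The orbit of an ad-nilpotent element is stable under nonzero scalars. -/
theorem smul_mem_adOrbit {G : Subgroup (GL (Fin n) k)} (hG : IsSimpleAlgGroup G) {x : lieAlg G}
    (hx : IsNilpotent (LieAlgebra.ad k (lieAlg G) x)) {c : k} (hc : c ≠ 0) {y : lieAlg G}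
    (hy : y ∈ adOrbit G x) : c • y ∈ adOrbit G x := by
  classical
  have := isKilling_lieAlg hG
  obtain ⟨h, hh⟩ := exists_lie_eq_self hx
  have hh' : (h : Matrix (Fin n) (Fin n) k) * x - x * h = x := congrArg Subtype.val hh
  -- A replica of `h` with integral eigenvalues that acts on `x` with a nonzero weight.
  let b := Basis.ofVectorSpace ℚ k
  obtain ⟨i, hi⟩ : ∃ i, b.coord i 1 ≠ 0 := by
    by_contra! h0
    exact one_ne_zero (b.ext_elem (x := (1 : k)) (y := 0) fun i => by simpa using h0 i)
  obtain ⟨D, hD, hDS⟩ := exists_mul_eq_intCast (b.coord i)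
    (insert 1 (finite_spec (Matrix.toLinAlgEquiv' (h : Matrix (Fin n) (Fin n) k))).toFinset)
  let f : k →ₗ[ℚ] ℚ := (D : ℚ) • b.coord i
  have hf : ∀ μ ∈ spec (h : Matrix (Fin n) (Fin n) k), ((⌊f μ⌋ : ℤ) : ℚ) = f μ := by
    intro μ hμ
    exact hDS μ (Finset.mem_insert_of_mem (by simpa [spec] using hμ))
  have h1 : f 1 = (⌊f 1⌋ : ℤ) := (hDS 1 (Finset.mem_insert_self _ _)).symm
  have hm : ⌊f 1⌋ ≠ 0 := by
    intro h0
    rw [h0, Int.cast_zero] at h1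
    exact mul_ne_zero (Nat.cast_ne_zero.2 hD) hi h1
  obtain ⟨t, ht⟩ : ∃ t : kˣ, ((t ^ ⌊f 1⌋ : kˣ) : k) = c := by
    obtain ⟨s, hs⟩ := IsAlgClosed.exists_pow_nat_eq c (Int.natAbs_pos.2 hm)
    have hs0 : s ≠ 0 := by
      rintro rfl
      rw [zero_pow (Int.natAbs_ne_zero.2 hm)] at hs
      exact hc hs.symm
    rcases Int.natAbs_eq ⌊f 1⌋ with h2 | h2
    · refine ⟨Units.mk0 s hs0, ?_⟩
      rw [h2, zpow_natCast, Units.val_pow_eq_pow_val, Units.val_mk0, hs]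
    · refine ⟨(Units.mk0 s hs0)⁻¹, ?_⟩
      rw [h2, zpow_neg, zpow_natCast, inv_pow, inv_inv, Units.val_pow_eq_pow_val, Units.val_mk0, hs]
  obtain ⟨g, hg, hy⟩ := hy
  refine ⟨g * torus (h : Matrix (Fin n) (Fin n) k) f t, mul_mem hg
    (torus_mem (isAlgebraic_iff.1 hG.isAlgebraic) h.2 f hf t), ?_⟩
  have h3 := torus_conj hh' f h1 t
  rw [ht] at h3
  rw [mul_inv_rev, Units.val_mul, Units.val_mul, SetLike.val_smul, hy]
  calc _ = (g : Matrix (Fin n) (Fin n) k) * (c • (x : Matrix (Fin n) (Fin n) k)) *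
      ((g⁻¹ : GL (Fin n) k) : Matrix (Fin n) (Fin n) k) := by simp
    _ = _ := by rw [← h3]; simp only [mul_assoc]

end Cone

/-! ### Regular functions and finite morphisms -/

section RegularFunctions
open Module

variable {k : Type*} [Field k] {V W : Type*} [AddCommGroup V] [Module k V]
  [AddCommGroup W] [Module k W] {ι κ : Type*}

/-- The function on `V` given by a polynomial in the coordinates of a basis. -/
def coordFun (b : Basis ι k V) : MvPolynomial ι k →ₐ[k] (V → k) :=
  MvPolynomial.aeval fun i => (b.coord i : V → k)

theorem coordFun_apply (b : Basis ι k V) (p : MvPolynomial ι k) (v : V) :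
    coordFun b p v = MvPolynomial.aeval (b.repr v : ι → k) p := by
  have : (Pi.evalAlgHom k (fun _ : V => k) v).comp (coordFun b) =
      MvPolynomial.aeval (b.repr v : ι → k) := by
    ext i
    simp [coordFun]
  exact DFunLike.congr_fun this p

/-- The linear polynomial that represents a linear form in the coordinates of a basis. -/
def coordLin [Fintype ι] (b : Basis ι k V) (l : Dual k V) : MvPolynomial ι k :=
  ∑ i, MvPolynomial.C (l (b i)) * MvPolynomial.X i

theorem coordFun_coordLin [Fintype ι] (b : Basis ι k V) (l : Dual k V) :
    coordFun b (coordLin b l) = l := by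
  ext v
  rw [coordFun_apply, coordLin, map_sum]
  conv_rhs => rw [← b.sum_repr v, map_sum]
  refine Finset.sum_congr rfl fun i _ => ?_
  rw [map_mul, MvPolynomial.aeval_X, MvPolynomial.aeval_C, map_smul, smul_eq_mul, mul_comm]
  rfl

theorem coordLin_isHomogeneous [Fintype ι] (b : Basis ι k V) (l : Dual k V) :
    (coordLin b l).IsHomogeneous 1 := by
  refine MvPolynomial.IsHomogeneous.sum _ _ _ fun i _ => ?_
  have := (MvPolynomial.isHomogeneous_C ι (l (b i))).mul (MvPolynomial.isHomogeneous_X k i)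
  simpa using this

theorem range_coordFun [Fintype ι] (b : Basis ι k V) : (coordFun b).range = polyFun k V := by
  refine le_antisymm ?_ (Algebra.adjoin_le ?_)
  · rw [coordFun, ← Algebra.adjoin_range_eq_range_aeval]
    refine Algebra.adjoin_mono ?_
    rintro _ ⟨i, rfl⟩
    exact ⟨b.coord i, rfl⟩
  · rintro _ ⟨l, rfl⟩
    exact ⟨coordLin b l, coordFun_coordLin b l⟩

theorem mem_regFun {X : Set V} {q : X → k} :
    q ∈ regFun k X ↔ ∃ p ∈ polyFun k V, q = fun v : X => p v := by
  rw [regFun, Subalgebra.mem_map]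
  exact exists_congr fun p => and_congr_right fun _ => eq_comm

theorem comp_mem_polyFun (φ : V →ₗ[k] W) {q : W → k} (hq : q ∈ polyFun k W) :
    (fun v => q (φ v)) ∈ polyFun k V := by
  induction hq using Algebra.adjoin_induction with
  | mem q hq =>
    obtain ⟨l, rfl⟩ := hq
    exact Algebra.subset_adjoin ⟨l ∘ₗ φ, rfl⟩
  | algebraMap c => exact Subalgebra.algebraMap_mem _ c
  | add p q _ _ hp hq => exact add_mem hp hq
  | mul p q _ _ hp hq => exact mul_mem hp hq

theorem pullback_mem_regFun (φ : V →ₗ[k] W) {X : Set V} {Y : Set W} (h : ∀ v ∈ X, φ v ∈ Y)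
    (q : regFun k Y) : pullback k (fun v : X => (⟨φ v, h v v.2⟩ : Y)) q ∈ regFun k X := by
  obtain ⟨q, hq⟩ := q
  obtain ⟨p, hp, rfl⟩ := mem_regFun.1 hq
  exact mem_regFun.2 ⟨_, comp_mem_polyFun φ hp, rfl⟩

/-- The homomorphism of algebras of regular functions attached to a morphism `X → Y` that is the
restriction of a linear map. -/
def comorphism (φ : V →ₗ[k] W) {X : Set V} {Y : Set W} (h : ∀ v ∈ X, φ v ∈ Y) :
    regFun k Y →ₐ[k] regFun k X :=
  ((pullback k fun v : X => (⟨φ v, h v v.2⟩ : Y)).comp (regFun k Y).val).codRestrict (regFun k X)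
    (pullback_mem_regFun φ h)

/-- The regular function on `X` given by a polynomial in the coordinates. -/
def coordReg [Fintype ι] (b : Basis ι k V) (X : Set V) : MvPolynomial ι k →ₐ[k] regFun k X :=
  ((AlgHom.pi (R := k) (A := fun _ : X => k) fun x =>
    Pi.evalAlgHom k (fun _ : V => k) (x : V)).comp (coordFun b)).codRestrict (regFun k X) fun p =>
      ⟨coordFun b p, by rw [← range_coordFun b]; exact ⟨p, rfl⟩, rfl⟩

theorem coordReg_apply [Fintype ι] (b : Basis ι k V) (X : Set V) (p : MvPolynomial ι k) (v : X) :
    (coordReg b X p : X → k) v = coordFun b p v := rfl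

theorem coordReg_surjective [Fintype ι] (b : Basis ι k V) (X : Set V) :
    Function.Surjective (coordReg b X) := by
  rintro ⟨q, hq⟩
  obtain ⟨p, hp, rfl⟩ := mem_regFun.1 hq
  rw [← range_coordFun b] at hp
  obtain ⟨p, rfl⟩ := hp
  exact ⟨p, rfl⟩

theorem coordReg_eq_zero_iff [Fintype ι] (b : Basis ι k V) (X : Set V) (p : MvPolynomial ι k) :
    coordReg b X p = 0 ↔ ∀ v ∈ X, coordFun b p v = 0 := by
  constructor
  · intro h v hv
    have := congrFun (congrArg Subtype.val h) ⟨v, hv⟩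
    exact this
  · intro h
    ext v
    exact h v v.2

theorem mem_zclosure_iff_coordFun [Fintype ι] (b : Basis ι k V) {X : Set V} {v : V} :
    v ∈ zclosure k X ↔ ∀ p, coordReg b X p = 0 → coordFun b p v = 0 := by
  rw [mem_zclosure, ← range_coordFun b]
  constructor
  · intro h p hp
    exact h _ ⟨p, rfl⟩ ((coordReg_eq_zero_iff b X p).1 hp)
  · rintro h _ ⟨p, rfl⟩ hp
    exact h p ((coordReg_eq_zero_iff b X p).2 hp)

theorem dual_ext {w w' : W} (h : ∀ l : Dual k W, l w = l w') : w = w' := by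
  rw [← sub_eq_zero, ← Module.forall_dual_apply_eq_zero_iff k]
  intro l
  rw [map_sub, h, sub_self]

theorem zclosure_zclosure (X : Set V) : zclosure k (zclosure k X) = zclosure k X := by
  let _ := zariski k V
  exact closure_closure

theorem zdim_zclosure (X : Set V) : zdim k (zclosure k X) = zdim k X := by
  rw [zdim, zdim, zclosure_zclosure]

theorem zclosure_mono {X Y : Set V} (h : X ⊆ Y) : zclosure k X ⊆ zclosure k Y := by
  let _ := zariski k V
  exact closure_mono h

/-- Maximal ideals of `k[X]` are the points of `X`, for Zariski closed `X`. -/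
theorem exists_point_of_isMaximal [IsAlgClosed k] [FiniteDimensional k V] {X : Set V}
    (hX : zclosure k X = X) (Q : Ideal (regFun k X)) [hQ : Q.IsMaximal] :
    ∃ v : X, ∀ q ∈ Q, (q : X → k) v = 0 := by
  let b := Module.finBasis k V
  have h1 := Ideal.comap_isMaximal_of_surjective (coordReg b X).toRingHom
    (coordReg_surjective b X) (K := Q)
  obtain ⟨x, hx⟩ := MvPolynomial.isMaximal_iff_eq_vanishingIdeal_singleton.1 h1
  let v : V := b.equivFun.symm x
  have hv : ∀ p, coordFun b p v = MvPolynomial.aeval x p := by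
    intro p
    rw [coordFun_apply]
    congr 2
    exact b.equivFun.apply_symm_apply x
  have hvX : v ∈ X := by
    rw [← hX, mem_zclosure_iff_coordFun b]
    intro p hp
    rw [hv, ← MvPolynomial.mem_vanishingIdeal_singleton_iff, ← hx, Ideal.mem_comap]
    change coordReg b X p ∈ Q
    rw [hp]
    exact zero_mem Q
  refine ⟨⟨v, hvX⟩, fun q hq => ?_⟩
  obtain ⟨p, rfl⟩ := coordReg_surjective b X q
  rw [coordReg_apply, hv, ← MvPolynomial.mem_vanishingIdeal_singleton_iff, ← hx]
  exact hq

/-- The image of a finite morphism is closed (lying over). -/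
theorem image_closed_of_finite [IsAlgClosed k] [FiniteDimensional k V] (φ : V →ₗ[k] W)
    {X : Set V} (hX : zclosure k X = X)
    (hfin : (comorphism φ (X := X) (Y := Set.univ) fun _ _ => Set.mem_univ _ :
      regFun k (Set.univ : Set W) →+* regFun k X).Finite) :
    zclosure k (φ '' X) = φ '' X := by
  refine (subset_zclosure _).antisymm' fun y hy => ?_
  let F := comorphism φ (X := X) (Y := Set.univ) fun _ _ => Set.mem_univ _
  let _ := F.toRingHom.toAlgebra
  have hint : Algebra.IsIntegral (regFun k (Set.univ : Set W)) (regFun k X) :=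
    ⟨hfin.to_isIntegral⟩
  let ev : regFun k (Set.univ : Set W) →ₐ[k] k :=
    (Pi.evalAlgHom k (fun _ : (Set.univ : Set W) => k) ⟨y, Set.mem_univ y⟩).comp
      (regFun k (Set.univ : Set W)).val
  have hmax : (RingHom.ker ev.toRingHom).IsMaximal :=
    RingHom.ker_isMaximal_of_surjective _ fun c => ⟨algebraMap k _ c, rfl⟩
  obtain ⟨Q, hQ, hQc⟩ := Ideal.exists_ideal_over_maximal_of_isIntegral
    (S := regFun k X) (RingHom.ker ev.toRingHom) (by
      rintro ⟨q, hq⟩ hq0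
      obtain ⟨p, hp, rfl⟩ := mem_regFun.1 hq
      refine mem_zclosure.1 hy p hp ?_
      rintro _ ⟨v, hv, rfl⟩
      exact congrFun (congrArg Subtype.val hq0) ⟨v, hv⟩)
  obtain ⟨v, hv⟩ := exists_point_of_isMaximal hX Q
  refine ⟨v, v.2, dual_ext (k := k) fun l => ?_⟩
  let q : regFun k (Set.univ : Set W) := ⟨fun w => l w - l y, mem_regFun.2
    ⟨fun w => l w - l y, sub_mem (Algebra.subset_adjoin ⟨l, rfl⟩)
      (Subalgebra.algebraMap_mem _ (l y)), rfl⟩⟩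
  have h1 : q ∈ RingHom.ker ev.toRingHom := sub_self (l y)
  rw [← hQc, Ideal.mem_comap] at h1
  exact sub_eq_zero.1 (hv _ h1)

/-- The fibres of a finite morphism are finite: on a fibre each coordinate is a root of a fixed
monic polynomial. -/
theorem finite_fiber_of_finite [FiniteDimensional k V] (φ : V →ₗ[k] W) {X : Set V}
    (hfin : (comorphism φ (X := X) (Y := Set.univ) fun _ _ => Set.mem_univ _ :
      regFun k (Set.univ : Set W) →+* regFun k X).Finite) (y : W) :
    {v | v ∈ X ∧ φ v = y}.Finite := by
  let F := comorphism φ (X := X) (Y := Set.univ) fun _ _ => Set.mem_univ _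
  let b := Module.finBasis k V
  let ev : regFun k (Set.univ : Set W) →+* k :=
    (Pi.evalRingHom (fun _ : (Set.univ : Set W) => k) ⟨y, Set.mem_univ y⟩).comp
      (regFun k (Set.univ : Set W)).val.toRingHom
  have h1 : ∀ i, ∃ P : Polynomial k, P ≠ 0 ∧ ∀ v ∈ X, φ v = y → P.IsRoot (b.repr v i) := by
    intro i
    obtain ⟨P, hP, hP0⟩ := hfin.to_isIntegral (coordReg b X (MvPolynomial.X i))
    refine ⟨P.map ev, (hP.map ev).ne_zero, fun v hv hvy => ?_⟩
    have h2 := congrArg (fun q : regFun k X => (q : X → k) ⟨v, hv⟩) hP0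
    let ev' : regFun k X →+* k := (Pi.evalRingHom (fun _ : X => k) ⟨v, hv⟩).comp
      (regFun k X).val.toRingHom
    have h3 : ev'.comp F.toRingHom = ev := by
      ext q
      subst hvy
      rfl
    change ev' (Polynomial.eval₂ F.toRingHom _ P) = 0 at h2
    rw [Polynomial.hom_eval₂, h3, ← Polynomial.eval_map] at h2
    have h4 : ev' (coordReg b X (MvPolynomial.X i)) = b.repr v i := by
      change coordFun b (MvPolynomial.X i) v = _
      rw [coordFun_apply, MvPolynomial.aeval_X]
    rwa [h4] at h2
  choose P hP0 hP using h1
  have h2 : (Set.univ.pi fun i => {c | (P i).IsRoot c}).Finite :=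
    Set.Finite.pi fun i => Polynomial.finite_setOfPred_isRoot (hP0 i)
  refine (h2.preimage (b.equivFun.injective.injOn)).subset ?_
  rintro v ⟨hv, hvy⟩ i -
  exact hP i v hv hvy

/-- Integral extensions preserve the Krull dimension. -/
theorem ringKrullDim_eq_of_isIntegral {A B : Type*} [CommRing A] [CommRing B] (f : A →+* B)
    (hf : Function.Injective f) (hi : f.IsIntegral) : ringKrullDim A = ringKrullDim B := by
  let _ := f.toAlgebra
  have : Algebra.IsIntegral A B := ⟨hi⟩
  have : FaithfulSMul A B := (faithfulSMul_iff_algebraMap_injective A B).2 hf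
  refine le_antisymm (iSup_le fun l => ?_) ?_
  · obtain ⟨Q, hQ, hQl⟩ := (inferInstance : Nonempty (Ideal.primesOver l.head.asIdeal B))
    obtain ⟨L, hL, -⟩ := Ideal.exists_ltSeries_of_hasGoingUp l Q
    rw [← hL]
    exact le_iSup (fun L : LTSeries (PrimeSpectrum B) => (L.length : WithBot ℕ∞)) L
  · refine Order.krullDim_le_of_strictMono (PrimeSpectrum.comap (algebraMap A B)) fun P Q h => ?_
    exact Ideal.IsIntegral.comap_lt_comap (show P.asIdeal < Q.asIdeal from h)

/-- A finite morphism preserves the dimension. -/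
theorem zdim_image_of_finite (φ : V →ₗ[k] W) {X : Set V} (hX : zclosure k X = X)
    (hφX : zclosure k (φ '' X) = φ '' X)
    (hfin : (comorphism φ (X := X) (Y := Set.univ) fun _ _ => Set.mem_univ _ :
      regFun k (Set.univ : Set W) →+* regFun k X).Finite) :
    zdim k (φ '' X) = zdim k X := by
  rw [zdim, zdim, hX, hφX]
  let F := comorphism φ (X := X) (Y := φ '' X) fun v hv => ⟨v, hv, rfl⟩
  let R := comorphism (LinearMap.id : W →ₗ[k] W) (X := φ '' X) (Y := Set.univ)
    fun _ _ => Set.mem_univ _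
  refine ringKrullDim_eq_of_isIntegral F.toRingHom ?_
    (RingHom.IsIntegral.tower_top R.toRingHom F.toRingHom hfin.to_isIntegral)
  intro p q hpq
  ext ⟨_, v, hv, rfl⟩
  exact congrFun (congrArg Subtype.val hpq) ⟨v, hv⟩

theorem zclosure_image (φ : V →ₗ[k] W) {O : Set V}
    (h : zclosure k (φ '' zclosure k O) = φ '' zclosure k O) :
    zclosure k (φ '' O) = φ '' zclosure k O := by
  refine subset_antisymm ?_ ?_
  · rw [← h]
    exact zclosure_mono (Set.image_mono (subset_zclosure O))
  · rintro _ ⟨v, hv, rfl⟩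
    rw [mem_zclosure] at hv ⊢
    intro q hq h0
    exact hv _ (comp_mem_polyFun φ hq) fun x hx => h0 _ ⟨x, hx, rfl⟩

end RegularFunctions

/-! ### Linear projections of cones -/

section ConeProjection
open Module

variable {k : Type*} [Field k] {V W : Type*} [AddCommGroup V] [Module k V]
  [AddCommGroup W] [Module k W] {ι κ : Type*}

theorem degree_eq_of_mem_support {p : MvPolynomial ι k} {d : ℕ} (hp : p.IsHomogeneous d)
    {s : ι →₀ ℕ} (hs : s ∈ p.support) : s.degree = d := by
  by_contra h
  exact MvPolynomial.mem_support_iff.1 hs (hp.coeff_eq_zero h)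

theorem aeval_smul_of_isHomogeneous [Fintype ι] {p : MvPolynomial ι k} {d : ℕ}
    (hp : p.IsHomogeneous d) (c : k) (x : ι → k) :
    MvPolynomial.aeval (fun i => c * x i) p = c ^ d * MvPolynomial.aeval x p := by
  rw [MvPolynomial.aeval_def, MvPolynomial.aeval_def, MvPolynomial.eval₂_eq',
    MvPolynomial.eval₂_eq', Finset.mul_sum]
  refine Finset.sum_congr rfl fun s hs => ?_
  have h1 : ∑ i, s i = d := by
    rw [← Finsupp.degree_eq_sum, degree_eq_of_mem_support hp hs]
  simp only [mul_pow, Finset.prod_mul_distrib, Finset.prod_pow_eq_pow_sum, h1]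
  ring

theorem homogeneousComponent_mul_of_isHomogeneous_one (a : MvPolynomial ι k)
    {l : MvPolynomial ι k} (hl : l.IsHomogeneous 1) (d : ℕ) :
    MvPolynomial.homogeneousComponent (d + 1) (a * l) =
      MvPolynomial.homogeneousComponent d a * l := by
  have h1 : ∀ e, MvPolynomial.homogeneousComponent (d + 1)
      (MvPolynomial.homogeneousComponent e a * l) =
        if d = e then MvPolynomial.homogeneousComponent d a * l else 0 := by
    intro e
    rw [MvPolynomial.homogeneousComponent_of_mem
      ((MvPolynomial.homogeneousComponent_isHomogeneous e a).mul hl)]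
    by_cases h : d = e
    · subst h; simp
    · simp [h]
  conv_lhs => rw [← MvPolynomial.sum_homogeneousComponent a, Finset.sum_mul, map_sum]
  simp only [h1, Finset.sum_ite_eq, Finset.mem_range]
  split_ifs with h
  · rfl
  · rw [MvPolynomial.homogeneousComponent_eq_zero _ _ (by omega), zero_mul]

/-- The ideal of a cone is homogeneous. -/
theorem coordReg_homogeneousComponent_eq_zero [Infinite k] [Fintype ι] (b : Basis ι k V)
    {X : Set V} (hcone : ∀ c : k, c ≠ 0 → ∀ v ∈ X, c • v ∈ X) {p : MvPolynomial ι k}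
    (hp : coordReg b X p = 0) (d : ℕ) :
    coordReg b X (MvPolynomial.homogeneousComponent d p) = 0 := by
  rw [coordReg_eq_zero_iff] at hp ⊢
  intro v hv
  let N := p.totalDegree + 1
  let Q : Polynomial k := ∑ e ∈ Finset.range N,
    Polynomial.monomial e (coordFun b (MvPolynomial.homogeneousComponent e p) v)
  have hQ : ∀ c : k, c ≠ 0 → Q.eval c = 0 := by
    intro c hc
    rw [← hp _ (hcone c hc v hv)]
    conv_rhs => rw [← MvPolynomial.sum_homogeneousComponent p, map_sum, Finset.sum_apply]
    rw [Polynomial.eval_finsetSum]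
    refine Finset.sum_congr rfl fun e _ => ?_
    rw [Polynomial.eval_monomial, coordFun_apply, coordFun_apply, mul_comm,
      ← aeval_smul_of_isHomogeneous (MvPolynomial.homogeneousComponent_isHomogeneous e p), map_smul]
    rfl
  have hQ0 : Q = 0 := by
    refine Polynomial.eq_zero_of_infinite_isRoot Q ?_
    exact (Set.infinite_univ.sdiff (Set.finite_singleton (0 : k))).mono fun c hc => hQ c hc.2
  by_cases hd : d < N
  · have h2 := congrArg (fun Q => Polynomial.coeff Q d) hQ0
    simp only [Q, Polynomial.finsetSum_coeff, Polynomial.coeff_monomial, Polynomial.coeff_zero,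
      Finset.sum_ite_eq', Finset.mem_range, hd, if_true] at h2
    exact h2
  · rw [MvPolynomial.homogeneousComponent_eq_zero _ _ (by omega), map_zero]
    rfl

/-- An ideal whose radical contains the variables contains the forms of large degree. -/
theorem exists_mem_of_isHomogeneous {I : Ideal (MvPolynomial ι k)} [Finite ι]
    (h : ∀ i, MvPolynomial.X i ∈ I.radical) :
    ∃ N : ℕ, 0 < N ∧ ∀ p : MvPolynomial ι k, ∀ d, N ≤ d → p.IsHomogeneous d → p ∈ I := by
  have h1 : MvPolynomial.idealOfVars ι k ≤ I.radical := by
    rw [MvPolynomial.idealOfVars, Ideal.span_le]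
    rintro _ ⟨i, rfl⟩
    exact h i
  obtain ⟨N, hN⟩ := Ideal.exists_pow_le_of_le_radical_of_fg_radical h1 (IsNoetherian.noetherian _)
  refine ⟨N + 1, N.succ_pos, fun p d hd hp => hN ?_⟩
  rw [MvPolynomial.mem_pow_idealOfVars_iff]
  intro s hs
  rw [degree_eq_of_mem_support hp hs]
  exact (Nat.le_succ N).trans hd

variable [IsAlgClosed k] [FiniteDimensional k V] [FiniteDimensional k W]

/-- A linear map restricted to a closed cone that meets its kernel only in the origin is a finite
morphism. By the Nullstellensatz and homogeneity, polynomials of large degree are, on the cone,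
combinations of the components of the map with coefficients of smaller degree. -/
theorem finite_comorphism_of_cone (φ : V →ₗ[k] W) {X : Set V} (hX : zclosure k X = X)
    (hcone : ∀ c : k, c ≠ 0 → ∀ v ∈ X, c • v ∈ X) (h0 : ∀ v ∈ X, φ v = 0 → v = 0) :
    (comorphism φ (X := X) (Y := Set.univ) fun _ _ => Set.mem_univ _ :
      regFun k (Set.univ : Set W) →+* regFun k X).Finite := by
  have := IsAlgClosed.instInfinite (K := k)
  let F := comorphism φ (X := X) (Y := Set.univ) fun _ _ => Set.mem_univ _
  let b := Module.finBasis k V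
  let c := Module.finBasis k W
  let r := coordReg b X
  let lp := fun j => coordLin b (c.coord j ∘ₗ φ)
  let I := RingHom.ker r.toRingHom
  let J := I ⊔ Ideal.span (Set.range lp)
  have hXr : ∀ i, MvPolynomial.X i ∈ J.radical := by
    intro i
    rw [← MvPolynomial.vanishingIdeal_zeroLocus_eq_radical (K := k),
      MvPolynomial.mem_vanishingIdeal_iff]
    intro x hx
    let v : V := b.equivFun.symm x
    have hv : ∀ p, coordFun b p v = MvPolynomial.aeval x p := by
      intro p
      rw [coordFun_apply]
      congr 2
      exact b.equivFun.apply_symm_apply x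
    have hv0 : v = 0 := by
      refine h0 v ?_ ?_
      · rw [← hX, mem_zclosure_iff_coordFun b]
        intro p hp
        rw [hv]
        exact hx p (Ideal.mem_sup_left hp)
      · refine c.ext_elem fun j => ?_
        have h1 := hx (lp j) (Ideal.mem_sup_right (Ideal.subset_span ⟨j, rfl⟩))
        rw [← hv, coordFun_coordLin] at h1
        simpa using h1
    rw [← hv, coordFun_apply, hv0]
    simp
  obtain ⟨N, hN0, hN⟩ := exists_mem_of_isHomogeneous hXr
  let _ := F.toRingHom.toAlgebra
  let S : Set (Fin (finrank k V) →₀ ℕ) := {s | s.degree < N}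
  have hS : S.Finite := by
    refine (Set.finite_Iic (Finsupp.equivFunOnFinite.symm fun _ => N)).subset fun s hs i => ?_
    exact (Finsupp.le_degree i s).trans (le_of_lt hs)
  let M : Submodule (regFun k (Set.univ : Set W)) (regFun k X) :=
    Submodule.span _ ((fun s => r (MvPolynomial.monomial s 1)) '' S)
  have hM : ∀ d, ∀ p : MvPolynomial (Fin (finrank k V)) k, p.IsHomogeneous d → r p ∈ M := by
    intro d
    induction d using Nat.strong_induction_on with
    | _ d ih =>
      intro p hp
      by_cases hd : d < N
      · rw [MvPolynomial.as_sum p, map_sum]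
        refine Submodule.sum_mem _ fun s hs => ?_
        have h1 : r (MvPolynomial.monomial s (p.coeff s)) =
            (algebraMap k (regFun k (Set.univ : Set W)) (p.coeff s)) •
              r (MvPolynomial.monomial s 1) := by
          have h2 : MvPolynomial.monomial s (p.coeff s) =
              p.coeff s • MvPolynomial.monomial s (1 : k) := by
            rw [MvPolynomial.smul_monomial, smul_eq_mul, mul_one]
          rw [h2, map_smul, Algebra.smul_def, Algebra.smul_def]
          rfl
        rw [h1]
        refine Submodule.smul_mem _ _ (Submodule.subset_span ⟨s, ?_, rfl⟩)
        change s.degree < N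
        rwa [degree_eq_of_mem_support hp hs]
      · obtain ⟨i, hi, q, hq, hiq⟩ := Submodule.mem_sup.1 (hN p d (not_lt.1 hd) hp)
        obtain ⟨a, rfl⟩ := Ideal.mem_span_range_iff_exists_fun.1 hq
        obtain ⟨d, rfl⟩ := Nat.exists_eq_add_of_le' (hN0.trans_le (not_lt.1 hd))
        have h1 : r p = ∑ j, (⟨fun w => c.coord j w, mem_regFun.2
            ⟨c.coord j, Algebra.subset_adjoin ⟨_, rfl⟩, rfl⟩⟩ : regFun k (Set.univ : Set W)) •
            r (MvPolynomial.homogeneousComponent d (a j)) := by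
          conv_lhs => rw [← MvPolynomial.homogeneousComponent_eq_self hp, ← hiq, map_add, map_add,
            coordReg_homogeneousComponent_eq_zero b hcone hi, zero_add, map_sum, map_sum]
          refine Finset.sum_congr rfl fun j _ => ?_
          rw [homogeneousComponent_mul_of_isHomogeneous_one _ (coordLin_isHomogeneous b _),
            map_mul, mul_comm, Algebra.smul_def]
          congr 1
          ext v
          rw [coordReg_apply, coordFun_coordLin]
          rfl
        rw [h1]
        exact Submodule.sum_mem _ fun j _ => Submodule.smul_mem _ _
          (ih d (by omega) _ (MvPolynomial.homogeneousComponent_isHomogeneous _ _))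
  have htop : M = ⊤ := by
    rw [eq_top_iff]
    rintro q -
    obtain ⟨p, rfl⟩ := coordReg_surjective b X q
    rw [← MvPolynomial.sum_homogeneousComponent p, map_sum]
    exact Submodule.sum_mem _ fun e _ =>
      hM e _ (MvPolynomial.homogeneousComponent_isHomogeneous _ _)
  have hfg : M.FG := Submodule.fg_span (hS.image _)
  rw [htop] at hfg
  exact ⟨hfg⟩

end ConeProjection

/-! ### Actions that move a matrix within a finite set -/

section FiniteOrbits
open Module

variable {k : Type*} [Field k] {n : ℕ}

/-- A rational curve in `GL n k` whose orbit through `e` is finite fixes `e`. -/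
theorem IsCurve.commute_of_finite [Infinite k] {γ : kˣ → GL (Fin n) k} (hγ : IsCurve γ)
    {e : Matrix (Fin n) (Fin n) k} {F : Set (Matrix (Fin n) (Fin n) k)} (hF : F.Finite)
    (h : ∀ t, (γ t : Matrix (Fin n) (Fin n) k) * e *
      (((γ t)⁻¹ : GL (Fin n) k) : Matrix (Fin n) (Fin n) k) ∈ F) (t : kˣ) :
    Commute (γ t : Matrix (Fin n) (Fin n) k) e := by
  classical
  let D := fun (v : Matrix (Fin n) (Fin n) k) t => (γ t : Matrix (Fin n) (Fin n) k) * e - v * γ t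
  -- The values that the orbit map does not take identically are avoided by some `t`.
  let s := hF.toFinset.filter fun v => ∃ t, D v t ≠ 0
  have hs : ∀ v ∈ s, ∃ l : Dual k (Matrix (Fin n) (Fin n) k), ∃ t, l (D v t) ≠ 0 := by
    intro v hv
    obtain ⟨t, ht⟩ := (Finset.mem_filter.1 hv).2
    by_contra! h0
    exact ht ((Module.forall_dual_apply_eq_zero_iff k _).1 fun l => h0 l t)
  choose! l hl using hs
  have hL : ∀ v ∈ s, IsLaurent fun t => l v (D v t) := by
    intro v _
    have := isLaurent_evm hγ.laurent
      (linPoly (l v ∘ₗ (LinearMap.mulRight k e - LinearMap.mulLeft k v)))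
    simp only [evm_linPoly] at this
    exact this
  obtain ⟨t₀, ht₀⟩ := IsLaurent.exists_forall_ne_zero s _ hL hl
  set v := (γ t₀ : Matrix (Fin n) (Fin n) k) * e *
    (((γ t₀)⁻¹ : GL (Fin n) k) : Matrix (Fin n) (Fin n) k) with hv
  have hvs : v ∉ s := by
    intro hvs
    apply ht₀ v hvs
    have : D v t₀ = 0 := by
      simp only [D, hv, mul_assoc, ← Units.val_mul, inv_mul_cancel]
      simp
    rw [this, map_zero]
  have hD : ∀ t, D v t = 0 := by
    by_contra! h0
    exact hvs (Finset.mem_filter.2 ⟨hF.mem_toFinset.2 (h t₀), h0⟩)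
  have hve : v = e := by
    have := hD 1
    simp only [D, hγ.one, Units.val_one, one_mul, mul_one, sub_eq_zero] at this
    exact this.symm
  have := hD t
  rw [hve] at this
  exact sub_eq_zero.1 this

/-- If the elements of `K` that commute with all that commutes with `A ∈ Lie K` move `e` within a
finite set, then `A` commutes with `e`. -/
theorem commute_of_finite [IsAlgClosed k] [CharZero k] {K : Subgroup (GL (Fin n) k)}
    (hK : IsAlgebraic K) {A e : Matrix (Fin n) (Fin n) k} (hA : A ∈ lieAlg K)
    {F : Set (Matrix (Fin n) (Fin n) k)} (hF : F.Finite)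
    (h : ∀ g ∈ K, (∀ B, Commute A B → Commute (g : Matrix (Fin n) (Fin n) k) B) →
      (g : Matrix (Fin n) (Fin n) k) * e *
        ((g⁻¹ : GL (Fin n) k) : Matrix (Fin n) (Fin n) k) ∈ F) : Commute A e := by
  have := IsAlgClosed.instInfinite (K := k)
  refine mem_commutant.1 ((Submodule.span_le (p := commutant {e})).2 ?_
    (mem_span_curves hK hA)) e rfl
  rintro _ ⟨γ, hγ, hγK, hγA, t, rfl⟩
  rw [SetLike.mem_coe, Submodule.sub_mem_iff_left _ (one_mem_commutant _), mem_commutant]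
  rintro B rfl
  exact hγ.commute_of_finite hF (fun t => h _ (hγK t) (hγA t)) t

/-- If `K` moves `e` within a finite set, then the stabilizer of `e` in `K` has the same Lie algebra
as `K`. -/
theorem lieAlg_le_of_finite {K L : Subgroup (GL (Fin n) k)} {e : Matrix (Fin n) (Fin n) k}
    {F : Set (Matrix (Fin n) (Fin n) k)} (hF : F.Finite)
    (h : ∀ g ∈ K, (g : Matrix (Fin n) (Fin n) k) * e *
      ((g⁻¹ : GL (Fin n) k) : Matrix (Fin n) (Fin n) k) ∈ F)
    (hL : ∀ g ∈ K, (g : Matrix (Fin n) (Fin n) k) * e *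
      ((g⁻¹ : GL (Fin n) k) : Matrix (Fin n) (Fin n) k) = e → g ∈ L) :
    lieAlg K ≤ lieAlg L := by
  classical
  intro A hA
  rw [mem_lieAlg_iff] at hA ⊢
  intro p hp
  have hs : ∀ v, v ≠ e → ∃ f : Dual k (Matrix (Fin n) (Fin n) k), f (e - v) ≠ 0 := by
    intro v hv
    by_contra! h0
    exact hv (sub_eq_zero.1 ((Module.forall_dual_apply_eq_zero_iff k _).1 h0)).symm
  choose! f hf using hs
  let l := fun v => f v ∘ₗ (LinearMap.mulRight k e - LinearMap.mulLeft k v)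
  have hl : ∀ v M, l v M = f v (M * e - v * M) := fun v M => rfl
  -- The polynomial `q` vanishes on the elements of `K` that move `e`, but not at `1`.
  let q := ∏ v ∈ hF.toFinset.erase e, linPoly (l v)
  have hq1 : evm (1 : Matrix (Fin n) (Fin n) k) q ≠ 0 := by
    rw [map_prod, Finset.prod_ne_zero_iff]
    intro v hv
    rw [evm_linPoly, hl, one_mul, mul_one]
    exact hf v (Finset.ne_of_mem_erase hv)
  have h1 := hA (p * q) (mem_groupIdeal.2 fun g hg => by
    rw [map_mul]
    by_cases hge : (g : Matrix (Fin n) (Fin n) k) * e *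
      ((g⁻¹ : GL (Fin n) k) : Matrix (Fin n) (Fin n) k) = e
    · rw [mem_groupIdeal.1 hp g (hL g hg hge), zero_mul]
    · refine mul_eq_zero_of_right _ ?_
      rw [map_prod]
      refine Finset.prod_eq_zero
        (Finset.mem_erase.2 ⟨hge, hF.mem_toFinset.2 (h g hg)⟩) ?_
      rw [evm_linPoly, hl, mul_assoc _ _ (g : Matrix (Fin n) (Fin n) k), ← Units.val_mul]
      simp)
  have h2 : evm (1 : Matrix (Fin n) (Fin n) k) p = 0 := by
    simpa using mem_groupIdeal.1 hp 1 (one_mem L)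
  rw [dir_mul, h2, zero_mul, zero_add] at h1
  exact (mul_eq_zero.1 h1).resolve_left hq1

end FiniteOrbits

/-! ### The projection to the Lie algebra of a subgroup -/

section Projection
open Module

variable {k : Type*} [Field k] {n : ℕ} {G H : Subgroup (GL (Fin n) k)}

theorem mem_adOrbit {x y : lieAlg G} :
    y ∈ adOrbit G x ↔ ∃ g, ∃ hg : g ∈ G, y = adEquiv g hg x := by
  constructor
  · rintro ⟨g, hg, h⟩
    exact ⟨g, hg, Subtype.ext h⟩
  · rintro ⟨g, hg, rfl⟩
    exact ⟨g, hg, rfl⟩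

theorem map_mem_zclosure {V : Type*} [AddCommGroup V] [Module k V] (φ : V →ₗ[k] V) {O : Set V}
    (h : ∀ v ∈ O, φ v ∈ O) {v : V} (hv : v ∈ zclosure k O) : φ v ∈ zclosure k O := by
  rw [mem_zclosure] at hv ⊢
  exact fun q hq h0 => hv _ (comp_mem_polyFun φ hq) fun x hx => h0 _ (h x hx)

theorem adEquiv_mem_zclosure {x e : lieAlg G} (he : e ∈ zclosure k (adOrbit G x))
    {g : GL (Fin n) k} (hg : g ∈ G) : adEquiv g hg e ∈ zclosure k (adOrbit G x) := by
  refine map_mem_zclosure ((adEquiv g hg : lieAlg G →ₗ⁅k⁆ lieAlg G) : lieAlg G →ₗ[k] lieAlg G)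
    (fun v hv => ?_) he
  obtain ⟨g', hg', rfl⟩ := mem_adOrbit.1 hv
  refine mem_adOrbit.2 ⟨g * g', mul_mem hg hg', Subtype.ext ?_⟩
  change ((adEquiv g hg (adEquiv g' hg' x) : lieAlg G) : Matrix (Fin n) (Fin n) k) = _
  rw [coe_adEquiv, coe_adEquiv, coe_adEquiv, mul_inv_rev, Units.val_mul, Units.val_mul]
  simp only [mul_assoc]

theorem adEquiv_eq_self_of_commute {g : GL (Fin n) k} (hg : g ∈ G) {y : lieAlg G}
    (h : Commute (g : Matrix (Fin n) (Fin n) k) y) : adEquiv g hg y = y := by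
  ext1
  rw [coe_adEquiv, h.eq, mul_assoc, ← Units.val_mul, mul_inv_cancel, Units.val_one, mul_one]

/-- An element of `G` that centralizes `Lie H` stabilizes the orthogonal complement of `Lie H`. -/
theorem adEquiv_mem_orthCompl_of_commute {g : GL (Fin n) k} (hg : g ∈ G)
    (h : ∀ z ∈ lieSub G H, Commute (g : Matrix (Fin n) (Fin n) k) z) {y : lieAlg G}
    (hy : y ∈ orthCompl G H) : adEquiv g hg y ∈ orthCompl G H := by
  rw [mem_orthCompl] at hy ⊢
  intro z hz
  have h1 := LieAlgebra.killingForm_of_equiv_apply (adEquiv g hg) z y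
  rw [adEquiv_eq_self_of_commute hg (h z hz)] at h1
  rw [h1]
  exact hy z hz

variable (hc : IsCompl (lieSub G H).toSubmodule (orthCompl G H))

theorem sub_projection_mem (e : lieAlg G) :
    e - (lieSub G H).toSubmodule.projectionOnto (orthCompl G H) hc e ∈ orthCompl G H := by
  rw [← Submodule.projectionOnto_apply_eq_zero_iff hc, map_sub, Submodule.projectionOnto_apply_left,
    sub_self]

theorem projection_eq_of_mem {a b : lieAlg G} (ha : a ∈ lieSub G H) (hb : b ∈ orthCompl G H) :
    (lieSub G H).toSubmodule.projectionOnto (orthCompl G H) hc (a + b) = ⟨a, ha⟩ := by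
  rw [map_add, Submodule.projectionOnto_apply_of_mem_right hc hb, add_zero]
  exact Submodule.projectionOnto_apply_of_mem_left hc ha

/-- The projection to `Lie H` commutes with automorphisms that preserve both summands. -/
theorem projection_adEquiv {g : GL (Fin n) k} (hg : g ∈ G)
    (h1 : ∀ y ∈ lieSub G H, adEquiv g hg y ∈ lieSub G H)
    (h2 : ∀ y ∈ orthCompl G H, adEquiv g hg y ∈ orthCompl G H) (e : lieAlg G) :
    ((lieSub G H).toSubmodule.projectionOnto (orthCompl G H) hc (adEquiv g hg e) : lieAlg G) =
      adEquiv g hg ((lieSub G H).toSubmodule.projectionOnto (orthCompl G H) hc e : lieAlg G) := by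
  set a : lieAlg G := ((lieSub G H).toSubmodule.projectionOnto (orthCompl G H) hc e : lieAlg G)
    with ha
  have h3 : e = a + (e - a) := by abel
  have h4 : adEquiv g hg e = adEquiv g hg a + adEquiv g hg (e - a) := by
    rw [← map_add, ← h3]
  rw [h4, projection_eq_of_mem hc (h1 a (Submodule.coe_mem _)) (h2 _ (sub_projection_mem hc e))]

/-- The elements of `G` that preserve `Lie H` and its orthogonal complement and fix the component
of `e` in `Lie H` move `e` within a fibre of the projection. -/
theorem conj_mem_fiber {x e : lieAlg G} (he : e ∈ zclosure k (adOrbit G x)) {g : GL (Fin n) k}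
    (hg : g ∈ G) (h1 : ∀ y ∈ lieSub G H, adEquiv g hg y ∈ lieSub G H)
    (h2 : ∀ y ∈ orthCompl G H, adEquiv g hg y ∈ orthCompl G H)
    (h3 : Commute (g : Matrix (Fin n) (Fin n) k)
      ((lieSub G H).toSubmodule.projectionOnto (orthCompl G H) hc e : lieAlg G)) :
    (g : Matrix (Fin n) (Fin n) k) * e * ((g⁻¹ : GL (Fin n) k) : Matrix (Fin n) (Fin n) k) ∈
      (fun v : lieAlg G => (v : Matrix (Fin n) (Fin n) k)) '' {v | v ∈ zclosure k (adOrbit G x) ∧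
        (lieSub G H).toSubmodule.projectionOnto (orthCompl G H) hc v =
          (lieSub G H).toSubmodule.projectionOnto (orthCompl G H) hc e} := by
  refine ⟨adEquiv g hg e, ⟨adEquiv_mem_zclosure he hg, Subtype.ext ?_⟩, rfl⟩
  rw [projection_adEquiv hc hg h1 h2, adEquiv_eq_self_of_commute hg h3]

/-- An element of the closure of the orbit commutes with its component in `Lie H`: the fibre of the
projection through it is finite and stable under the stabilizer of the component. -/
theorem commute_projection [IsAlgClosed k] [CharZero k] (hHG : H ≤ G) (hH : IsAlgebraic H)
    {x e : lieAlg G} (he : e ∈ zclosure k (adOrbit G x))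
    (hfin : ∀ a, {v | v ∈ zclosure k (adOrbit G x) ∧
      (lieSub G H).toSubmodule.projectionOnto (orthCompl G H) hc v = a}.Finite) :
    Commute (((lieSub G H).toSubmodule.projectionOnto (orthCompl G H) hc e : lieAlg G) :
      Matrix (Fin n) (Fin n) k) e :=
  commute_of_finite hH (Submodule.coe_mem
    ((lieSub G H).toSubmodule.projectionOnto (orthCompl G H) hc e)) ((hfin _).image _)
    fun _ hg hcomm => conj_mem_fiber hc he (hHG hg) (fun _ hy => conj_mem_lieAlg hg hy)
      (fun _ hy => adEquiv_mem_orthCompl hHG hg hy) (hcomm _ (Commute.refl _))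

/-- The stabilizer in `H` of the component `a` of `e` in `Lie H` moves `e` within a finite fibre, so
its Lie algebra is contained in that of the stabilizer of the other component. -/
theorem lieAlg_adStab_le (hHG : H ≤ G) {x e : lieAlg G} (he : e ∈ zclosure k (adOrbit G x))
    (hfin : ∀ a, {v | v ∈ zclosure k (adOrbit G x) ∧
      (lieSub G H).toSubmodule.projectionOnto (orthCompl G H) hc v = a}.Finite) {a : lieAlg G}
    (ha : a = (lieSub G H).toSubmodule.projectionOnto (orthCompl G H) hc e) :
    lieAlg (adStab H a) ≤ lieAlg (adStab H (e - a : lieAlg G)) := by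
  refine lieAlg_le_of_finite (e := e) ((hfin
    ((lieSub G H).toSubmodule.projectionOnto (orthCompl G H) hc e)).image
      fun v : lieAlg G => (v : Matrix (Fin n) (Fin n) k)) (fun g hg => ?_) (fun g hg hge => ?_)
  · refine conj_mem_fiber hc he (hHG hg.1) (fun _ hy => conj_mem_lieAlg hg.1 hy)
      (fun _ hy => adEquiv_mem_orthCompl hHG hg.1 hy) ?_
    rw [← ha]
    have h1 := congrArg (fun M => M * (g : Matrix (Fin n) (Fin n) k)) hg.2
    simpa [mul_assoc, Commute, SemiconjBy] using h1
  · refine ⟨hg.1, ?_⟩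
    rw [AddSubgroupClass.coe_sub, mul_sub, sub_mul, hge, hg.2]

/-- The centralizer of `Lie H` is trivial: it commutes with the orbit, by finiteness of the fibres
of the projection, and the orbit of a nonzero element has trivial centralizer. -/
theorem centralizer_eq_zero [IsAlgClosed k] [CharZero k] (hG : IsSimpleAlgGroup G)
    {x : lieAlg G} (hx : x ≠ 0)
    (hfin : ∀ a, {v | v ∈ zclosure k (adOrbit G x) ∧
      (lieSub G H).toSubmodule.projectionOnto (orthCompl G H) hc v = a}.Finite) {z : lieAlg G}
    (hz : ∀ y ∈ lieSub G H, Commute (z : Matrix (Fin n) (Fin n) k) y) : z = 0 := by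
  have h1 : ∀ e ∈ adOrbit G x, Commute (z : Matrix (Fin n) (Fin n) k) e := fun e he =>
    commute_of_finite hG.isAlgebraic z.2 ((hfin _).image _) fun g hg hcomm => by
      have h2 : ∀ y ∈ lieSub G H, Commute (g : Matrix (Fin n) (Fin n) k) y := fun y hy =>
        hcomm _ (hz y hy)
      refine conj_mem_fiber hc (subset_zclosure _ he) hg (fun y hy => ?_)
        (fun _ hy => adEquiv_mem_orthCompl_of_commute hg h2 hy) (h2 _ (Submodule.coe_mem _))
      rwa [adEquiv_eq_self_of_commute hg (h2 y hy)]
  rcases commutant_trivial_or hG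
    ((fun v : lieAlg G => (v : Matrix (Fin n) (Fin n) k)) '' adOrbit G x) (by
      rintro g hg _ ⟨e, he, rfl⟩
      obtain ⟨g', hg', rfl⟩ := mem_adOrbit.1 he
      refine ⟨_, mem_adOrbit.2 ⟨g * g', mul_mem hg hg', rfl⟩, ?_⟩
      simp only [coe_adEquiv, mul_inv_rev, Units.val_mul, mul_assoc]) with h2 | h2
  · refine Subtype.ext (h2 z z.2 ?_)
    rintro _ ⟨e, he, rfl⟩
    exact h1 e he
  · refine absurd (Subtype.ext (center_lieAlg_trivial hG x.2 fun B hB => ?_)) hx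
    exact (commute_of_mem_lieAlg (fun g hg => h2 g hg _
      ⟨x, mem_adOrbit.2 ⟨1, one_mem G, by ext1; simp [coe_adEquiv]⟩, rfl⟩) hB).symm

end Projection

/-! ### Semisimplicity -/

section Semisimple
open Module

/-- If the elements of an ideal `I` of `L` act nilpotently on `M`, then they are orthogonal to `L`
for the trace form of `M`: by Engel's theorem there is an `L`-stable flag lowered by `I`. -/
theorem trace_eq_zero_of_mem_ideal {k L M : Type*} [Field k] [LieRing L]
    [LieAlgebra k L] [AddCommGroup M] [Module k M] [LieRingModule L M] [LieModule k L M]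
    [FiniteDimensional k M]
    {I : LieIdeal k L} [IsNoetherian k I]
    (hI : ∀ y ∈ I, IsNilpotent (LieModule.toEnd k L M y)) {y : L} (hy : y ∈ I) (w : L) :
    LinearMap.trace k M (LieModule.toEnd k L M y ∘ₗ LieModule.toEnd k L M w) = 0 := by
  have h1 : LieModule.IsNilpotent I M := by
    rw [LieModule.isNilpotent_iff_forall (R := k)]
    exact fun z => hI z z.2
  obtain ⟨N, hN⟩ := (LieModule.isNilpotent_iff k I M).1 h1
  have h2 : ∀ j m, ((LieModule.toEnd k L M y ∘ₗ LieModule.toEnd k L M w) ^ j) m ∈ I.lcs M j := by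
    intro j
    induction j with
    | zero => simp
    | succ j ih =>
      intro m
      rw [pow_succ', LieIdeal.lcs_succ]
      exact LieSubmodule.lie_mem_lie hy (LieSubmodule.lie_mem _ (ih m))
  refine (LinearMap.isNilpotent_trace_of_isNilpotent ⟨N, ?_⟩).eq_zero
  ext m
  have h3 := h2 N m
  rw [← LieSubmodule.mem_toSubmodule, LieIdeal.coe_lcs_eq, hN] at h3
  exact h3

variable {k : Type*} [Field k] [IsAlgClosed k] {n : ℕ} {G H : Subgroup (GL (Fin n) k)}

/-- If the centralizer of `Lie H` in `Lie G` is trivial, then the elements of an abelian ideal of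
`Lie H` are ad-nilpotent: their semisimple parts centralize `Lie H`. -/
theorem isNilpotent_of_mem_abelian (hHG : H ≤ G)
    (hcent : ∀ z : lieAlg G, (∀ y ∈ lieSub G H, Commute (z : Matrix (Fin n) (Fin n) k) y) → z = 0)
    {I : LieIdeal k (lieSub G H)} [IsLieAbelian I] {y : lieSub G H} (hy : y ∈ I) :
    IsNilpotent (LieAlgebra.ad k (lieAlg G) y) := by
  have hs := scalM_mem_lieAlg (K := H) y.2 (AddMonoidHom.id k)
  have h1 := hcent ⟨_, lieAlg_mono hHG hs⟩ fun w hw => by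
    have h2 : (w : lieAlg G) ∈
        End.maxGenEigenspace (LieAlgebra.ad k (lieAlg G) (y : lieAlg G)) 0 := by
      rw [End.mem_maxGenEigenspace]
      refine ⟨2, ?_⟩
      have h3 : ⁅y, (⟨w, hw⟩ : lieSub G H)⁆ ∈ I := by
        rw [← lie_skew]
        exact neg_mem (lie_mem_right k _ I _ _ hy)
      have h4 : ⁅(⟨y, hy⟩ : I), (⟨_, h3⟩ : I)⁆ = 0 := LieModule.IsTrivial.trivial _ _
      have h5 : ⁅(y : lieAlg G), ⁅(y : lieAlg G), w⁆⁆ = 0 :=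
        congrArg (fun z : I => ((z : lieSub G H) : lieAlg G)) h4
      simpa [pow_two] using h5
    have h3 := scalM_mul_sub_mul_scalM h2 (AddMonoidHom.id k)
    simp only [map_zero, zero_smul, sub_eq_zero] at h3
    exact h3
  have h2 := isNilpotent_sub_scalM (((y : lieAlg G)) : Matrix (Fin n) (Fin n) k)
  have h3 : scalM (((y : lieAlg G)) : Matrix (Fin n) (Fin n) k) id = 0 := congrArg Subtype.val h1
  rw [h3, sub_zero] at h2
  exact LieSubalgebra.isNilpotent_ad_of_isNilpotent_ad _ (LieAlgebra.ad_nilpotent_of_nilpotent h2)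

/-- If the centralizer of `Lie H` in `Lie G` is trivial and the Killing form of `Lie G` is
nondegenerate on `Lie H`, then `Lie H` is semisimple: an abelian ideal would be in the radical of
the form. -/
theorem isSemisimple_lieSub (hHG : H ≤ G)
    (hc : IsCompl (lieSub G H).toSubmodule (orthCompl G H))
    (hcent : ∀ z : lieAlg G,
      (∀ y ∈ lieSub G H, Commute (z : Matrix (Fin n) (Fin n) k) y) → z = 0) :
    LieAlgebra.IsSemisimple k (lieSub G H) := by
  let Φ : LinearMap.BilinForm k (lieSub G H) :=
    (killingForm k (lieAlg G)).restrict (lieSub G H).toSubmodule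
  have hΦ : ∀ y w : lieSub G H, Φ y w = killingForm k (lieAlg G) y w := fun _ _ => rfl
  have hsymm : ∀ y w, Φ y w = Φ w y := fun y w => by rw [hΦ, hΦ, killingForm_comm']
  have hleft : ∀ y, (∀ w, Φ w y = 0) → y = 0 := by
    intro y h
    have h1 : (y : lieAlg G) ∈ orthCompl G H := mem_orthCompl.2 fun w hw => h ⟨w, hw⟩
    exact Subtype.ext ((Submodule.disjoint_def.1 hc.disjoint) y y.2 h1)
  refine LieAlgebra.InvariantForm.isSemisimple_of_nondegenerate Φ
    ⟨fun y h => hleft y fun w => by rw [hsymm, h], hleft⟩ (fun y z w => ?_)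
    (fun y w h => by rw [hsymm, h]) fun I hI hab => ?_
  · rw [hΦ, hΦ, LieSubalgebra.coe_bracket, LieSubalgebra.coe_bracket, ← lie_skew, map_neg,
      LinearMap.neg_apply, killingForm_lie]
  · refine hI.1 ((LieSubmodule.eq_bot_iff _).2 fun y hy => hleft y fun w => ?_)
    rw [hsymm, hΦ, killingForm_apply_apply]
    exact trace_eq_zero_of_mem_ideal (M := lieAlg G)
      (fun z hz => isNilpotent_of_mem_abelian hHG hcent hz) hy w

end Semisimple

end NilpProj

end

open NilpProj in
theorem proposition3p2 {k : Type*} [Field k] [IsAlgClosed k] [CharZero k] {n : ℕ}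
    (G H : Subgroup (GL (Fin n) k)) (hG : IsSimpleAlgGroup G)
    (hH : IsReductive H) (hHG : H ≤ G)
    (x : lieAlg G) (hx : IsNilpotent (LieAlgebra.ad k (lieAlg G) x))
    (hP : zclosure k (adOrbit G x) ∩ (orthCompl G H : Set (lieAlg G)) = {0}) :
    ∃ hc : IsCompl (lieSub G H).toSubmodule (orthCompl G H),
      let φ : lieAlg G →ₗ[k] lieSub G H :=
        (lieSub G H).toSubmodule.projectionOnto (orthCompl G H) hc
      (IsFiniteMorphism k (X := zclosure k (adOrbit G x)) (Y := (Set.univ : Set (lieSub G H)))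
          (fun e => ⟨φ e, Set.mem_univ _⟩) ∧
        zclosure k (φ '' adOrbit G x) = φ '' zclosure k (adOrbit G x) ∧
        zdim k (φ '' adOrbit G x) = zdim k (adOrbit G x)) ∧
      (∀ e ∈ zclosure k (adOrbit G x), ∀ a b : lieAlg G, a = φ e → b = e - a →
        ⁅a, b⁆ = 0 ∧ lieAlg (adStab H a) ≤ lieAlg (adStab H b)) ∧
      (x ≠ 0 →
        {z : lieAlg G | ∀ y ∈ lieSub G H, ⁅y, z⁆ = 0} = {0} ∧
        LieAlgebra.IsSemisimple k (lieSub G H)) := by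
  have hc := isCompl_lieSub_orthCompl hG hHG hH
  refine ⟨hc, ?_⟩
  intro φ
  have hX := zclosure_zclosure (k := k) (adOrbit G x)
  have hcone : ∀ c : k, c ≠ 0 → ∀ v ∈ zclosure k (adOrbit G x),
      c • v ∈ zclosure k (adOrbit G x) := fun c hc v hv =>
    map_mem_zclosure (LinearMap.lsmul k (lieAlg G) c) (fun _ hv => smul_mem_adOrbit hG hx hc hv) hv
  have h0 : ∀ v ∈ zclosure k (adOrbit G x), φ v = 0 → v = 0 := fun v hv hφ => by
    have h1 : v ∈ zclosure k (adOrbit G x) ∩ (orthCompl G H : Set (lieAlg G)) :=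
      ⟨hv, (Submodule.projectionOnto_apply_eq_zero_iff hc).1 hφ⟩
    rwa [hP] at h1
  have hfin := finite_comorphism_of_cone φ hX hcone h0
  have himg := image_closed_of_finite φ hX hfin
  have hcl := zclosure_image φ himg
  have hfib := finite_fiber_of_finite φ hfin
  refine ⟨⟨⟨pullback_mem_regFun φ fun _ _ => Set.mem_univ _, hfin⟩, hcl, ?_⟩, ?_, fun hx0 => ?_⟩
  · have h1 := zdim_image_of_finite φ hX himg hfin
    rw [← hcl] at h1
    rwa [zdim_zclosure, zdim_zclosure] at h1
  · rintro e he a b ha rfl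
    refine ⟨?_, lieAlg_adStab_le hc hHG he hfib ha⟩
    have h1 := commute_projection hc hHG hH.isAlgebraic he hfib
    rw [lie_sub, lie_self, sub_zero, ha]
    exact Subtype.ext (commute_iff_lie_eq.1 h1)
  · have hcent : ∀ z : lieAlg G,
        (∀ y ∈ lieSub G H, Commute (z : Matrix (Fin n) (Fin n) k) y) → z = 0 :=
      fun z hz => centralizer_eq_zero hc hG hx0 hfib hz
    refine ⟨?_, isSemisimple_lieSub hHG hc hcent⟩
    ext z
    refine ⟨fun hz => hcent z fun y hy => ?_, ?_⟩
    · exact (commute_iff_lie_eq.2 (congrArg Subtype.val (hz y hy))).symm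
    · rintro rfl y -
      exact lie_zero y
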